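/- Let $\mathcal X,\mathcal X_1,\mathcal S,\mathcal S_d,\hat{\mathcal S}_d,\mathcal Y,\mathcal Y_1$ be finite non-empty alphabets, $P_{SS_d}$ a pmf on $\mathcal S\times\mathcal S_d$, $P_{YY_1|XX_1S}$ a family of transition pmfs, and $d:\mathcal S_d\times\hat{\mathcal S}_d\to[0,\infty)$ a distortion function. Consider the state-dependent memoryless relay channel in which the pairs $(S_i,S_{d,i})$ are i.i.d. with law $P_{SS_d}$, independent of the message, and, in channel use $i$, the outputs $(Y_i,Y_{1,i})$ at the destination and the relay are drawn from $P_{YY_1|XX_1S}(\cdot|X_i,X_{1,i},S_i)$. For $R\ge 0$, a $(2^{nR},n)$ code consists of a message $W$ uniform on $\{1,\dots,2^{\lceil nR\rceil}\}$, a source encoder $x^n=e_n(w)$, relay encoders $x_{1,i}=f_i(y_1^{i-1})$ ($1\le i\le n$), a message decoder $\hat w=h_n(y^n)$ and a state estimator $\hat s_d^n=g_n(y^n)\in\hat{\mathcal S}_d^n$ at the destination. A pair $(R,D)$ is achievable if there is a sequence of $(2^{nR},n)$ codes with $\lim_{n\to\infty}\Pr(\hat W\ne W)=0$ and $\limsup_{n\to\infty}\frac1n\sum_{i=1}^n\mathbb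 E[d(S_{d,i},\hat S_{d,i})]\le D$. Let $D_{\min}$ be the minimum of all $D$ such that $(R,D)$ is achievable for some $R\ge0$. Then this minimum exists, and $$D_{\min}=\min_{P_{XX_1}P_{V|XX_1Y_1}}\mathbb E\big[d(S_d,\hat S_d(X,X_1,Y,V))\big],$$ where the minimum (which is attained) is over all finite alphabets $\mathcal V$ and all pmfs $P_{XX_1}$, $P_{V|XX_1Y_1}$ such that $$I(X_1;Y|X)\ \ge\ I(V;Y_1|X,X_1,Y),$$ the joint pmf of $(X,X_1,S,S_d,Y,Y_1,V)$ is $P_{XX_1}P_{SS_d}P_{YY_1|XX_1S}P_{V|XX_1Y_1}$, and $$\hat S_d(x,x_1,y,v)\in\operatorname*{arg\,min}_{s'\in\hat{\mathcal S}_d}\ \sum_{s_d\in\mathcal S_d}P_{S_d|XX_1YV}(s_d|x,x_1,y,v)\,d(s_d,s')$$ (ties, and points $(x,x_1,y,v)$ of probability zero, being resolved arbitrarily). -/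

import Mathlib

open Filter Topology

namespace RelayISAC

noncomputable section

/-! ### Finite probability and information measures

Probability mass functions on a finite type are the elements of Mathlib's `stdSimplex ℝ α`:
nonnegative real functions that sum to one. -/

open Classical in
/-- The pmf of the random variable `A`, defined on the finite sample space `Ω` with pmf `P`. -/
def pmfOf {Ω α : Type*} [Fintype Ω] (P : Ω → ℝ) (A : Ω → α) (a : α) : ℝ :=
  ∑ ω, if A ω = a then P ω else 0

/-- Expectation of a real random variable. -/
def expect {Ω : Type*} [Fintype Ω] (P : Ω → ℝ) (F : Ω → ℝ) : ℝ :=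
  ∑ ω, P ω * F ω

open Classical in
/-- Probability of an event. -/
def prob {Ω : Type*} [Fintype Ω] (P : Ω → ℝ) (E : Ω → Prop) : ℝ :=
  ∑ ω, if E ω then P ω else 0

/-- The entropy `H(A)` in bits (`0 log 0 = 0`). -/
def entropy {Ω α : Type*} [Fintype Ω] [Fintype α] (P : Ω → ℝ) (A : Ω → α) : ℝ :=
  -∑ a, pmfOf P A a * Real.logb 2 (pmfOf P A a)

/-- The conditional entropy `H(A | C) = H(A, C) - H(C)`. -/
def condEntropy {Ω α γ : Type*} [Fintype Ω] [Fintype α] [Fintype γ]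
    (P : Ω → ℝ) (A : Ω → α) (C : Ω → γ) : ℝ :=
  entropy P (fun ω => (A ω, C ω)) - entropy P C

/-- The conditional mutual information `I(A; B | C) = H(A | C) - H(A | B, C)`. -/
def condMutualInfo {Ω α β γ : Type*} [Fintype Ω] [Fintype α] [Fintype β] [Fintype γ]
    (P : Ω → ℝ) (A : Ω → α) (B : Ω → β) (C : Ω → γ) : ℝ :=
  condEntropy P A C - condEntropy P A (fun ω => (B ω, C ω))

/-! ### The channel and its codes -/

/-- A state-dependent discrete memoryless relay channel with sensing parameter: the pmf
`P_{S S_d}` of state and parameter, and the transition pmfs `P_{Y Y₁ | X X₁ S}`. -/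
structure RelayChannel (X X₁ S Sd Y Y₁ : Type*)
    [Fintype S] [Fintype Sd] [Fintype Y] [Fintype Y₁] where
  /-- `P_{S S_d}` -/
  state : S × Sd → ℝ
  state_mem : state ∈ stdSimplex ℝ (S × Sd)
  /-- `P_{Y Y₁ | X X₁ S}` -/
  trans : X → X₁ → S → Y × Y₁ → ℝ
  trans_mem : ∀ x x₁ s, trans x x₁ s ∈ stdSimplex ℝ (Y × Y₁)

/-- A code with `M` messages and `n` channel uses. In channel use `i` the relay sees only its own
past outputs. -/
structure RelayCode (X X₁ Y Y₁ Shat : Type*) (M n : ℕ) where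
  /-- source encoder `x^n = e_n(w)` -/
  enc : Fin M → Fin n → X
  /-- relay encoders `x_{1,i} = f_i(y_1^{i-1})` -/
  relay : (i : Fin n) → (Fin i → Y₁) → X₁
  /-- message decoder `h_n(y^n)` -/
  dec : (Fin n → Y) → Fin M
  /-- state estimator `g_n(y^n)` -/
  est : (Fin n → Y) → Fin n → Shat

/-- The outcomes `(w, s^n, s_d^n, y^n, y_1^n)` of a transmission. -/
abbrev BlockOutcome (S Sd Y Y₁ : Type*) (M n : ℕ) : Type _ :=
  Fin M × (Fin n → S) × (Fin n → Sd) × (Fin n → Y) × (Fin n → Y₁)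

/-- The outcomes `(x, x₁, s, s_d, y, y₁, v)` in the single-letter expression; the auxiliary
variable `V` takes values in an alphabet of size `k`. -/
abbrev LetterOutcome (X X₁ S Sd Y Y₁ : Type*) (k : ℕ) : Type _ :=
  X × X₁ × S × Sd × Y × Y₁ × Fin k

namespace LetterOutcome

variable {X X₁ S Sd Y Y₁ : Type*} {k : ℕ}

def rvX (ω : LetterOutcome X X₁ S Sd Y Y₁ k) : X := ω.1
def rvX₁ (ω : LetterOutcome X X₁ S Sd Y Y₁ k) : X₁ := ω.2.1
def rvS (ω : LetterOutcome X X₁ S Sd Y Y₁ k) : S := ω.2.2.1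
def rvSd (ω : LetterOutcome X X₁ S Sd Y Y₁ k) : Sd := ω.2.2.2.1
def rvY (ω : LetterOutcome X X₁ S Sd Y Y₁ k) : Y := ω.2.2.2.2.1
def rvY₁ (ω : LetterOutcome X X₁ S Sd Y Y₁ k) : Y₁ := ω.2.2.2.2.2.1
def rvV (ω : LetterOutcome X X₁ S Sd Y Y₁ k) : Fin k := ω.2.2.2.2.2.2

/-- The tuple `(X, X₁, Y)`. -/
def rvXX₁Y (ω : LetterOutcome X X₁ S Sd Y Y₁ k) : X × X₁ × Y := (rvX ω, rvX₁ ω, rvY ω)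

/-- The tuple `(X, X₁, Y, V)` on which the estimate is based. -/
def rvXX₁YV (ω : LetterOutcome X X₁ S Sd Y Y₁ k) : X × X₁ × Y × Fin k :=
  (rvX ω, rvX₁ ω, rvY ω, rvV ω)

end LetterOutcome

namespace RelayChannel

open LetterOutcome

variable {X X₁ S Sd Shat Y Y₁ : Type*} [Fintype X] [Fintype X₁] [Fintype S] [Fintype Sd]
  [Fintype Y] [Fintype Y₁]

/-! ### Operational side -/

/-- The joint pmf of `(W, S^n, S_d^n, Y^n, Y_1^n)` induced by a code: the message is uniform,
independent of the i.i.d. pairs `(S_i, S_{d,i})`, and the channel is memoryless. -/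
def blockPMF (ch : RelayChannel X X₁ S Sd Y Y₁) {M n : ℕ} (c : RelayCode X X₁ Y Y₁ Shat M n) :
    BlockOutcome S Sd Y Y₁ M n → ℝ :=
  fun (w, s, sd, y, y₁) =>
    (1 / (M : ℝ)) * ∏ i : Fin n, ch.state (s i, sd i) *
      ch.trans (c.enc w i) (c.relay i (fun j => y₁ (Fin.castLE i.isLt.le j))) (s i) (y i, y₁ i)

/-- `Pr(Ŵ ≠ W)`. -/
def errorProb (ch : RelayChannel X X₁ S Sd Y Y₁) {M n : ℕ}
    (c : RelayCode X X₁ Y Y₁ Shat M n) : ℝ :=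
  prob (ch.blockPMF c) (fun (w, _, _, y, _) => c.dec y ≠ w)

/-- The expected block distortion `(1/n) ∑ᵢ E[d(S_{d,i}, Ŝ_{d,i})]`. -/
def codeDistortion (ch : RelayChannel X X₁ S Sd Y Y₁) (d : Sd → Shat → ℝ) {M n : ℕ}
    (c : RelayCode X X₁ Y Y₁ Shat M n) : ℝ :=
  (1 / (n : ℝ)) *
    ∑ i : Fin n, expect (ch.blockPMF c) (fun (_, _, sd, y, _) => d (sd i) (c.est y i))

/-- Achievability of `(R, D)` for `R ≥ 0`, with message sets of size `2 ^ ⌈nR⌉`. For a distortion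
function on finite alphabets the sequence under the `limsup` is bounded. -/
def Achievable (ch : RelayChannel X X₁ S Sd Y Y₁) (d : Sd → Shat → ℝ) (R D : ℝ) : Prop :=
  0 ≤ R ∧ ∃ c : (n : ℕ) → RelayCode X X₁ Y Y₁ Shat (2 ^ ⌈(n : ℝ) * R⌉₊) n,
    Tendsto (fun n => ch.errorProb (c n)) atTop (𝓝 0) ∧
    limsup (fun n => ch.codeDistortion d (c n)) atTop ≤ D

/-- The distortions `D` such that `(R, D)` is achievable for some rate `R`. -/
def achievableDistortions (ch : RelayChannel X X₁ S Sd Y Y₁) (d : Sd → Shat → ℝ) : Set ℝ :=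
  {D | ∃ R, ch.Achievable d R D}

/-- `D_min`. That the infimum is a minimum is a separate claim. -/
def minDistortion (ch : RelayChannel X X₁ S Sd Y Y₁) (d : Sd → Shat → ℝ) : ℝ :=
  sInf (ch.achievableDistortions d)

/-! ### Single-letter side -/

/-- The joint pmf `P_{X X₁} P_{S S_d} P_{Y Y₁ | X X₁ S} P_{V | X X₁ Y₁}`. -/
def letterPMF (ch : RelayChannel X X₁ S Sd Y Y₁) {k : ℕ} (p : X × X₁ → ℝ)
    (q : X → X₁ → Y₁ → Fin k → ℝ) : LetterOutcome X X₁ S Sd Y Y₁ k → ℝ :=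
  fun (x, x₁, s, sd, y, y₁, v) =>
    p (x, x₁) * ch.state (s, sd) * ch.trans x x₁ s (y, y₁) * q x x₁ y₁ v

/-- The conditional pmf `P_{S_d | X X₁ Y V}(sd | t)`, equal to `0` if `t` has probability zero. -/
def posterior {k : ℕ} (P : LetterOutcome X X₁ S Sd Y Y₁ k → ℝ)
    (sd : Sd) (t : X × X₁ × Y × Fin k) : ℝ :=
  pmfOf P (fun ω => (rvSd ω, rvXX₁YV ω)) (sd, t) / pmfOf P rvXX₁YV t

/-- `g` is an optimal estimator: `g t` is, for every `t = (x, x₁, y, v)`, a minimizer of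
`s' ↦ ∑ P_{S_d | X X₁ Y V}(sd | t) d(sd, s')`. (No condition where `t` has probability zero.) -/
def IsBayesEstimator (d : Sd → Shat → ℝ) {k : ℕ} (P : LetterOutcome X X₁ S Sd Y Y₁ k → ℝ)
    (g : X × X₁ × Y × Fin k → Shat) : Prop :=
  ∀ t, ∀ s' : Shat, ∑ sd, posterior P sd t * d sd (g t) ≤ ∑ sd, posterior P sd t * d sd s'

/-- The values `E[d(S_d, Ŝ_d)]`, over all finite alphabets of `V` and all pmfs
`P_{X X₁} P_{V | X X₁ Y₁}` with `I(X₁; Y | X) ≥ I(V; Y₁ | X X₁ Y)`. -/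
def letterDistortions (ch : RelayChannel X X₁ S Sd Y Y₁) (d : Sd → Shat → ℝ) : Set ℝ :=
  {D | ∃ (k : ℕ) (p : X × X₁ → ℝ) (q : X → X₁ → Y₁ → Fin k → ℝ)
      (g : X × X₁ × Y × Fin k → Shat),
    p ∈ stdSimplex ℝ (X × X₁) ∧
    (∀ x x₁ y₁, q x x₁ y₁ ∈ stdSimplex ℝ (Fin k)) ∧
    condMutualInfo (ch.letterPMF p q) rvV rvY₁ rvXX₁Y ≤
      condMutualInfo (ch.letterPMF p q) rvX₁ rvY rvX ∧
    IsBayesEstimator d (ch.letterPMF p q) g ∧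
    D = expect (ch.letterPMF p q) (fun ω => d (rvSd ω) (g (rvXX₁YV ω)))}

end RelayChannel

end

end RelayISAC

/-!
The message error puts no constraint on the distortion: lowering the rate to zero, where there is a
single message, changes nothing, and the problem is to let the destination see as much as possible
of the relay's outputs. The two bounds compare codes with the single-letter expression, in which the
law `q x x₁ y₁ v` of the auxiliary variable enters only through its columns `q · · · v`: constraint
and distortion are sums over `v` of the functionals `infoAt` and `costAt`, homogeneous of degree one
in the column (`mem_letterDistortions_iff`).

*Converse.* Given a code, choose message and time uniformly, and let the auxiliary variable consist
of message, time, the past outputs of the relay and all outputs of the destination but the present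
one (`auxVar`). The estimate is a function of this variable and the present output, so the Bayes
cost is at most the distortion of the code. For each message, the conditional information terms of
the constraint telescope, and what is left is the divergence of the law of the destination's output
sequence from a product of single-letter laws, nonnegative by Gibbs' inequality
(`sum_auxInput_mul_infoAt_le`, `exists_mem_letterDistortions_le`).

*Achievability.* Block Markov compress-and-forward: in every block the relay sends an index that
describes what it received in the preceding block. Covering, decoding of the description with side
information, and channel decoding are all done by drawing with probability proportional to a
likelihood. The mean reward of a random codebook is then bounded below by a tangent inequality, with
no typical sequences (`exists_compression`, `exists_channelCode`); the losses have the form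
`min 1 (likelihood ratio)`, and they decay exponentially in the block length when the constraint is
strict (`exists_blockScheme`). A decoding error spoils only two blocks, so blocks can be chained
without accumulating errors (`exists_code_of_blockScheme`). If the constraint holds with equality,
erasing the auxiliary variable with small probability makes it strict, unless both sides are zero;
then the auxiliary variable carries no information on the relay output and can be dropped
(`isCodable_of_mem_letterDistortions`).

*Minima.* By Carathéodory's theorem, applied to the columns, an alphabet of bounded size suffices
for the auxiliary variable (`exists_bounded_alphabet`), so the single-letter minimum is attained by
compactness (`exists_isLeast_letterDistortions`). The same value is achievable, rather than merely
approached, since for every length a code of almost minimal distortion may be chosen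
(`achievable_of_forall_isCodable`).
-/

namespace RelayISAC

/-! ### Sums over product pmfs, averaging, and derandomization -/

section ProductSums

variable {ι V : Type*} [Fintype ι] [DecidableEq ι] [Fintype V]

theorem sum_prod_apply (f : ι → V → ℝ) :
    ∑ u : ι → V, ∏ l, f l (u l) = ∏ l, ∑ v, f l v := by
  rw [Finset.prod_univ_sum, Fintype.piFinset_univ]

/-- Under the product law `∏ l, p l (u l)` two distinct coordinates are independent. -/
theorem sum_prod_mul_pair (p : ι → V → ℝ) (hp : ∀ l, ∑ v, p l v = 1) {k l : ι} (hkl : k ≠ l)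
    (F G : V → ℝ) :
    ∑ u : ι → V, (∏ i, p i (u i)) * (F (u k) * G (u l)) =
      (∑ v, p k v * F v) * ∑ v, p l v * G v := by
  have h1 : ∀ u : ι → V, (∏ i, p i (u i)) * (F (u k) * G (u l)) =
      ∏ i, (p i (u i) * ((if i = k then F (u i) else 1) * (if i = l then G (u i) else 1))) := by
    intro u
    simp only [Finset.prod_mul_distrib, Finset.prod_ite_eq', Finset.mem_univ, if_true]
  simp_rw [h1]
  rw [sum_prod_apply (fun i v => p i v * ((if i = k then F v else 1) * if i = l then G v else 1))]
  have h2 : ∀ i, (∑ v, p i v * ((if i = k then F v else 1) * if i = l then G v else 1)) =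
      (if i = k then ∑ v, p k v * F v else 1) * (if i = l then ∑ v, p l v * G v else 1) := by
    intro i
    by_cases h : i = k
    · subst h; simp [hkl]
    · by_cases h' : i = l
      · subst h'; simp [h]
      · simp [h, h', hp]
  simp_rw [h2]
  simp only [Finset.prod_mul_distrib, Finset.prod_ite_eq', Finset.mem_univ, if_true]

theorem sum_prod_mul_single (p : ι → V → ℝ) (hp : ∀ l, ∑ v, p l v = 1) (k : ι) (F : V → ℝ) :
    ∑ u : ι → V, (∏ i, p i (u i)) * F (u k) = ∑ v, p k v * F v := by
  have h1 : ∀ u : ι → V, (∏ i, p i (u i)) * F (u k) =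
      ∏ i, (p i (u i) * (if i = k then F (u i) else 1)) := by
    intro u
    simp only [Finset.prod_mul_distrib, Finset.prod_ite_eq', Finset.mem_univ, if_true]
  simp_rw [h1]
  rw [sum_prod_apply (fun i v => p i v * (if i = k then F v else 1))]
  have h2 : ∀ i, (∑ v, p i v * (if i = k then F v else 1)) =
      (if i = k then ∑ v, p k v * F v else 1) := by
    intro i
    by_cases h : i = k
    · subst h; simp
    · simp [h, hp]
  simp_rw [h2]
  simp [Finset.prod_ite_eq']

/-- For an i.i.d. codebook `u`, the mean of `F (u k) * ∑ l ∈ L, Q (u l)` with `k ∈ L`: the term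
`l = k` stays correlated with `F`, each of the others contributes the mean of `Q`. -/
theorem sum_iid_mul_sum (p : V → ℝ) (hp : ∑ v, p v = 1) {k : ι} {L : Finset ι} (hk : k ∈ L)
    (F Q : V → ℝ) :
    ∑ u : ι → V, (∏ i, p (u i)) * (F (u k) * ∑ l ∈ L, Q (u l)) =
      ∑ v, p v * (F v * (Q v + ((L.card : ℝ) - 1) * ∑ v', p v' * Q v')) := by
  have hL : ∀ u : ι → V, (∏ i, p (u i)) * (F (u k) * ∑ l ∈ L, Q (u l)) =
      (∏ i, p (u i)) * (F (u k) * Q (u k)) +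
        ∑ l ∈ L.erase k, (∏ i, p (u i)) * (F (u k) * Q (u l)) := by
    intro u
    rw [← Finset.add_sum_erase L _ hk, mul_add, mul_add, Finset.mul_sum, Finset.mul_sum]
  simp_rw [hL]
  rw [Finset.sum_add_distrib, Finset.sum_comm,
    sum_prod_mul_single (fun _ => p) (fun _ => hp) k (fun v => F v * Q v)]
  rw [Finset.sum_congr rfl fun l hl => sum_prod_mul_pair (fun _ => p) (fun _ => hp)
    (Finset.ne_of_mem_erase hl).symm F Q]
  rw [Finset.sum_const, Finset.card_erase_of_mem hk, nsmul_eq_mul,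
    Nat.cast_sub (Finset.card_pos.2 ⟨k, hk⟩)]
  simp only [mul_add, Finset.sum_add_distrib]
  congr 1
  rw [Finset.sum_mul, Finset.mul_sum]
  refine Finset.sum_congr rfl fun v _ => ?_
  push_cast
  ring

theorem prod_pmf_sum_one (p : ι → V → ℝ) (hp : ∀ l, ∑ v, p l v = 1) :
    ∑ u : ι → V, ∏ i, p i (u i) = 1 := by
  rw [sum_prod_apply]; simp [hp]

end ProductSums

/-- Some point of positive weight does at most as well as the mean. -/
theorem exists_le_mean {α : Type*} [Fintype α] (p F : α → ℝ) (hp : ∀ a, 0 ≤ p a)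
    (hsum : ∑ a, p a = 1) : ∃ a, 0 < p a ∧ F a ≤ ∑ a, p a * F a := by
  by_contra! h
  have h1 : ∀ a ∈ Finset.univ, p a * (∑ a, p a * F a) ≤ p a * F a := by
    intro a _
    rcases (hp a).eq_or_lt with h0 | h0
    · simp [← h0]
    · exact mul_le_mul_of_nonneg_left (h a h0).le (hp a)
  obtain ⟨a, ha⟩ : ∃ a, 0 < p a := by
    by_contra! h0
    have : ∑ a, p a ≤ 0 := Finset.sum_nonpos fun a _ => h0 a
    linarith
  have h2 : ∑ a, p a * (∑ a, p a * F a) < ∑ a, p a * F a :=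
    Finset.sum_lt_sum h1 ⟨a, Finset.mem_univ _, mul_lt_mul_of_pos_left (h a ha) ha⟩
  rw [← Finset.sum_mul, hsum, one_mul] at h2
  exact lt_irrefl _ h2

theorem exists_ge_mean {α : Type*} [Fintype α] (p F : α → ℝ) (hp : ∀ a, 0 ≤ p a)
    (hsum : ∑ a, p a = 1) : ∃ a, 0 < p a ∧ ∑ a, p a * F a ≤ F a := by
  obtain ⟨a, ha, h⟩ := exists_le_mean p (fun a => -F a) hp hsum
  refine ⟨a, ha, ?_⟩
  simp only [mul_neg, Finset.sum_neg_distrib] at h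
  linarith

/-- Derandomization: a randomized decision `k` based on the observation `obs z` can be replaced by
a deterministic one without losing expected reward. The rows of `k` need only be
sub-probabilities, since rewards are nonnegative. -/
theorem exists_deterministic {Z A E : Type*} [Fintype Z] [Fintype A] [Fintype E] [Nonempty E]
    (obs : Z → A) (k : A → E → ℝ) (hk : ∀ a e, 0 ≤ k a e) (hk1 : ∀ a, ∑ e, k a e ≤ 1)
    (R : Z → E → ℝ) (hR : ∀ z e, 0 ≤ R z e) :
    ∃ φ : A → E, ∑ z, ∑ e, k (obs z) e * R z e ≤ ∑ z, R z (φ (obs z)) := by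
  classical
  have hmax : ∀ a, ∃ e, ∀ e', ∑ z with obs z = a, R z e' ≤ ∑ z with obs z = a, R z e :=
    fun a => Finite.exists_max fun e => ∑ z with obs z = a, R z e
  choose φ hφ using hmax
  refine ⟨φ, ?_⟩
  rw [← Finset.sum_fiberwise_of_maps_to (s := Finset.univ) (t := Finset.univ) (g := obs)
    (fun _ _ => Finset.mem_univ _),
    ← Finset.sum_fiberwise_of_maps_to (s := Finset.univ) (t := Finset.univ) (g := obs)
    (f := fun z => R z (φ (obs z))) (fun _ _ => Finset.mem_univ _)]
  refine Finset.sum_le_sum fun a _ => ?_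
  calc ∑ z with obs z = a, ∑ e, k (obs z) e * R z e
      = ∑ z with obs z = a, ∑ e, k a e * R z e :=
        Finset.sum_congr rfl fun z hz => by rw [(Finset.mem_filter.1 hz).2]
    _ = ∑ e, k a e * ∑ z with obs z = a, R z e := by
        rw [Finset.sum_comm]; simp_rw [Finset.mul_sum]
    _ ≤ ∑ e, k a e * ∑ z with obs z = a, R z (φ a) :=
        Finset.sum_le_sum fun e _ => mul_le_mul_of_nonneg_left (hφ a e) (hk a e)
    _ = (∑ e, k a e) * ∑ z with obs z = a, R z (φ a) := by rw [Finset.sum_mul]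
    _ ≤ 1 * ∑ z with obs z = a, R z (φ a) :=
        mul_le_mul_of_nonneg_right (hk1 a) (Finset.sum_nonneg fun z _ => hR z _)
    _ = ∑ z with obs z = a, R z (φ (obs z)) := by
        rw [one_mul]
        exact Finset.sum_congr rfl fun z hz => by rw [(Finset.mem_filter.1 hz).2]

theorem sum_div_sum_le_one {ι : Type*} [Fintype ι] (f : ι → ℝ) :
    ∑ i, f i / ∑ j, f j ≤ 1 := by
  rw [← Finset.sum_div]
  exact div_self_le_one _

/-! ### One-shot coding lemmas -/

theorem three_sub_le_inv_mul_inv {x y : ℝ} (hx : 0 < x) (hy : 0 < y) :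
    3 - x - y ≤ x⁻¹ * y⁻¹ := by
  have h1 := Real.add_one_le_exp (-Real.log x - Real.log y)
  have h2 : Real.exp (-Real.log x - Real.log y) = x⁻¹ * y⁻¹ := by
    rw [sub_eq_add_neg, Real.exp_add, Real.exp_neg, Real.exp_neg, Real.exp_log hx, Real.exp_log hy]
  have h3 := Real.log_le_sub_one_of_pos hx
  have h4 := Real.log_le_sub_one_of_pos hy
  linarith

section Likelihood

variable {ι V : Type*} [Fintype ι] [DecidableEq ι] [Fintype V]

/-- In an i.i.d. codebook `u`, draw one codeword with probability proportional to `Q` and,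
independently, one codeword of the sublist `L` with probability proportional to `T`. This bounds
below the mean reward collected when both draws equal `k`. As `(a, b) ↦ 1 / (a * b)` is convex,
replacing the normalizing sums by their conditional means given `u k` only decreases the mean; the
convexity is used through the tangent inequality `3 - x - y ≤ 1 / (x * y)`. -/
theorem mean_double_likelihood_ge (p Q T G : V → ℝ) (hp : ∀ v, 0 ≤ p v) (hp1 : ∑ v, p v = 1)
    (hQ : ∀ v, 0 ≤ Q v) (hT : ∀ v, 0 ≤ T v) (hG : ∀ v, 0 ≤ G v) {k : ι} {L : Finset ι}
    (hk : k ∈ L) {α β : ℝ} (hα : ((Fintype.card ι : ℝ) - 1) * ∑ v, p v * Q v ≤ α)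
    (hβ : ((L.card : ℝ) - 1) * ∑ v, p v * T v ≤ β) (hα0 : 0 ≤ α) (hβ0 : 0 ≤ β) :
    ∑ v, p v * (Q v / (Q v + α) * (T v / (T v + β)) * G v) ≤
      ∑ u : ι → V, (∏ i, p (u i)) *
        (Q (u k) / (∑ l, Q (u l)) * (T (u k) / ∑ l ∈ L, T (u l)) * G (u k)) := by
  set F : V → ℝ := fun v => Q v / (Q v + α) * (T v / (T v + β)) * G v with hF
  have hF0 : ∀ v, 0 ≤ F v := fun v => by
    have := hQ v; have := hT v; have := hG v; positivity
  have hpt : ∀ u : ι → V, 3 * F (u k) - F (u k) / (Q (u k) + α) * (∑ l ∈ Finset.univ, Q (u l))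
      - F (u k) / (T (u k) + β) * (∑ l ∈ L, T (u l)) ≤
      Q (u k) / (∑ l, Q (u l)) * (T (u k) / ∑ l ∈ L, T (u l)) * G (u k) := by
    intro u
    set v := u k with hv
    have ha : Q v ≤ ∑ l, Q (u l) :=
      Finset.single_le_sum (f := fun l => Q (u l)) (fun l _ => hQ _) (Finset.mem_univ k)
    have hb : T v ≤ ∑ l ∈ L, T (u l) :=
      Finset.single_le_sum (f := fun l => T (u l)) (fun l _ => hT _) hk
    rcases (hQ v).eq_or_lt with hq | hq
    · simp [hF, ← hq]
    rcases (hT v).eq_or_lt with ht | ht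
    · simp [hF, ← ht]
    set a := ∑ l, Q (u l)
    set b := ∑ l ∈ L, T (u l)
    have ha0 : 0 < a := hq.trans_le ha
    have hb0 : 0 < b := ht.trans_le hb
    have h1 : 0 < Q v + α := by linarith
    have h2 : 0 < T v + β := by linarith
    have h3 := three_sub_le_inv_mul_inv (div_pos ha0 h1) (div_pos hb0 h2)
    have h4 := mul_le_mul_of_nonneg_left h3 (hF0 v)
    calc _ = F v * (3 - a / (Q v + α) - b / (T v + β)) := by ring
      _ ≤ _ := h4
      _ = _ := by simp only [hF]; field_simp
  -- the lower bound is affine in the two normalizing sums, so its mean is explicit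
  have hmean : ∑ u : ι → V, (∏ i, p (u i)) *
      (3 * F (u k) - F (u k) / (Q (u k) + α) * (∑ l ∈ Finset.univ, Q (u l))
      - F (u k) / (T (u k) + β) * (∑ l ∈ L, T (u l))) =
      ∑ v, p v * (3 * F v
        - F v / (Q v + α) * (Q v + ((Fintype.card ι : ℝ) - 1) * ∑ v', p v' * Q v')
        - F v / (T v + β) * (T v + ((L.card : ℝ) - 1) * ∑ v', p v' * T v')) := by
    simp only [mul_sub, Finset.sum_sub_distrib]
    congr 1
    · congr 1
      · exact sum_prod_mul_single (fun _ => p) (fun _ => hp1) k fun v => 3 * F v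
      · exact sum_iid_mul_sum p hp1 (Finset.mem_univ k) (fun v => F v / (Q v + α)) Q
    · exact sum_iid_mul_sum p hp1 hk (fun v => F v / (T v + β)) T
  calc ∑ v, p v * F v ≤ _ := ?_
    _ = _ := hmean.symm
    _ ≤ _ := Finset.sum_le_sum fun u _ => mul_le_mul_of_nonneg_left (hpt u)
        (Finset.prod_nonneg fun i _ => hp _)
  refine Finset.sum_le_sum fun v _ => mul_le_mul_of_nonneg_left ?_ (hp v)
  have h1 : F v / (Q v + α) * (Q v + ((Fintype.card ι : ℝ) - 1) * ∑ v', p v' * Q v') ≤ F v := by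
    have h0 : 0 ≤ Q v + α := add_nonneg (hQ v) hα0
    calc _ ≤ F v / (Q v + α) * (Q v + α) :=
          mul_le_mul_of_nonneg_left (by linarith) (div_nonneg (hF0 v) h0)
      _ ≤ F v := by
        rw [div_mul_eq_mul_div]
        exact div_le_of_le_mul₀ h0 (hF0 v) le_rfl
  have h2 : F v / (T v + β) * (T v + ((L.card : ℝ) - 1) * ∑ v', p v' * T v') ≤ F v := by
    have h0 : 0 ≤ T v + β := add_nonneg (hT v) hβ0
    calc _ ≤ F v / (T v + β) * (T v + β) :=
          mul_le_mul_of_nonneg_left (by linarith) (div_nonneg (hF0 v) h0)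
      _ ≤ F v := by
        rw [div_mul_eq_mul_div]
        exact div_le_of_le_mul₀ h0 (hF0 v) le_rfl
  linarith

/-- The version of `mean_double_likelihood_ge` with a single draw. -/
theorem mean_likelihood_ge (p Q G : V → ℝ) (hp : ∀ v, 0 ≤ p v) (hp1 : ∑ v, p v = 1)
    (hQ : ∀ v, 0 ≤ Q v) (hG : ∀ v, 0 ≤ G v) (k : ι)
    {α : ℝ} (hα : ((Fintype.card ι : ℝ) - 1) * ∑ v, p v * Q v ≤ α) (hα0 : 0 ≤ α) :
    ∑ v, p v * (Q v / (Q v + α) * G v) ≤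
      ∑ u : ι → V, (∏ i, p (u i)) * (Q (u k) / (∑ l, Q (u l)) * G (u k)) := by
  have h := mean_double_likelihood_ge p Q (fun _ => 1) G hp hp1 hQ (fun _ => zero_le_one) hG
    (Finset.mem_singleton_self k) hα (β := 0) (by simp) hα0 le_rfl
  simpa using h

end Likelihood

/-- One-shot lossy compression with side information at the decoder. A source `z` of weight `r z`
is seen as `a z` by the encoder, which sends one of `M` indices, and as `b z` by the decoder. The
reward `ρ` collected comes close to the one under the test channel `q`, where the decoder sees
`v ∼ q (a z)`; `t (b z)` is a guess of the law of `v` given the side information, and `J` is the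
number of codewords per index. The codewords are uniform on `V`; the encoder draws one with
likelihood `q`, and the decoder draws one with likelihood `t` among the `J` codewords of the
received index. -/
theorem exists_compression {Z A B V E : Type*} [Fintype Z] [Fintype A] [Fintype B] [Fintype V]
    [Nonempty V] (r : Z → ℝ) (hr : ∀ z, 0 ≤ r z) (a : Z → A) (b : Z → B)
    (q : A → V → ℝ) (hq : ∀ x v, 0 ≤ q x v) (hq1 : ∀ x, ∑ v, q x v ≤ 1)
    (t : B → V → ℝ) (ht : ∀ y v, 0 ≤ t y v) (ht1 : ∀ y, ∑ v, t y v ≤ 1)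
    (g : B → V → E) (ρ : Z → E → ℝ) (hρ : ∀ z e, 0 ≤ ρ z e)
    {M J : ℕ} (hM : 0 < M) (hJ : 0 < J) :
    ∃ (φ : A → Fin M) (est : Fin M → B → E),
      ∑ z, r z * ∑ v, q (a z) v *
        ((M * J / Fintype.card V) / (q (a z) v + M * J / Fintype.card V) *
          (t (b z) v / (t (b z) v + (J - 1) / Fintype.card V))) * ρ z (g (b z) v) ≤
      ∑ z, r z * ρ z (est (φ (a z)) (b z)) := by
  classical
  have : Nonempty (Fin M) := ⟨⟨0, hM⟩⟩
  have : Nonempty (Fin J) := ⟨⟨0, hJ⟩⟩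
  set K : ℝ := (Fintype.card V : ℝ) with hKdef
  have hK : 0 < K := by rw [hKdef]; exact_mod_cast Fintype.card_pos
  have hJ1 : (1 : ℝ) ≤ J := by exact_mod_cast hJ
  have hM1 : (1 : ℝ) ≤ M := by exact_mod_cast hM
  set p : V → ℝ := fun _ => 1 / K with hp
  have hp0 : ∀ v, 0 ≤ p v := fun v => by positivity
  have hp1 : ∑ v, p v = 1 := by
    simp only [hp, Finset.sum_const, Finset.card_univ, nsmul_eq_mul, ← hKdef]
    field_simp
  have hw0 : ∀ u : Fin M × Fin J → V, 0 ≤ ∏ i, p (u i) :=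
    fun u => Finset.prod_nonneg fun i _ => hp0 (u i)
  have hw1 : ∑ u : Fin M × Fin J → V, ∏ i, p (u i) = 1 :=
    prod_pmf_sum_one (fun _ => p) fun _ => hp1
  -- mean reward for the codebook `u` when the encoder and the decoder draw at random
  set Rw : (Fin M × Fin J → V) → ℝ := fun u => ∑ z, ∑ m,
    (∑ j, q (a z) (u (m, j)) / ∑ l, q (a z) (u l)) *
      (r z * ∑ j, t (b z) (u (m, j)) / (∑ j', t (b z) (u (m, j'))) *
        ρ z (g (b z) (u (m, j)))) with hRw
  have key : ∑ z, r z * ∑ v, q (a z) v *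
        ((M * J / K) / (q (a z) v + M * J / K) *
          (t (b z) v / (t (b z) v + (J - 1) / K))) * ρ z (g (b z) v) ≤
      ∑ u : Fin M × Fin J → V, (∏ i, p (u i)) * Rw u := by
    -- only the event that both draws give the same codeword `k` is counted
    have hlow : ∀ u, ∑ z, r z * ∑ k : Fin M × Fin J,
        (q (a z) (u k) / (∑ l, q (a z) (u l)) *
          (t (b z) (u k) / ∑ l ∈ ({k.1} : Finset (Fin M)) ×ˢ Finset.univ, t (b z) (u l)) *
          ρ z (g (b z) (u k))) ≤ Rw u := by
      intro u
      refine Finset.sum_le_sum fun z _ => ?_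
      rw [Fintype.sum_prod_type, Finset.mul_sum]
      refine Finset.sum_le_sum fun m _ => ?_
      rw [Finset.mul_sum, Finset.sum_mul]
      refine Finset.sum_le_sum fun j _ => ?_
      simp only [Finset.sum_product, Finset.sum_singleton]
      have h1 : t (b z) (u (m, j)) / (∑ j', t (b z) (u (m, j'))) * ρ z (g (b z) (u (m, j))) ≤
          ∑ j, t (b z) (u (m, j)) / (∑ j', t (b z) (u (m, j'))) *
            ρ z (g (b z) (u (m, j))) :=
        Finset.single_le_sum (f := fun j => t (b z) (u (m, j)) / (∑ j', t (b z) (u (m, j'))) *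
            ρ z (g (b z) (u (m, j))))
          (fun j _ => mul_nonneg (div_nonneg (ht _ _) (Finset.sum_nonneg fun _ _ => ht _ _))
            (hρ _ _)) (Finset.mem_univ j)
      have h2 := mul_le_mul_of_nonneg_left h1
        (mul_nonneg (div_nonneg (hq (a z) (u (m, j)))
          (Finset.sum_nonneg fun l (_ : l ∈ Finset.univ) => hq (a z) (u l))) (hr z))
      calc _ = _ := by ring
        _ ≤ _ := h2
        _ = _ := by ring
    calc _ ≤ ∑ z, r z * ∑ k : Fin M × Fin J, ∑ u : Fin M × Fin J → V, (∏ i, p (u i)) *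
        (q (a z) (u k) / (∑ l, q (a z) (u l)) *
          (t (b z) (u k) / ∑ l ∈ ({k.1} : Finset (Fin M)) ×ˢ Finset.univ, t (b z) (u l)) *
          ρ z (g (b z) (u k))) := ?_
      _ = ∑ u : Fin M × Fin J → V, (∏ i, p (u i)) * ∑ z, r z * ∑ k : Fin M × Fin J,
        (q (a z) (u k) / (∑ l, q (a z) (u l)) *
          (t (b z) (u k) / ∑ l ∈ ({k.1} : Finset (Fin M)) ×ˢ Finset.univ, t (b z) (u l)) *
          ρ z (g (b z) (u k))) := by
        simp_rw [Finset.mul_sum]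
        rw [Finset.sum_comm' (t' := Finset.univ) (s' := fun _ => Finset.univ) (by simp)]
        conv_rhs => rw [Finset.sum_comm]; enter [2, z]; rw [Finset.sum_comm]
        rw [Finset.sum_comm]
        refine Finset.sum_congr rfl fun z _ => Finset.sum_congr rfl fun k _ =>
          Finset.sum_congr rfl fun u _ => ?_
        ring
      _ ≤ _ := Finset.sum_le_sum fun u _ => mul_le_mul_of_nonneg_left (hlow u) (hw0 u)
    refine Finset.sum_le_sum fun z _ => mul_le_mul_of_nonneg_left ?_ (hr z)
    have hQb : ∑ v, p v * q (a z) v ≤ 1 / K := by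
      simp only [hp, ← Finset.mul_sum]
      exact mul_le_of_le_one_right (by positivity) (hq1 _)
    have hTb : ∑ v, p v * t (b z) v ≤ 1 / K := by
      simp only [hp, ← Finset.mul_sum]
      exact mul_le_of_le_one_right (by positivity) (ht1 _)
    have hone : ∀ k : Fin M × Fin J,
        ∑ v, p v * (q (a z) v / (q (a z) v + M * J / K) *
          (t (b z) v / (t (b z) v + (J - 1) / K)) * ρ z (g (b z) v)) ≤
        ∑ u : Fin M × Fin J → V, (∏ i, p (u i)) *
        (q (a z) (u k) / (∑ l, q (a z) (u l)) *
          (t (b z) (u k) / ∑ l ∈ ({k.1} : Finset (Fin M)) ×ˢ Finset.univ, t (b z) (u l)) *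
          ρ z (g (b z) (u k))) := by
      intro k
      refine mean_double_likelihood_ge p (q (a z)) (t (b z)) (fun v => ρ z (g (b z) v)) hp0 hp1
        (hq _) (ht _) (fun v => hρ _ _) (by simp) ?_ ?_ (by positivity)
        (div_nonneg (by linarith) hK.le)
      · have hMJ : (1 : ℝ) ≤ M * J := by nlinarith
        simp only [Fintype.card_prod, Fintype.card_fin, Nat.cast_mul]
        calc ((M : ℝ) * J - 1) * ∑ v, p v * q (a z) v ≤ ((M : ℝ) * J - 1) * (1 / K) :=
              mul_le_mul_of_nonneg_left hQb (by linarith)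
          _ = (M * J - 1) / K := by ring
          _ ≤ M * J / K := by gcongr; linarith
      · simp only [Finset.card_product, Finset.card_singleton, one_mul, Finset.card_univ,
          Fintype.card_fin]
        calc ((J : ℝ) - 1) * ∑ v, p v * t (b z) v ≤ ((J : ℝ) - 1) * (1 / K) :=
              mul_le_mul_of_nonneg_left hTb (by linarith)
          _ = (J - 1) / K := by ring
    calc _ = ∑ k : Fin M × Fin J, ∑ v, p v * (q (a z) v / (q (a z) v + M * J / K) *
          (t (b z) v / (t (b z) v + (J - 1) / K)) * ρ z (g (b z) v)) := by
          rw [Finset.sum_const, Finset.card_univ, nsmul_eq_mul, Finset.mul_sum]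
          refine Finset.sum_congr rfl fun v _ => ?_
          simp only [Fintype.card_prod, Fintype.card_fin, Nat.cast_mul, hp]
          ring
      _ ≤ _ := Finset.sum_le_sum fun k _ => hone k
  -- a good codebook is fixed, and the draws of encoder and decoder are replaced by best choices
  obtain ⟨u, -, hu⟩ := exists_ge_mean (fun u : Fin M × Fin J → V => ∏ i, p (u i)) Rw hw0 hw1
  obtain ⟨φ, hφ⟩ := exists_deterministic a
    (fun x (m : Fin M) => ∑ j, q x (u (m, j)) / ∑ l, q x (u l))
    (fun x m => Finset.sum_nonneg fun j _ =>
      div_nonneg (hq _ _) (Finset.sum_nonneg fun _ _ => hq _ _))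
    (fun x => by
      rw [← Fintype.sum_prod_type (f := fun k => q x (u k) / ∑ l, q x (u l))]
      exact sum_div_sum_le_one _)
    (fun z m => r z * ∑ j, t (b z) (u (m, j)) / (∑ j', t (b z) (u (m, j'))) *
        ρ z (g (b z) (u (m, j))))
    (fun z m => mul_nonneg (hr z) (Finset.sum_nonneg fun j _ => mul_nonneg
      (div_nonneg (ht _ _) (Finset.sum_nonneg fun _ _ => ht _ _)) (hρ _ _)))
  obtain ⟨ψ, hψ⟩ := exists_deterministic (fun z => (φ (a z), b z))
    (fun x (j : Fin J) => t x.2 (u (x.1, j)) / ∑ j', t x.2 (u (x.1, j')))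
    (fun x j => div_nonneg (ht _ _) (Finset.sum_nonneg fun _ _ => ht _ _))
    (fun x => sum_div_sum_le_one _)
    (fun z j => r z * ρ z (g (b z) (u (φ (a z), j))))
    (fun z j => mul_nonneg (hr z) (hρ _ _))
  refine ⟨φ, fun m y => g y (u (m, ψ (m, y))), ?_⟩
  refine (key.trans hu).trans (hφ.trans (le_trans (le_of_eq ?_) hψ))
  refine Finset.sum_congr rfl fun z _ => ?_
  rw [Finset.mul_sum]
  exact Finset.sum_congr rfl fun j _ => by ring

/-- One-shot channel coding for the channel `w` with `M` messages of law `μ` and i.i.d. codewords of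
law `p`, decoded by likelihood. Besides the probability of correct decoding the code also collects,
at its mean value, a further reward `c` depending on the transmitted codeword. -/
theorem exists_channelCode {U B : Type*} [Fintype U] [Fintype B] {M : ℕ} (hM : 0 < M)
    (p : U → ℝ) (hp : ∀ u, 0 ≤ p u) (hp1 : ∑ u, p u = 1)
    (w : U → B → ℝ) (hw : ∀ u y, 0 ≤ w u y) (c : U → ℝ)
    (μ : Fin M → ℝ) (hμ : ∀ m, 0 ≤ μ m) (hμ1 : ∑ m, μ m = 1) :
    ∃ (cw : Fin M → U) (ψ : B → Fin M),
      ∑ u, p u * (c u + ∑ y, w u y *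
        (w u y / (w u y + (M - 1) * ∑ u', p u' * w u' y))) ≤
      ∑ m, μ m * (c (cw m) + ∑ y, if ψ y = m then w (cw m) y else 0) := by
  classical
  have : Nonempty (Fin M) := ⟨⟨0, hM⟩⟩
  have hM1 : (1 : ℝ) ≤ M := by exact_mod_cast hM
  set Rw : (Fin M → U) → ℝ := fun u => ∑ m, μ m * (c (u m) + ∑ y, w (u m) y / (∑ l, w (u l) y) *
    w (u m) y) with hRw
  have hw0 : ∀ u : Fin M → U, 0 ≤ ∏ i, p (u i) :=
    fun u => Finset.prod_nonneg fun i _ => hp _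
  have hw1 : ∑ u : Fin M → U, ∏ i, p (u i) = 1 :=
    prod_pmf_sum_one (fun _ => p) fun _ => hp1
  obtain ⟨u, -, hu⟩ := exists_ge_mean (fun u : Fin M → U => ∏ i, p (u i)) Rw hw0 hw1
  obtain ⟨ψ, hψ⟩ := exists_deterministic (fun z : Fin M × B => z.2)
    (fun y (m : Fin M) => w (u m) y / ∑ l, w (u l) y)
    (fun y m => div_nonneg (hw _ _) (Finset.sum_nonneg fun _ _ => hw _ _))
    (fun y => sum_div_sum_le_one _)
    (fun z m => if m = z.1 then μ z.1 * w (u z.1) z.2 else 0)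
    (fun z m => by split_ifs; exacts [mul_nonneg (hμ _) (hw _ _), le_rfl])
  refine ⟨u, ψ, le_trans (le_trans ?_ hu) ?_⟩
  · have h1 : ∀ m, ∑ u, p u * (c u + ∑ y, w u y *
        (w u y / (w u y + (M - 1) * ∑ u', p u' * w u' y))) ≤
        ∑ u : Fin M → U, (∏ i, p (u i)) *
          (c (u m) + ∑ y, w (u m) y / (∑ l, w (u l) y) * w (u m) y) := by
      intro m
      simp only [mul_add, Finset.sum_add_distrib]
      refine add_le_add (sum_prod_mul_single (fun _ => p) (fun _ => hp1) m c).ge ?_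
      simp_rw [Finset.mul_sum]
      rw [Finset.sum_comm]
      conv_rhs => rw [Finset.sum_comm]
      refine Finset.sum_le_sum fun y _ => ?_
      refine le_trans (le_of_eq ?_) (mean_likelihood_ge p (fun u => w u y) (fun u => w u y) hp hp1
        (fun u => hw u y) (fun u => hw u y) m (α := (M - 1) * ∑ u', p u' * w u' y) (by simp)
        (mul_nonneg (by linarith) (Finset.sum_nonneg fun _ _ => mul_nonneg (hp _) (hw _ _))))
      refine Finset.sum_congr rfl fun v _ => ?_
      simp only [Finset.mul_sum]
      ring
    calc _ = ∑ m, μ m * ∑ u, p u * (c u + ∑ y, w u y *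
        (w u y / (w u y + (M - 1) * ∑ u', p u' * w u' y))) := by
          rw [← Finset.sum_mul, hμ1, one_mul]
      _ ≤ ∑ m, μ m * ∑ u : Fin M → U, (∏ i, p (u i)) *
          (c (u m) + ∑ y, w (u m) y / (∑ l, w (u l) y) * w (u m) y) :=
          Finset.sum_le_sum fun m _ => mul_le_mul_of_nonneg_left (h1 m) (hμ m)
      _ = _ := by
          simp_rw [hRw, Finset.mul_sum]
          rw [Finset.sum_comm]
          exact Finset.sum_congr rfl fun u _ => Finset.sum_congr rfl fun m _ => by ring
  · simp only [hRw, mul_add, Finset.sum_add_distrib]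
    refine add_le_add le_rfl ?_
    simp only [Finset.mul_sum]
    rw [Fintype.sum_prod_type, Fintype.sum_prod_type] at hψ
    refine le_trans (le_of_eq ?_) (hψ.trans (le_of_eq ?_))
    · refine Finset.sum_congr rfl fun m _ => Finset.sum_congr rfl fun y _ => ?_
      simp
      ring
    · simp

/-! ### Exponential bounds for i.i.d. sequences -/

/-- A random variable of negative mean has an exponential moment below one. -/
theorem exists_exp_moment_lt_one {Ω : Type*} [Fintype Ω] (P f : Ω → ℝ) (hP : ∀ ω, 0 ≤ P ω)
    (hP1 : ∑ ω, P ω = 1) (hf : ∑ ω, P ω * f ω < 0) :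
    ∃ s : ℝ, 0 < s ∧ s ≤ 1 ∧ ∑ ω, P ω * Real.exp (s * f ω) < 1 := by
  set B : ℝ := 1 + ∑ ω, |f ω| with hB
  have hB1 : 1 ≤ B := by
    have : 0 ≤ ∑ ω, |f ω| := Finset.sum_nonneg fun _ _ => abs_nonneg _
    linarith
  have hfB : ∀ ω, |f ω| ≤ B := fun ω => by
    have := Finset.single_le_sum (f := fun ω => |f ω|) (fun _ _ => abs_nonneg _)
      (Finset.mem_univ ω)
    linarith
  set m : ℝ := -∑ ω, P ω * f ω with hm
  have hm0 : 0 < m := by linarith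
  set s : ℝ := min (1 / B) (m / (2 * B ^ 2)) with hs
  have hs0 : 0 < s := by positivity
  have hsB : s * B ≤ 1 := by
    calc s * B ≤ 1 / B * B := by gcongr; exact min_le_left _ _
      _ = 1 := by field_simp
  have hsm : s * B ^ 2 ≤ m / 2 := by
    calc s * B ^ 2 ≤ m / (2 * B ^ 2) * B ^ 2 := by gcongr; exact min_le_right _ _
      _ = m / 2 := by field_simp
  refine ⟨s, hs0, by nlinarith, ?_⟩
  have hpt : ∀ ω, P ω * Real.exp (s * f ω) ≤ P ω * (1 + s * f ω + s ^ 2 * B ^ 2) := by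
    intro ω
    refine mul_le_mul_of_nonneg_left ?_ (hP ω)
    have h1 : |s * f ω| ≤ 1 := by
      rw [abs_mul, abs_of_pos hs0]
      exact (mul_le_mul_of_nonneg_left (hfB ω) hs0.le).trans hsB
    have h2 := (abs_le.1 (Real.abs_exp_sub_one_sub_id_le h1)).2
    have h3 : (s * f ω) ^ 2 ≤ s ^ 2 * B ^ 2 := by
      rw [mul_pow]
      gcongr ?_ * ?_
      exact sq_le_sq' (by linarith [(abs_le.1 (hfB ω)).1]) (abs_le.1 (hfB ω)).2
    linarith
  calc ∑ ω, P ω * Real.exp (s * f ω) ≤ ∑ ω, P ω * (1 + s * f ω + s ^ 2 * B ^ 2) :=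
        Finset.sum_le_sum fun ω _ => hpt ω
    _ = ∑ ω, P ω + s * ∑ ω, P ω * f ω + s ^ 2 * B ^ 2 * ∑ ω, P ω := by
        rw [Finset.mul_sum, Finset.mul_sum, ← Finset.sum_add_distrib, ← Finset.sum_add_distrib]
        exact Finset.sum_congr rfl fun ω _ => by ring
    _ = 1 - s * m + s * (s * B ^ 2) := by rw [hP1, hm]; ring
    _ ≤ 1 - s * m + s * (m / 2) := by gcongr
    _ < 1 := by nlinarith

theorem min_one_le_exp_mul {z x s : ℝ} (hz : z ≤ Real.exp x) (hs : 0 ≤ s) (hs1 : s ≤ 1) :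
    min 1 z ≤ Real.exp (s * x) := by
  rcases le_total 0 x with h | h
  · exact (min_le_left _ _).trans (Real.one_le_exp (mul_nonneg hs h))
  · exact (min_le_right _ _).trans (hz.trans (Real.exp_le_exp.2 (by nlinarith)))

/-- Chernoff bound for an error probability of the form `min 1 z`, where `z` is at most the
exponential of a sum of i.i.d. terms. -/
theorem mean_min_one_le_pow {Ω : Type*} [Fintype Ω] (P f : Ω → ℝ) (hP : ∀ ω, 0 ≤ P ω)
    {s : ℝ} (hs : 0 ≤ s) (hs1 : s ≤ 1) {N : ℕ} (z : (Fin N → Ω) → ℝ)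
    (hz : ∀ ω, (∀ i, 0 < P (ω i)) → z ω ≤ Real.exp (∑ i, f (ω i))) :
    ∑ ω : Fin N → Ω, (∏ i, P (ω i)) * min 1 (z ω) ≤ (∑ ω, P ω * Real.exp (s * f ω)) ^ N := by
  have h : (∑ ω, P ω * Real.exp (s * f ω)) ^ N =
      ∑ ω : Fin N → Ω, (∏ i, P (ω i)) * Real.exp (s * ∑ i, f (ω i)) := by
    rw [← Fin.prod_const, ← sum_prod_apply (fun (_ : Fin N) ω => P ω * Real.exp (s * f ω))]
    refine Finset.sum_congr rfl fun ω _ => ?_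
    rw [Finset.prod_mul_distrib, Finset.mul_sum, Real.exp_sum]
  rw [h]
  refine Finset.sum_le_sum fun ω _ => ?_
  by_cases h0 : ∀ i, 0 < P (ω i)
  · exact mul_le_mul_of_nonneg_left (min_one_le_exp_mul (hz ω h0) hs hs1)
      (Finset.prod_nonneg fun i _ => hP _)
  · push Not at h0
    obtain ⟨i, hi⟩ := h0
    have : ∏ i, P (ω i) = 0 := Finset.prod_eq_zero (Finset.mem_univ i) (le_antisymm hi (hP _))
    simp [this]

theorem one_sub_div_add_le {t B : ℝ} (ht : 0 < t) (hB : 0 ≤ B) :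
    1 - t / (t + B) ≤ min 1 (B / t) := by
  have h : 1 - t / (t + B) = B / (t + B) := by field_simp; ring
  rw [h]
  refine le_min ((div_le_one (by positivity)).2 (by linarith)) ?_
  gcongr
  linarith

theorem one_sub_mul_le {x y : ℝ} (hx1 : x ≤ 1) (hy1 : y ≤ 1) :
    1 - x * y ≤ (1 - x) + (1 - y) := by nlinarith

/-- Push-forward of a product law under a letterwise map. -/
theorem sum_prod_comp {A B : Type*} [Fintype A] [Fintype B] [DecidableEq B] {N : ℕ}
    (r : Fin N → A → ℝ) (h : A → B) (F : (Fin N → B) → ℝ) :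
    ∑ z : Fin N → A, (∏ i, r i (z i)) * F (fun i => h (z i)) =
      ∑ y : Fin N → B, (∏ i, ∑ a, if h a = y i then r i a else 0) * F y := by
  have h1 : ∀ y : Fin N → B, (∏ i, ∑ a, if h a = y i then r i a else 0) * F y =
      ∑ z : Fin N → A, if (fun i => h (z i)) = y then (∏ i, r i (z i)) * F y else 0 := by
    intro y
    rw [← sum_prod_apply (fun i a => if h a = y i then r i a else 0), Finset.sum_mul]
    refine Finset.sum_congr rfl fun z _ => ?_
    by_cases hz : (fun i => h (z i)) = y
    · subst hz; simp
    · obtain ⟨i, hi⟩ := Function.ne_iff.1 hz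
      rw [if_neg hz, Finset.prod_eq_zero (Finset.mem_univ i) (if_neg hi), zero_mul]
  simp_rw [h1]
  rw [Finset.sum_comm]
  simp

theorem sum_arrow_prod {A B : Type*} [Fintype A] [Fintype B] {N : ℕ}
    (F : (Fin N → A) → (Fin N → B) → ℝ) :
    ∑ ω : Fin N → A × B, F (fun i => (ω i).1) (fun i => (ω i).2) = ∑ a, ∑ b, F a b := by
  rw [← Fintype.sum_prod_type']
  exact Fintype.sum_equiv (Equiv.arrowProdEquivProdArrow _ _ _) _ _ fun ω => rfl

/-! ### Coding one block -/

/-- The operation of relay and destination in one block of `N` channel uses. The source sends the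
fixed sequence `x`. The relay holds an index `m`, which it sends as the codeword `x₁ m`; from the
outputs of the block it computes the index to be sent in the next block. The destination decodes
the index of the block by `dec`, and estimates the parameters of the block from the index sent in
it, the index sent in the next block, and its outputs. -/
structure BlockScheme (X X₁ Y Y₁ Shat : Type*) (N M : ℕ) where
  x : Fin N → X
  x₁ : Fin M → Fin N → X₁
  compress : Fin M → (Fin N → Y₁) → Fin M
  dec : (Fin N → Y) → Fin M
  est : Fin M → Fin M → (Fin N → Y) → Fin N → Shat

section Block

variable {X X₁ Y Y₁ Shat Z V : Type*} [Fintype X] [Fintype X₁] [Fintype Z]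

/-- Mean distortion of a block, when the relay index is `m` and the destination knows the two
indices it needs, plus `L` times the probability that `m` is decoded wrongly. A channel use with
inputs `x, x₁` has an outcome `z` of law `step x x₁`, of which the destination sees `oY z` and the
relay `oY₁ z`; an estimate `s` costs `δ z s`. -/
noncomputable def BlockScheme.cost (step : X → X₁ → Z → ℝ) (oY : Z → Y) (oY₁ : Z → Y₁)
    (δ : Z → Shat → ℝ) (L : ℝ) {N M : ℕ} (σ : BlockScheme X X₁ Y Y₁ Shat N M) (m : Fin M) : ℝ :=
  open Classical in
  ∑ z : Fin N → Z, (∏ i, step (σ.x i) (σ.x₁ m i) (z i)) *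
    (1 / (N : ℝ) * ∑ i, δ (z i) (σ.est m (σ.compress m fun i => oY₁ (z i)) (fun i => oY (z i)) i) +
      if σ.dec (fun i => oY (z i)) = m then 0 else L)

open Classical in
/-- The law of the output at the destination, given both inputs. -/
noncomputable def outLaw (step : X → X₁ → Z → ℝ) (oY : Z → Y) (x : X) (x₁ : X₁) (y : Y) : ℝ :=
  ∑ z, if oY z = y then step x x₁ z else 0

/-- The law of the output at the destination, given the input of the source only (zero if that
input has probability zero). -/
noncomputable def outLawX (step : X → X₁ → Z → ℝ) (oY : Z → Y) (p : X × X₁ → ℝ)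
    (x : X) (y : Y) : ℝ :=
  ∑ x₁, p (x, x₁) / (∑ x₁', p (x, x₁')) * outLaw step oY x x₁ y

/-- The joint law of `(x, x₁, z, v)`. -/
noncomputable def jointLaw (step : X → X₁ → Z → ℝ) (oY₁ : Z → Y₁) (p : X × X₁ → ℝ)
    (q : X → X₁ → Y₁ → V → ℝ) (ω : X × X₁ × Z × V) : ℝ :=
  p (ω.1, ω.2.1) * step ω.1 ω.2.1 ω.2.2.1 * q ω.1 ω.2.1 (oY₁ ω.2.2.1) ω.2.2.2

variable [Fintype V]

theorem sum_jointLaw (step : X → X₁ → Z → ℝ) (oY₁ : Z → Y₁) (hstep1 : ∀ x x₁, ∑ z, step x x₁ z = 1)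
    (p : X × X₁ → ℝ) (hp1 : ∑ a, p a = 1)
    (q : X → X₁ → Y₁ → V → ℝ) (hq1 : ∀ x x₁ y₁, ∑ v, q x x₁ y₁ v = 1) :
    ∑ ω, jointLaw step oY₁ p q ω = 1 := by
  simp only [Fintype.sum_prod_type, jointLaw, ← Finset.mul_sum, hq1, mul_one, hstep1]
  rw [← hp1, Fintype.sum_prod_type]

theorem sum_jointLaw_block (step : X → X₁ → Z → ℝ) (oY₁ : Z → Y₁) (p : X × X₁ → ℝ)
    (q : X → X₁ → Y₁ → V → ℝ) {N : ℕ}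
    (G : (Fin N → X) → (Fin N → X₁) → (Fin N → Z) → (Fin N → V) → ℝ) :
    ∑ ω : Fin N → X × X₁ × Z × V, (∏ i, jointLaw step oY₁ p q (ω i)) *
      G (fun i => (ω i).1) (fun i => (ω i).2.1) (fun i => (ω i).2.2.1) (fun i => (ω i).2.2.2) =
    ∑ x : Fin N → X, ∑ u : Fin N → X₁, (∏ i, p (x i, u i)) *
      ∑ z : Fin N → Z, (∏ i, step (x i) (u i) (z i)) *
        ∑ v : Fin N → V, (∏ i, q (x i) (u i) (oY₁ (z i)) (v i)) * G x u z v := by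
  rw [sum_arrow_prod (F := fun x (b : Fin N → X₁ × Z × V) =>
    (∏ i, jointLaw step oY₁ p q (x i, b i)) *
      G x (fun i => (b i).1) (fun i => (b i).2.1) (fun i => (b i).2.2))]
  refine Finset.sum_congr rfl fun x _ => ?_
  rw [sum_arrow_prod (F := fun u (b : Fin N → Z × V) =>
    (∏ i, jointLaw step oY₁ p q (x i, u i, b i)) *
      G x u (fun i => (b i).1) (fun i => (b i).2))]
  refine Finset.sum_congr rfl fun u _ => ?_
  rw [sum_arrow_prod (F := fun z (v : Fin N → V) =>
    (∏ i, jointLaw step oY₁ p q (x i, u i, z i, v i)) * G x u z v), Finset.mul_sum]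
  refine Finset.sum_congr rfl fun z _ => ?_
  rw [Finset.mul_sum, Finset.mul_sum]
  refine Finset.sum_congr rfl fun v _ => ?_
  simp only [jointLaw, Finset.prod_mul_distrib]
  ring

variable [Fintype Y] [Fintype Y₁] [Nonempty V]

/-- For a fixed block length `N` and given numbers of indices: a block scheme whose cost is bounded
through the probabilities, of the form `min 1 z`, of the three error events of random coding. -/
theorem exists_blockScheme_of_length (step : X → X₁ → Z → ℝ) (oY : Z → Y) (oY₁ : Z → Y₁)
    (δ : Z → Shat → ℝ) (hstep : ∀ x x₁ z, 0 ≤ step x x₁ z) (hstep1 : ∀ x x₁, ∑ z, step x x₁ z = 1)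
    (hδ : ∀ z s, 0 ≤ δ z s) {D₀ : ℝ} (hD₀ : ∀ z s, δ z s ≤ D₀) {L : ℝ} (hL : 0 < L)
    (p : X × X₁ → ℝ) (hp : ∀ a, 0 ≤ p a) (hp1 : ∑ a, p a = 1)
    (q : X → X₁ → Y₁ → V → ℝ) (hq : ∀ x x₁ y₁ v, 0 ≤ q x x₁ y₁ v)
    (hq1 : ∀ x x₁ y₁, ∑ v, q x x₁ y₁ v = 1)
    (t : X → X₁ → Y → V → ℝ) (ht : ∀ x x₁ y v, 0 ≤ t x x₁ y v)
    (ht1 : ∀ x x₁ y, ∑ v, t x x₁ y v ≤ 1)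
    (hqt : ∀ ω : X × X₁ × Z × V, 0 < jointLaw step oY₁ p q ω →
      0 < t ω.1 ω.2.1 (oY ω.2.2.1) ω.2.2.2)
    (g : X → X₁ → Y → V → Shat) {N M J : ℕ} (hN : 0 < N) (hM : 0 < M) (hJ : 0 < J)
    (μ : Fin M → ℝ) (hμ : ∀ m, 0 ≤ μ m) (hμ1 : ∑ m, μ m = 1) :
    ∃ σ : BlockScheme X X₁ Y Y₁ Shat N M, ∑ m, μ m * σ.cost step oY oY₁ δ L m ≤
      ∑ ω, jointLaw step oY₁ p q ω * δ ω.2.2.1 (g ω.1 ω.2.1 (oY ω.2.2.1) ω.2.2.2) +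
      D₀ * ∑ ω : Fin N → X × X₁ × Z × V, (∏ i, jointLaw step oY₁ p q (ω i)) *
        min 1 ((∏ i, q (ω i).1 (ω i).2.1 (oY₁ (ω i).2.2.1) (ω i).2.2.2) /
          (M * J / (Fintype.card V : ℝ) ^ N)) +
      D₀ * ∑ ω : Fin N → X × X₁ × Z × V, (∏ i, jointLaw step oY₁ p q (ω i)) *
        min 1 (((J - 1) / (Fintype.card V : ℝ) ^ N) /
          ∏ i, t (ω i).1 (ω i).2.1 (oY (ω i).2.2.1) (ω i).2.2.2) +
      L * ∑ ω : Fin N → X × X₁ × Z × V, (∏ i, jointLaw step oY₁ p q (ω i)) *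
        min 1 (((M - 1) * ∏ i, outLawX step oY p (ω i).1 (oY (ω i).2.2.1)) /
          ∏ i, outLaw step oY (ω i).1 (ω i).2.1 (oY (ω i).2.2.1)) := by
  classical
  set P := jointLaw step oY₁ p q with hPdef
  have hP0 : ∀ ω, 0 ≤ P ω := fun ω => mul_nonneg (mul_nonneg (hp _) (hstep _ _ _)) (hq _ _ _ _)
  set pX : X → ℝ := fun x => ∑ x₁, p (x, x₁) with hpX
  have hpX0 : ∀ x, 0 ≤ pX x := fun x => Finset.sum_nonneg fun _ _ => hp _
  have hpX1 : ∑ x, pX x = 1 := by rw [← hp1, Fintype.sum_prod_type]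
  have hN0 : (0 : ℝ) < N := by exact_mod_cast hN
  have hM1 : (1 : ℝ) ≤ M := by exact_mod_cast hM
  have hJ1 : (1 : ℝ) ≤ J := by exact_mod_cast hJ
  set K : ℝ := (Fintype.card V : ℝ) ^ N with hK
  have hK0 : 0 < K := by
    have : (0 : ℝ) < Fintype.card V := by exact_mod_cast Fintype.card_pos
    positivity
  have hKcard : (Fintype.card (Fin N → V) : ℝ) = K := by simp [hK]
  -- the reward of a block is `D₀` minus its distortion
  set ρ : (Fin N → Z) → (Fin N → Shat) → ℝ := fun z e => D₀ - 1 / (N : ℝ) * ∑ i, δ (z i) (e i)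
    with hρ
  have hρ0 : ∀ z e, 0 ≤ ρ z e := by
    intro z e
    have : ∑ i, δ (z i) (e i) ≤ ∑ _i : Fin N, D₀ := Finset.sum_le_sum fun i _ => hD₀ _ _
    rw [Finset.sum_const, Finset.card_univ, Fintype.card_fin, nsmul_eq_mul] at this
    have h2 : 1 / (N : ℝ) * ∑ i, δ (z i) (e i) ≤ 1 / (N : ℝ) * (N * D₀) := by gcongr
    have h3 : 1 / (N : ℝ) * (N * D₀) = D₀ := by field_simp
    simp only [hρ]
    linarith
  have hρD : ∀ z e, ρ z e ≤ D₀ := by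
    intro z e
    have : 0 ≤ 1 / (N : ℝ) * ∑ i, δ (z i) (e i) :=
      mul_nonneg (by positivity) (Finset.sum_nonneg fun _ _ => hδ _ _)
    simp only [hρ]
    linarith
  set gN : (Fin N → X) → (Fin N → X₁) → (Fin N → Y) → (Fin N → V) → Fin N → Shat :=
    fun x u y v i => g (x i) (u i) (y i) (v i) with hgN
  set qN : (Fin N → X) → (Fin N → X₁) → (Fin N → Y₁) → (Fin N → V) → ℝ :=
    fun x u y₁ v => ∏ i, q (x i) (u i) (y₁ i) (v i) with hqN
  set tN : (Fin N → X) → (Fin N → X₁) → (Fin N → Y) → (Fin N → V) → ℝ :=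
    fun x u y v => ∏ i, t (x i) (u i) (y i) (v i) with htN
  set oYN : (Fin N → Z) → (Fin N → Y) := fun z i => oY (z i) with hoYN
  set oY₁N : (Fin N → Z) → (Fin N → Y₁) := fun z i => oY₁ (z i) with hoY₁N
  have hqN1 : ∀ x u y₁, ∑ v, qN x u y₁ v = 1 := fun x u y₁ => by
    simp only [hqN]
    rw [sum_prod_apply (fun i v => q (x i) (u i) (y₁ i) v)]
    simp [hq1]
  -- a lower bound on the probability that the relay and the destination agree on `v`, relative to
  -- the probability of `v` under the test channel `q`
  set succ : (Fin N → X) → (Fin N → X₁) → (Fin N → Z) → (Fin N → V) → ℝ := fun x u z v =>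
    (M * J / K) / (qN x u (oY₁N z) v + M * J / K) *
      (tN x u (oYN z) v / (tN x u (oYN z) v + (J - 1) / K)) with hsucc
  have hcomp : ∀ x u, ∃ (φ : (Fin N → Y₁) → Fin M) (est : Fin M → (Fin N → Y) → Fin N → Shat),
      ∑ z, (∏ i, step (x i) (u i) (z i)) *
        ∑ v, qN x u (oY₁N z) v * succ x u z v * ρ z (gN x u (oYN z) v) ≤
      ∑ z, (∏ i, step (x i) (u i) (z i)) * ρ z (est (φ (oY₁N z)) (oYN z)) := by
    intro x u
    have := exists_compression (fun z : Fin N → Z => ∏ i, step (x i) (u i) (z i))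
      (fun z => Finset.prod_nonneg fun i _ => hstep _ _ _) oY₁N oYN
      (qN x u) (fun y₁ v => Finset.prod_nonneg fun i _ => hq _ _ _ _)
      (fun y₁ => (hqN1 x u y₁).le) (tN x u) (fun y v => Finset.prod_nonneg fun i _ => ht _ _ _ _)
      (fun y => by
        simp only [htN]
        rw [sum_prod_apply (fun i v => t (x i) (u i) (y i) v)]
        exact Finset.prod_le_one (fun i _ => Finset.sum_nonneg fun _ _ => ht _ _ _ _)
          fun i _ => ht1 _ _ _)
      (gN x u) ρ hρ0 hM hJ
    rw [hKcard] at this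
    exact this
  choose φ est hest using hcomp
  set c : (Fin N → X) → (Fin N → X₁) → ℝ := fun x u =>
    ∑ z, (∏ i, step (x i) (u i) (z i)) * ρ z (est x u (φ x u (oY₁N z)) (oYN z)) with hc
  set w : (Fin N → X) → (Fin N → X₁) → (Fin N → Y) → ℝ := fun x u y =>
    ∏ i, outLaw step oY (x i) (u i) (y i) with hw
  have hout0 : ∀ x u y, 0 ≤ outLaw step oY x u y := fun x u y =>
    Finset.sum_nonneg fun z _ => by split_ifs; exacts [hstep _ _ _, le_rfl]
  have hw0 : ∀ x u y, 0 ≤ w x u y := fun x u y => Finset.prod_nonneg fun i _ => hout0 _ _ _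
  have hwsum : ∀ x u (F : (Fin N → Y) → ℝ), ∑ y, w x u y * F y =
      ∑ z, (∏ i, step (x i) (u i) (z i)) * F (oYN z) := fun x u F =>
    (sum_prod_comp (fun i z => step (x i) (u i) z) oY F).symm
  set pU : (Fin N → X) → (Fin N → X₁) → ℝ := fun x u => ∏ i, p (x i, u i) / pX (x i) with hpU
  have hpU0 : ∀ x u, 0 ≤ pU x u := fun x u =>
    Finset.prod_nonneg fun i _ => div_nonneg (hp _) (hpX0 _)
  have hwX : ∀ x y, ∑ u, pU x u * w x u y = ∏ i, outLawX step oY p (x i) (y i) := by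
    intro x y
    simp only [hpU, hw, ← Finset.prod_mul_distrib]
    rw [sum_prod_apply (fun i u => p (x i, u) / pX (x i) * outLaw step oY (x i) u (y i))]
    rfl
  -- a lower bound on the probability that the relay's channel codeword `u` is drawn by the decoder
  -- when the output is `y`
  set succC : (Fin N → X) → (Fin N → X₁) → (Fin N → Y) → ℝ := fun x u y =>
    w x u y / (w x u y + (M - 1) * ∏ i, outLawX step oY p (x i) (y i)) with hsuccC
  -- the input sequence of the source is fixed first, as relay and destination have to know it; the
  -- codewords of the relay are then drawn from the conditional law `pU x`
  obtain ⟨x, hx0, hx⟩ := exists_ge_mean (fun x : Fin N → X => ∏ i, pX (x i))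
    (fun x => ∑ u, pU x u * (c x u + L * ∑ y, w x u y * succC x u y))
    (fun x => Finset.prod_nonneg fun i _ => hpX0 _)
    (prod_pmf_sum_one (fun _ => pX) fun _ => hpX1)
  have hxi : ∀ i, pX (x i) ≠ 0 := fun i h => hx0.ne' (Finset.prod_eq_zero (Finset.mem_univ i) h)
  obtain ⟨cw, ψ, hcw⟩ := exists_channelCode hM (pU x) (hpU0 x)
    (by
      simp only [hpU]
      rw [sum_prod_apply (fun i u => p (x i, u) / pX (x i))]
      refine Finset.prod_eq_one fun i _ => ?_
      rw [← Finset.sum_div]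
      exact div_self (hxi i))
    (w x) (hw0 x) (fun u => c x u / L) μ hμ hμ1
  simp only [hwX] at hcw
  refine ⟨⟨x, cw, fun m => φ x (cw m), ψ, fun m => est x (cw m)⟩, ?_⟩
  have hr1 : ∀ (x : Fin N → X) (u : Fin N → X₁),
      ∑ z : Fin N → Z, ∏ i, step (x i) (u i) (z i) = 1 := fun x u =>
    prod_pmf_sum_one (fun i z => step (x i) (u i) z) fun i => hstep1 _ _
  -- the cost is `D₀ + L` minus the rewards for estimation and for correct decoding
  have hcost : ∀ m, BlockScheme.cost step oY oY₁ δ L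
      ⟨x, cw, fun m => φ x (cw m), ψ, fun m => est x (cw m)⟩ m =
      D₀ + L - L * (c x (cw m) / L + ∑ y, if ψ y = m then w x (cw m) y else 0) := by
    intro m
    have h1 : ∑ y, (if ψ y = m then w x (cw m) y else 0) =
        ∑ z, (∏ i, step (x i) (cw m i) (z i)) * (if ψ (oYN z) = m then 1 else 0) := by
      rw [← hwsum x (cw m) (fun y => if ψ y = m then 1 else 0)]
      simp
    rw [h1, mul_add, mul_div_cancel₀ _ hL.ne']
    simp only [hc, BlockScheme.cost]
    have h2 : D₀ + L = ∑ z : Fin N → Z, (∏ i, step (x i) (cw m i) (z i)) * (D₀ + L) := by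
      rw [← Finset.sum_mul, hr1, one_mul]
    rw [h2, Finset.mul_sum, ← Finset.sum_add_distrib, ← Finset.sum_sub_distrib]
    refine Finset.sum_congr rfl fun z _ => ?_
    simp only [hρ, hoYN, hoY₁N]
    split_ifs <;> ring
  -- the mean reward over the input sequences becomes a mean under the `N`-th power of `jointLaw`
  have hmain : D₀ + L - (∑ x : Fin N → X, (∏ i, pX (x i)) *
      ∑ u, pU x u * (c x u + L * ∑ y, w x u y * succC x u y)) ≤
      ∑ ω, P ω * δ ω.2.2.1 (g ω.1 ω.2.1 (oY ω.2.2.1) ω.2.2.2) +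
      D₀ * ∑ ω : Fin N → X × X₁ × Z × V, (∏ i, P (ω i)) *
        min 1 ((∏ i, q (ω i).1 (ω i).2.1 (oY₁ (ω i).2.2.1) (ω i).2.2.2) / (M * J / K)) +
      D₀ * ∑ ω : Fin N → X × X₁ × Z × V, (∏ i, P (ω i)) *
        min 1 (((J - 1) / K) / ∏ i, t (ω i).1 (ω i).2.1 (oY (ω i).2.2.1) (ω i).2.2.2) +
      L * ∑ ω : Fin N → X × X₁ × Z × V, (∏ i, P (ω i)) *
        min 1 (((M - 1) * ∏ i, outLawX step oY p (ω i).1 (oY (ω i).2.2.1)) /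
          ∏ i, outLaw step oY (ω i).1 (ω i).2.1 (oY (ω i).2.2.1)) := by
    set G : (Fin N → X) → (Fin N → X₁) → (Fin N → Z) → (Fin N → V) → ℝ := fun x u z v =>
      succ x u z v * ρ z (gN x u (oYN z) v) + L * succC x u (oYN z) with hG
    have hP1 : ∑ ω, P ω = 1 := sum_jointLaw step oY₁ hstep1 p hp1 q hq1
    have hlow : ∑ ω : Fin N → X × X₁ × Z × V, (∏ i, P (ω i)) *
        G (fun i => (ω i).1) (fun i => (ω i).2.1) (fun i => (ω i).2.2.1) (fun i => (ω i).2.2.2) ≤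
        ∑ x : Fin N → X, (∏ i, pX (x i)) *
          ∑ u, pU x u * (c x u + L * ∑ y, w x u y * succC x u y) := by
      rw [sum_jointLaw_block]
      refine Finset.sum_le_sum fun x _ => ?_
      rw [Finset.mul_sum]
      refine Finset.sum_le_sum fun u _ => ?_
      have hpp : (∏ i, p (x i, u i)) = (∏ i, pX (x i)) * pU x u := by
        simp only [hpU, ← Finset.prod_mul_distrib]
        refine Finset.prod_congr rfl fun i _ => ?_
        by_cases h : pX (x i) = 0
        · have : p (x i, u i) ≤ pX (x i) :=
            Finset.single_le_sum (f := fun x₁ => p (x i, x₁)) (fun _ _ => hp _) (Finset.mem_univ _)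
          rw [h, zero_mul]
          exact le_antisymm (h ▸ this) (hp _)
        · field_simp
      rw [← mul_assoc, ← hpp]
      refine mul_le_mul_of_nonneg_left ?_ (Finset.prod_nonneg fun i _ => hp _)
      rw [hwsum]
      have h2 : ∀ z : Fin N → Z, ∑ v : Fin N → V, (∏ i, q (x i) (u i) (oY₁ (z i)) (v i)) * G x u z v
          = ∑ v, qN x u (oY₁N z) v * succ x u z v * ρ z (gN x u (oYN z) v) +
            L * succC x u (oYN z) := by
        intro z
        simp only [hG, mul_add, Finset.sum_add_distrib]
        congr 1
        · exact Finset.sum_congr rfl fun v _ => by simp only [hqN, hoY₁N]; ring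
        · rw [← Finset.sum_mul]
          have := hqN1 x u (oY₁N z)
          simp only [hqN, hoY₁N] at this
          rw [this, one_mul]
      simp only [h2, mul_add, Finset.sum_add_distrib]
      refine add_le_add (hest x u) (le_of_eq ?_)
      rw [Finset.mul_sum]
      exact Finset.sum_congr rfl fun z _ => by ring
    have hbound : ∀ ω : Fin N → X × X₁ × Z × V, (∏ i, P (ω i)) * (D₀ + L -
        G (fun i => (ω i).1) (fun i => (ω i).2.1) (fun i => (ω i).2.2.1) (fun i => (ω i).2.2.2)) ≤
        (∏ i, P (ω i)) * (1 / (N : ℝ) *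
          ∑ i, δ (ω i).2.2.1 (g (ω i).1 (ω i).2.1 (oY (ω i).2.2.1) (ω i).2.2.2)) +
        D₀ * ((∏ i, P (ω i)) *
          min 1 ((∏ i, q (ω i).1 (ω i).2.1 (oY₁ (ω i).2.2.1) (ω i).2.2.2) / (M * J / K))) +
        D₀ * ((∏ i, P (ω i)) *
          min 1 (((J - 1) / K) / ∏ i, t (ω i).1 (ω i).2.1 (oY (ω i).2.2.1) (ω i).2.2.2)) +
        L * ((∏ i, P (ω i)) *
          min 1 (((M - 1) * ∏ i, outLawX step oY p (ω i).1 (oY (ω i).2.2.1)) /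
            ∏ i, outLaw step oY (ω i).1 (ω i).2.1 (oY (ω i).2.2.1))) := by
      intro ω
      by_cases h0 : ∀ i, 0 < P (ω i)
      swap
      · push Not at h0
        obtain ⟨i, hi⟩ := h0
        have : ∏ i, P (ω i) = 0 := Finset.prod_eq_zero (Finset.mem_univ i) (le_antisymm hi (hP0 _))
        simp [this]
      have hprod : 0 ≤ ∏ i, P (ω i) := Finset.prod_nonneg fun i _ => hP0 _
      have htpos : 0 < ∏ i, t (ω i).1 (ω i).2.1 (oY (ω i).2.2.1) (ω i).2.2.2 :=
        Finset.prod_pos fun i _ => hqt _ (h0 i)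
      have hqpos : 0 ≤ ∏ i, q (ω i).1 (ω i).2.1 (oY₁ (ω i).2.2.1) (ω i).2.2.2 :=
        Finset.prod_nonneg fun i _ => hq _ _ _ _
      have hwpos : 0 < ∏ i, outLaw step oY (ω i).1 (ω i).2.1 (oY (ω i).2.2.1) := by
        refine Finset.prod_pos fun i _ => ?_
        have h1 : step (ω i).1 (ω i).2.1 (ω i).2.2.1 ≤
            outLaw step oY (ω i).1 (ω i).2.1 (oY (ω i).2.2.1) := by
          have := Finset.single_le_sum (f := fun z => if oY z = oY (ω i).2.2.1 then
            step (ω i).1 (ω i).2.1 z else 0)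
            (fun z _ => by split_ifs; exacts [hstep _ _ _, le_rfl])
            (Finset.mem_univ (ω i).2.2.1)
          simpa [outLaw] using this
        refine lt_of_lt_of_le (lt_of_le_of_ne (hstep _ _ _) fun h => ?_) h1
        have := h0 i
        simp [hPdef, jointLaw, ← h] at this
      have hMJ : (0 : ℝ) < M * J / K := by positivity
      have hJK : (0 : ℝ) ≤ (J - 1) / K := div_nonneg (by linarith) hK0.le
      have hXpos : 0 ≤ ∏ i, outLawX step oY p (ω i).1 (oY (ω i).2.2.1) :=
        Finset.prod_nonneg fun i _ => Finset.sum_nonneg fun _ _ =>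
          mul_nonneg (div_nonneg (hp _) (hpX0 _)) (hout0 _ _ _)
      have e2 := one_sub_div_add_le htpos hJK
      have e3 := one_sub_div_add_le hwpos
        (mul_nonneg (by linarith : (0 : ℝ) ≤ (M : ℝ) - 1) hXpos)
      have e1 := one_sub_div_add_le hMJ hqpos
      rw [add_comm] at e1
      have e4 : (M * J / K : ℝ) / ((∏ i, q (ω i).1 (ω i).2.1 (oY₁ (ω i).2.2.1) (ω i).2.2.2) +
          M * J / K) ≤ 1 := div_le_one_of_le₀ (by linarith) (by positivity)
      have e5 : (∏ i, t (ω i).1 (ω i).2.1 (oY (ω i).2.2.1) (ω i).2.2.2) /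
          ((∏ i, t (ω i).1 (ω i).2.1 (oY (ω i).2.2.1) (ω i).2.2.2) + (J - 1) / K) ≤ 1 :=
        div_le_one_of_le₀ (by linarith) (by positivity)
      have e6 := one_sub_mul_le e4 e5
      have r0 := hρ0 (fun i => (ω i).2.2.1)
        (fun i => g (ω i).1 (ω i).2.1 (oY (ω i).2.2.1) (ω i).2.2.2)
      have r1 := hρD (fun i => (ω i).2.2.1)
        (fun i => g (ω i).1 (ω i).2.1 (oY (ω i).2.2.1) (ω i).2.2.2)
      have hs : (M * J / K : ℝ) / ((∏ i, q (ω i).1 (ω i).2.1 (oY₁ (ω i).2.2.1) (ω i).2.2.2) +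
          M * J / K) * ((∏ i, t (ω i).1 (ω i).2.1 (oY (ω i).2.2.1) (ω i).2.2.2) /
          ((∏ i, t (ω i).1 (ω i).2.1 (oY (ω i).2.2.1) (ω i).2.2.2) + (J - 1) / K)) ≤ 1 :=
        mul_le_one₀ e4 (by positivity) e5
      have hD00 : 0 ≤ D₀ := r0.trans r1
      rw [mul_left_comm D₀, mul_left_comm D₀, mul_left_comm L, ← mul_add, ← mul_add, ← mul_add]
      refine mul_le_mul_of_nonneg_left ?_ hprod
      simp only [hG, hsucc, hsuccC, hqN, htN, hgN, hw, hoYN, hoY₁N]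
      simp only [hρ] at r0 r1 ⊢
      set dist := 1 / (N : ℝ) *
          ∑ i, δ (ω i).2.2.1 (g (ω i).1 (ω i).2.1 (oY (ω i).2.2.1) (ω i).2.2.2)
      generalize (M * J / K : ℝ) / ((∏ i, q (ω i).1 (ω i).2.1 (oY₁ (ω i).2.2.1) (ω i).2.2.2) +
          M * J / K) = s1 at *
      generalize (∏ i, t (ω i).1 (ω i).2.1 (oY (ω i).2.2.1) (ω i).2.2.2) /
          ((∏ i, t (ω i).1 (ω i).2.1 (oY (ω i).2.2.1) (ω i).2.2.2) + (J - 1) / K) = s2 at *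
      have f1 : D₀ - s1 * s2 * (D₀ - dist) ≤ dist + D₀ * (1 - s1 * s2) := by
        nlinarith
      have f2 := mul_le_mul_of_nonneg_left (e6.trans (add_le_add e1 e2)) hD00
      have f3 := mul_le_mul_of_nonneg_left e3 hL.le
      linarith
    have htot : ∑ ω : Fin N → X × X₁ × Z × V, (∏ i, P (ω i)) * (D₀ + L -
        G (fun i => (ω i).1) (fun i => (ω i).2.1) (fun i => (ω i).2.2.1) (fun i => (ω i).2.2.2)) =
        D₀ + L - ∑ ω : Fin N → X × X₁ × Z × V, (∏ i, P (ω i)) *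
        G (fun i => (ω i).1) (fun i => (ω i).2.1) (fun i => (ω i).2.2.1)
          (fun i => (ω i).2.2.2) := by
      simp only [mul_sub, Finset.sum_sub_distrib]
      rw [← Finset.sum_mul, prod_pmf_sum_one (fun _ => P) fun _ => hP1, one_mul]
    have hdist : ∑ ω : Fin N → X × X₁ × Z × V, (∏ i, P (ω i)) * (1 / (N : ℝ) *
          ∑ i, δ (ω i).2.2.1 (g (ω i).1 (ω i).2.1 (oY (ω i).2.2.1) (ω i).2.2.2)) =
        ∑ ω, P ω * δ ω.2.2.1 (g ω.1 ω.2.1 (oY ω.2.2.1) ω.2.2.2) := by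
      simp only [mul_left_comm _ (1 / (N : ℝ)), ← Finset.mul_sum]
      simp only [Finset.mul_sum _ _ (∏ i, P _)]
      rw [Finset.sum_comm]
      simp only [sum_prod_mul_single (fun _ => P) (fun _ => hP1) _
        (fun ω => δ ω.2.2.1 (g ω.1 ω.2.1 (oY ω.2.2.1) ω.2.2.2))]
      simp only [Finset.sum_const, Finset.card_univ, Fintype.card_fin, nsmul_eq_mul]
      field_simp
    have hfin := Finset.sum_le_sum fun ω (_ : ω ∈ Finset.univ) => hbound ω
    rw [htot] at hfin
    simp only [Finset.sum_add_distrib, ← Finset.mul_sum] at hfin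
    rw [hdist] at hfin
    linarith
  have hsumcost : ∑ m, μ m * (D₀ + L - L * (c x (cw m) / L +
      ∑ y, if ψ y = m then w x (cw m) y else 0)) =
      D₀ + L - L * ∑ m, μ m * (c x (cw m) / L +
      ∑ y, if ψ y = m then w x (cw m) y else 0) := by
    simp only [mul_sub, Finset.sum_sub_distrib]
    rw [← Finset.sum_mul, hμ1, one_mul, Finset.mul_sum]
    congr 1
    exact Finset.sum_congr rfl fun m _ => by ring
  simp only [hcost]
  rw [hsumcost]
  refine le_trans (sub_le_sub_left ?_ _) hmain
  refine hx.trans (le_trans (le_of_eq ?_) (mul_le_mul_of_nonneg_left hcw hL.le))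
  rw [Finset.mul_sum]
  refine Finset.sum_congr rfl fun u _ => ?_
  simp only [hsuccC]
  field_simp

/-- Block coding: if the mean of `log (q / t)`, the rate of compression, is less than that of
`log (outLaw / outLawX)`, the rate of the channel from the relay to the destination, then some
block length admits block schemes, for every law of the relay index, whose mean cost is at most
the mean distortion of `g` plus `η`. -/
theorem exists_blockScheme (step : X → X₁ → Z → ℝ) (oY : Z → Y) (oY₁ : Z → Y₁)
    (δ : Z → Shat → ℝ) (hstep : ∀ x x₁ z, 0 ≤ step x x₁ z) (hstep1 : ∀ x x₁, ∑ z, step x x₁ z = 1)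
    (hδ : ∀ z s, 0 ≤ δ z s) {D₀ : ℝ} (hD₀ : ∀ z s, δ z s ≤ D₀) {L : ℝ} (hL : 0 < L)
    (p : X × X₁ → ℝ) (hp : ∀ a, 0 ≤ p a) (hp1 : ∑ a, p a = 1)
    (q : X → X₁ → Y₁ → V → ℝ) (hq : ∀ x x₁ y₁ v, 0 ≤ q x x₁ y₁ v)
    (hq1 : ∀ x x₁ y₁, ∑ v, q x x₁ y₁ v = 1)
    (t : X → X₁ → Y → V → ℝ) (ht : ∀ x x₁ y v, 0 ≤ t x x₁ y v)
    (ht1 : ∀ x x₁ y, ∑ v, t x x₁ y v ≤ 1)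
    (hqt : ∀ ω : X × X₁ × Z × V, 0 < jointLaw step oY₁ p q ω →
      0 < t ω.1 ω.2.1 (oY ω.2.2.1) ω.2.2.2)
    (g : X → X₁ → Y → V → Shat)
    (hrate : ∑ ω, jointLaw step oY₁ p q ω *
        (Real.log (q ω.1 ω.2.1 (oY₁ ω.2.2.1) ω.2.2.2) -
          Real.log (t ω.1 ω.2.1 (oY ω.2.2.1) ω.2.2.2)) <
      ∑ ω, jointLaw step oY₁ p q ω *
        (Real.log (outLaw step oY ω.1 ω.2.1 (oY ω.2.2.1)) -
          Real.log (outLawX step oY p ω.1 (oY ω.2.2.1))))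
    {η : ℝ} (hη : 0 < η) :
    ∃ N M : ℕ, 0 < N ∧ 0 < M ∧ ∀ μ : Fin M → ℝ, (∀ m, 0 ≤ μ m) → ∑ m, μ m = 1 →
      ∃ σ : BlockScheme X X₁ Y Y₁ Shat N M, ∑ m, μ m * σ.cost step oY oY₁ δ L m ≤
        ∑ ω, jointLaw step oY₁ p q ω * δ ω.2.2.1 (g ω.1 ω.2.1 (oY ω.2.2.1) ω.2.2.2) + η := by
  classical
  set P := jointLaw step oY₁ p q with hPdef
  have hP0 : ∀ ω, 0 ≤ P ω := fun ω => mul_nonneg (mul_nonneg (hp _) (hstep _ _ _)) (hq _ _ _ _)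
  have hP1 : ∑ ω, P ω = 1 := sum_jointLaw step oY₁ hstep1 p hp1 q hq1
  have hK0 : (0 : ℝ) < Fintype.card V := by exact_mod_cast Fintype.card_pos
  set K : ℝ := (Fintype.card V : ℝ) with hK
  have hpos : ∀ ω, 0 < P ω → 0 < p (ω.1, ω.2.1) ∧ 0 < step ω.1 ω.2.1 ω.2.2.1 ∧
      0 < q ω.1 ω.2.1 (oY₁ ω.2.2.1) ω.2.2.2 := by
    intro ω h
    refine ⟨(hp _).lt_of_ne fun h' => ?_, (hstep _ _ _).lt_of_ne fun h' => ?_,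
      (hq _ _ _ _).lt_of_ne fun h' => ?_⟩ <;> simp [hPdef, jointLaw, ← h'] at h
  have hout0 : ∀ x u y, 0 ≤ outLaw step oY x u y := fun x u y =>
    Finset.sum_nonneg fun z _ => by split_ifs; exacts [hstep _ _ _, le_rfl]
  have hoX0 : ∀ x y, 0 ≤ outLawX step oY p x y := fun x y => Finset.sum_nonneg fun _ _ =>
    mul_nonneg (div_nonneg (hp _) (Finset.sum_nonneg fun _ _ => hp _)) (hout0 _ _ _)
  have hout : ∀ ω, 0 < P ω → 0 < outLaw step oY ω.1 ω.2.1 (oY ω.2.2.1) := by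
    intro ω h
    have := Finset.single_le_sum (f := fun z => if oY z = oY ω.2.2.1 then
      step ω.1 ω.2.1 z else 0)
      (fun z _ => by split_ifs; exacts [hstep _ _ _, le_rfl]) (Finset.mem_univ ω.2.2.1)
    exact (hpos ω h).2.1.trans_le (by simpa [outLaw] using this)
  have hoX : ∀ ω, 0 < P ω → 0 < outLawX step oY p ω.1 (oY ω.2.2.1) := by
    intro ω h
    have hp' := (hpos ω h).1
    have h2 : p (ω.1, ω.2.1) ≤ ∑ x₁, p (ω.1, x₁) :=
      Finset.single_le_sum (f := fun x₁ => p (ω.1, x₁)) (fun _ _ => hp _) (Finset.mem_univ _)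
    have h3 := Finset.single_le_sum (f := fun x₁ => p (ω.1, x₁) / (∑ x₁', p (ω.1, x₁')) *
      outLaw step oY ω.1 x₁ (oY ω.2.2.1)) (fun x₁ _ => mul_nonneg (div_nonneg (hp _)
        (Finset.sum_nonneg fun _ _ => hp _)) (hout0 _ _ _)) (Finset.mem_univ ω.2.1)
    exact lt_of_lt_of_le (mul_pos (div_pos hp' (hp'.trans_le h2)) (hout ω h)) h3
  set lq : X × X₁ × Z × V → ℝ := fun ω => Real.log (q ω.1 ω.2.1 (oY₁ ω.2.2.1) ω.2.2.2) with hlq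
  set lt : X × X₁ × Z × V → ℝ := fun ω => Real.log (t ω.1 ω.2.1 (oY ω.2.2.1) ω.2.2.2) with hlt
  set lw : X × X₁ × Z × V → ℝ := fun ω => Real.log (outLaw step oY ω.1 ω.2.1 (oY ω.2.2.1))
    with hlw
  set lx : X × X₁ × Z × V → ℝ := fun ω => Real.log (outLawX step oY p ω.1 (oY ω.2.2.1)) with hlx
  have hrate' : ∑ ω, P ω * (lq ω - lt ω) < ∑ ω, P ω * (lw ω - lx ω) := hrate
  -- a third of the gap between the two rates is given to each of the three error events: too few
  -- codewords to cover the relay output, too many per index to tell them apart, too many indices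
  -- for the channel from the relay to the destination
  have hgap : ∃ γ : ℝ, 0 < γ ∧ 3 * γ =
      ∑ ω, P ω * (lw ω - lx ω) - ∑ ω, P ω * (lq ω - lt ω) :=
    ⟨(∑ ω, P ω * (lw ω - lx ω) - ∑ ω, P ω * (lq ω - lt ω)) / 3, by linarith, by ring⟩
  obtain ⟨γ, hγ, hγ3⟩ := hgap
  -- `R₁` is the rate of the relay indices, `R₂` that of the codewords per index
  set R₁ : ℝ := ∑ ω, P ω * (lw ω - lx ω) - γ with hR₁
  set R₂ : ℝ := ∑ ω, P ω * lt ω + Real.log K - γ with hR₂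
  have hconst : ∀ (f : X × X₁ × Z × V → ℝ) (a : ℝ), ∑ ω, P ω * (f ω + a) =
      ∑ ω, P ω * f ω + a := by
    intro f a
    simp only [mul_add, Finset.sum_add_distrib]
    rw [← Finset.sum_mul, hP1, one_mul]
  have hsub : ∑ ω, P ω * (lq ω - lt ω) = ∑ ω, P ω * lq ω - ∑ ω, P ω * lt ω := by
    simp only [mul_sub, Finset.sum_sub_distrib]
  have m1 : ∑ ω, P ω * (lq ω + (Real.log K - (R₁ + R₂))) < 0 := by
    rw [hconst]; linarith
  have m2 : ∑ ω, P ω * (-lt ω + (R₂ - Real.log K)) < 0 := by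
    rw [hconst]; simp only [mul_neg, Finset.sum_neg_distrib]; linarith
  have m3 : ∑ ω, P ω * (-(lw ω - lx ω) + R₁) < 0 := by
    rw [hconst]; simp only [mul_neg, Finset.sum_neg_distrib]; linarith
  obtain ⟨s₁, hs₁, hs₁', h₁⟩ := exists_exp_moment_lt_one P _ hP0 hP1 m1
  obtain ⟨s₂, hs₂, hs₂', h₂⟩ := exists_exp_moment_lt_one P _ hP0 hP1 m2
  obtain ⟨s₃, hs₃, hs₃', h₃⟩ := exists_exp_moment_lt_one P _ hP0 hP1 m3
  have hpow : ∀ f : X × X₁ × Z × V → ℝ, ∑ ω, P ω * Real.exp (f ω) < 1 →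
      Tendsto (fun n : ℕ => (∑ ω, P ω * Real.exp (f ω)) ^ n) atTop (𝓝 0) := fun f hf =>
    tendsto_pow_atTop_nhds_zero_of_lt_one
      (Finset.sum_nonneg fun ω _ => mul_nonneg (hP0 ω) (Real.exp_pos _).le) hf
  have hlim := (((hpow _ h₁).const_mul D₀).add ((hpow _ h₂).const_mul D₀)).add
    ((hpow _ h₃).const_mul L)
  simp only [mul_zero, add_zero] at hlim
  obtain ⟨N, hN, hN0⟩ := ((hlim.eventually (gt_mem_nhds hη)).and (eventually_gt_atTop 0)).exists
  have hD0 : ∀ z s, 0 ≤ D₀ := fun z s => (hδ z s).trans (hD₀ z s)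
  set M : ℕ := ⌈Real.exp (N * R₁)⌉₊ with hM
  set J : ℕ := ⌈Real.exp (N * R₂)⌉₊ with hJ
  have hM0 : 0 < M := Nat.ceil_pos.2 (Real.exp_pos _)
  have hJ0 : 0 < J := Nat.ceil_pos.2 (Real.exp_pos _)
  have hM1 : (M : ℝ) - 1 ≤ Real.exp (N * R₁) := by
    have := Nat.ceil_lt_add_one (Real.exp_pos (N * R₁)).le
    linarith
  have hJ1 : (J : ℝ) - 1 ≤ Real.exp (N * R₂) := by
    have := Nat.ceil_lt_add_one (Real.exp_pos (N * R₂)).le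
    linarith
  have hMJ : Real.exp (N * (R₁ + R₂)) ≤ M * J := by
    rw [mul_add, Real.exp_add]
    exact mul_le_mul (Nat.le_ceil _) (Nat.le_ceil _) (Real.exp_pos _).le (Nat.cast_nonneg _)
  have hKN : K ^ N = Real.exp (N * Real.log K) := by
    rw [Real.exp_nat_mul, Real.exp_log hK0]
  have hsum : ∀ (f : X × X₁ × Z × V → ℝ) (a : ℝ) (ω : Fin N → X × X₁ × Z × V),
      ∑ i, (f (ω i) + a) = ∑ i, f (ω i) + N * a := by
    intro f a ω
    simp [Finset.sum_add_distrib]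
  have hprodlog : ∀ (f : X × X₁ × Z × V → ℝ) (ω : Fin N → X × X₁ × Z × V),
      (∀ i, 0 < f (ω i)) → ∏ i, f (ω i) = Real.exp (∑ i, Real.log (f (ω i))) := by
    intro f ω h
    rw [Real.exp_sum]
    exact Finset.prod_congr rfl fun i _ => (Real.exp_log (h i)).symm
  refine ⟨N, M, hN0, hM0, fun μ hμ hμ1 => ?_⟩
  obtain ⟨σ, hσ⟩ := exists_blockScheme_of_length step oY oY₁ δ hstep hstep1 hδ hD₀ hL p hp hp1 q hq
    hq1 t ht ht1 hqt g hN0 hM0 hJ0 μ hμ hμ1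
  refine ⟨σ, hσ.trans ?_⟩
  have hZ : Nonempty (X × X₁ × Z × V) := by
    by_contra h
    rw [not_nonempty_iff] at h
    simp at hP1
  obtain ⟨ω₀⟩ := hZ
  have hD00 : 0 ≤ D₀ := hD0 ω₀.2.2.1 (g ω₀.1 ω₀.2.1 (oY ω₀.2.2.1) ω₀.2.2.2)
  have b1 := mean_min_one_le_pow P (fun ω => lq ω + (Real.log K - (R₁ + R₂))) hP0 hs₁.le hs₁'
    (fun ω : Fin N → X × X₁ × Z × V =>
      (∏ i, q (ω i).1 (ω i).2.1 (oY₁ (ω i).2.2.1) (ω i).2.2.2) / (M * J / K ^ N)) (by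
      intro ω hω
      rw [hsum, hprodlog (fun ω => q ω.1 ω.2.1 (oY₁ ω.2.2.1) ω.2.2.2) ω
        fun i => (hpos _ (hω i)).2.2, hKN, mul_sub, Real.exp_add, Real.exp_sub]
      rw [div_div_eq_mul_div, mul_div_assoc]
      gcongr)
  have b2 := mean_min_one_le_pow P (fun ω => -lt ω + (R₂ - Real.log K)) hP0 hs₂.le hs₂'
    (fun ω : Fin N → X × X₁ × Z × V =>
      ((J - 1) / K ^ N) / ∏ i, t (ω i).1 (ω i).2.1 (oY (ω i).2.2.1) (ω i).2.2.2) (by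
      intro ω hω
      rw [hsum (fun ω => -lt ω), hprodlog (fun ω => t ω.1 ω.2.1 (oY ω.2.2.1) ω.2.2.2) ω
        fun i => hqt _ (hω i), hKN, mul_sub, Real.exp_add, Real.exp_sub, Finset.sum_neg_distrib,
        Real.exp_neg, ← div_eq_inv_mul]
      gcongr)
  have b3 := mean_min_one_le_pow P (fun ω => -(lw ω - lx ω) + R₁) hP0 hs₃.le hs₃'
    (fun ω : Fin N → X × X₁ × Z × V =>
      ((M - 1) * ∏ i, outLawX step oY p (ω i).1 (oY (ω i).2.2.1)) /
          ∏ i, outLaw step oY (ω i).1 (ω i).2.1 (oY (ω i).2.2.1)) (by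
      intro ω hω
      rw [hsum (fun ω => -(lw ω - lx ω)),
        hprodlog (fun ω => outLaw step oY ω.1 ω.2.1 (oY ω.2.2.1)) ω
        fun i => hout _ (hω i), hprodlog (fun ω => outLawX step oY p ω.1 (oY ω.2.2.1)) ω
        fun i => hoX _ (hω i), Real.exp_add, Finset.sum_neg_distrib, Finset.sum_sub_distrib,
        neg_sub, Real.exp_sub, div_mul_eq_mul_div, mul_comm (Real.exp (∑ i, lx (ω i)))]
      gcongr)
  have c1 := mul_le_mul_of_nonneg_left b1 hD00
  have c2 := mul_le_mul_of_nonneg_left b2 hD00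
  have c3 := mul_le_mul_of_nonneg_left b3 hL.le
  linarith

end Block

/-! ### Concatenation of blocks -/

section Chain

variable {X X₁ Y Y₁ Shat Z : Type*}

/-- Law of the outcomes of `n` channel uses when the source sends `x` and the relay acts by `rel`.
A relay map takes the whole sequence of relay outputs as argument; that it depends on the past only
is the property `IsCausal`. -/
def seqLaw (step : X → X₁ → Z → ℝ) (oY₁ : Z → Y₁) {n : ℕ} (x : Fin n → X)
    (rel : Fin n → (Fin n → Y₁) → X₁) (z : Fin n → Z) : ℝ :=
  ∏ i, step (x i) (rel i fun j => oY₁ (z j)) (z i)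

/-- The value at time `i` depends on the sequence before time `i` only. -/
def IsCausal {A B : Type*} {n : ℕ} (rel : Fin n → (Fin n → A) → B) : Prop :=
  ∀ i y y', (∀ j, j < i → y j = y' j) → rel i y = rel i y'

/-- A code for `n` channel uses, to be continued: the relay ends up with an index in `Fin M`, and
the estimates at the destination are made with this index as an additional argument. -/
structure OpenCode (X X₁ Y Y₁ Shat : Type*) (M n : ℕ) where
  x : Fin n → X
  rel : Fin n → (Fin n → Y₁) → X₁
  causal : IsCausal rel
  index : (Fin n → Y₁) → Fin M
  est : Fin M → (Fin n → Y) → Fin n → Shat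

namespace OpenCode

/-- Total mean distortion when the destination is told the final index of the relay. -/
def cost [Fintype Z] (step : X → X₁ → Z → ℝ) (oY : Z → Y) (oY₁ : Z → Y₁) (δ : Z → Shat → ℝ)
    {M n : ℕ} (c : OpenCode X X₁ Y Y₁ Shat M n) : ℝ :=
  ∑ z : Fin n → Z, seqLaw step oY₁ c.x c.rel z *
    ∑ i, δ (z i) (c.est (c.index fun j => oY₁ (z j)) (fun j => oY (z j)) i)

/-- A wrong index increases the total distortion by at most `B`. -/
def OscLE (oY : Z → Y) (δ : Z → Shat → ℝ) {M n : ℕ} (c : OpenCode X X₁ Y Y₁ Shat M n) (B : ℝ) :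
    Prop :=
  ∀ (z : Fin n → Z) (m m' : Fin M), ∑ i, δ (z i) (c.est m (fun j => oY (z j)) i) ≤
    ∑ i, δ (z i) (c.est m' (fun j => oY (z j)) i) + B

/-- Continue a code by one block. The destination decodes the index sent in the new block, and uses
it both for the preceding uses and for the new block. -/
def append {M n N : ℕ} (c : OpenCode X X₁ Y Y₁ Shat M n) (σ : BlockScheme X X₁ Y Y₁ Shat N M) :
    OpenCode X X₁ Y Y₁ Shat M (n + N) where
  x := Fin.append c.x σ.x
  rel i y₁ := Fin.addCases (motive := fun _ => X₁) (fun i => c.rel i fun j => y₁ (Fin.castAdd N j))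
    (fun i => σ.x₁ (c.index fun j => y₁ (Fin.castAdd N j)) i) i
  causal := by
    intro i y y' h
    induction i using Fin.addCases with
    | left i =>
      simp only [Fin.addCases_left]
      exact c.causal i _ _ fun j hj => h _ hj
    | right i =>
      simp only [Fin.addCases_right]
      congr 2
      funext j
      exact h _ (by simp only [Fin.lt_def, Fin.val_castAdd, Fin.val_natAdd]; omega)
  index y₁ := σ.compress (c.index fun j => y₁ (Fin.castAdd N j)) fun j => y₁ (Fin.natAdd n j)
  est m y := Fin.append
    (c.est (σ.dec fun j => y (Fin.natAdd n j)) fun j => y (Fin.castAdd N j))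
    (σ.est (σ.dec fun j => y (Fin.natAdd n j)) m fun j => y (Fin.natAdd n j))

theorem sum_append [Fintype Z] {n N : ℕ} (F : (Fin (n + N) → Z) → ℝ) :
    ∑ z, F z = ∑ z : Fin n → Z, ∑ z' : Fin N → Z, F (Fin.append z z') := by
  rw [← Fintype.sum_prod_type']
  exact (Fintype.sum_equiv (Fin.appendEquiv n N) _ _ fun z => rfl).symm

theorem seqLaw_append (step : X → X₁ → Z → ℝ) (oY₁ : Z → Y₁) {M n N : ℕ}
    (c : OpenCode X X₁ Y Y₁ Shat M n) (σ : BlockScheme X X₁ Y Y₁ Shat N M)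
    (z : Fin n → Z) (z' : Fin N → Z) :
    seqLaw step oY₁ (c.append σ).x (c.append σ).rel (Fin.append z z') =
      seqLaw step oY₁ c.x c.rel z *
        ∏ i, step (σ.x i) (σ.x₁ (c.index fun j => oY₁ (z j)) i) (z' i) := by
  simp [seqLaw, append, Fin.prod_univ_add]

theorem sum_seqLaw_append [Fintype Z] (step : X → X₁ → Z → ℝ) (oY₁ : Z → Y₁)
    (hstep1 : ∀ x x₁, ∑ z, step x x₁ z = 1) {M n N : ℕ}
    (c : OpenCode X X₁ Y Y₁ Shat M n) (hc : ∑ z, seqLaw step oY₁ c.x c.rel z = 1)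
    (σ : BlockScheme X X₁ Y Y₁ Shat N M) :
    ∑ z, seqLaw step oY₁ (c.append σ).x (c.append σ).rel z = 1 := by
  rw [sum_append]
  simp only [seqLaw_append, ← Finset.mul_sum]
  rw [← hc]
  refine Finset.sum_congr rfl fun z _ => ?_
  rw [prod_pmf_sum_one (fun i z' => step (σ.x i) (σ.x₁ _ i) z') fun i => hstep1 _ _, mul_one]

theorem oscLE_append (oY : Z → Y) (δ : Z → Shat → ℝ) (hδ : ∀ z s, 0 ≤ δ z s) {D₀ : ℝ}
    (hD₀ : ∀ z s, δ z s ≤ D₀) {M n N : ℕ} (c : OpenCode X X₁ Y Y₁ Shat M n)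
    (σ : BlockScheme X X₁ Y Y₁ Shat N M) : (c.append σ).OscLE oY δ (N * D₀) := by
  intro z m m'
  rw [Fin.sum_univ_add, Fin.sum_univ_add]
  simp only [append, Fin.append_left, Fin.append_right]
  have h1 : ∑ i : Fin N, δ (z (Fin.natAdd n i)) (σ.est (σ.dec fun j => oY (z (Fin.natAdd n j))) m
      (fun j => oY (z (Fin.natAdd n j))) i) ≤ N * D₀ := by
    refine (Finset.sum_le_sum fun i _ => hD₀ _ _).trans ?_
    simp
  have h2 : 0 ≤ ∑ i : Fin N, δ (z (Fin.natAdd n i))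
      (σ.est (σ.dec fun j => oY (z (Fin.natAdd n j))) m' (fun j => oY (z (Fin.natAdd n j))) i) :=
    Finset.sum_nonneg fun _ _ => hδ _ _
  linarith

open Classical in
/-- Appending a block adds `N` times its mean cost under the law of the current relay index. The
penalty for a decoding error has to be `2 * D₀`: an error spoils the estimates of the new block and,
through `OscLE`, those of the preceding block. -/
theorem cost_append_le [Fintype Z] (step : X → X₁ → Z → ℝ) (oY : Z → Y) (oY₁ : Z → Y₁)
    (δ : Z → Shat → ℝ)
    (hstep : ∀ x x₁ z, 0 ≤ step x x₁ z) (hstep1 : ∀ x x₁, ∑ z, step x x₁ z = 1)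
    (hδ : ∀ z s, 0 ≤ δ z s) {D₀ : ℝ} (hD₀ : ∀ z s, δ z s ≤ D₀)
    {M n N : ℕ} (hN : 0 < N) (c : OpenCode X X₁ Y Y₁ Shat M n) (hosc : c.OscLE oY δ (N * D₀))
    (σ : BlockScheme X X₁ Y Y₁ Shat N M) :
    (c.append σ).cost step oY oY₁ δ ≤ c.cost step oY oY₁ δ +
      N * ∑ m, (∑ z : Fin n → Z, if (c.index fun j => oY₁ (z j)) = m then
        seqLaw step oY₁ c.x c.rel z else 0) * σ.cost step oY oY₁ δ (2 * D₀) m := by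
  have hN0 : (0 : ℝ) < N := by exact_mod_cast hN
  have hμ : N * ∑ m, (∑ z : Fin n → Z, if (c.index fun j => oY₁ (z j)) = m then
        seqLaw step oY₁ c.x c.rel z else 0) * σ.cost step oY oY₁ δ (2 * D₀) m =
      ∑ z : Fin n → Z, seqLaw step oY₁ c.x c.rel z *
        (N * σ.cost step oY oY₁ δ (2 * D₀) (c.index fun j => oY₁ (z j))) := by
    simp only [Finset.sum_mul, Finset.mul_sum]
    rw [Finset.sum_comm]
    refine Finset.sum_congr rfl fun z _ => ?_
    rw [Finset.sum_eq_single (c.index fun j => oY₁ (z j))]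
    · rw [if_pos rfl]; ring
    · intro m _ hm
      rw [if_neg hm.symm]; ring
    · simp
  rw [hμ, cost, cost, sum_append, ← Finset.sum_add_distrib]
  refine Finset.sum_le_sum fun z _ => ?_
  rw [← mul_add]
  simp only [seqLaw_append, mul_assoc, ← Finset.mul_sum]
  refine mul_le_mul_of_nonneg_left ?_ (Finset.prod_nonneg fun i _ => hstep _ _ _)
  set m := c.index fun j => oY₁ (z j) with hm
  have h1 : ∑ i, δ (z i) (c.est m (fun j => oY (z j)) i) =
      ∑ z' : Fin N → Z, (∏ i, step (σ.x i) (σ.x₁ m i) (z' i)) *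
        ∑ i, δ (z i) (c.est m (fun j => oY (z j)) i) := by
    rw [← Finset.sum_mul, prod_pmf_sum_one (fun i z' => step (σ.x i) (σ.x₁ _ i) z')
      fun i => hstep1 _ _, one_mul]
  rw [h1, BlockScheme.cost, Finset.mul_sum, ← Finset.sum_add_distrib]
  refine Finset.sum_le_sum fun z' _ => ?_
  rw [mul_left_comm, ← mul_add]
  refine mul_le_mul_of_nonneg_left ?_ (Finset.prod_nonneg fun i _ => hstep _ _ _)
  rw [Fin.sum_univ_add]
  simp only [append, Fin.append_left, Fin.append_right, ← hm]
  by_cases hdec : (σ.dec fun j => oY (z' j)) = m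
  · rw [hdec, if_pos rfl, add_zero, ← mul_assoc, mul_one_div_cancel hN0.ne', one_mul]
  · have h3 := hosc z (σ.dec fun j => oY (z' j)) m
    have h4 : ∑ i, δ (z' i) (σ.est (σ.dec fun j => oY (z' j))
        (σ.compress m fun j => oY₁ (z' j)) (fun j => oY (z' j)) i) ≤ N * D₀ := by
      refine (Finset.sum_le_sum fun i _ => hD₀ _ _).trans ?_
      simp
    have h5 : 0 ≤ ∑ i, δ (z' i) (σ.est m (σ.compress m fun j => oY₁ (z' j))
        (fun j => oY (z' j)) i) := Finset.sum_nonneg fun _ _ => hδ _ _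
    rw [if_neg hdec, mul_add, ← mul_assoc, mul_one_div_cancel hN0.ne', one_mul]
    linarith

end OpenCode

/-- If for every law of the relay index some block scheme has mean cost at most `D`, then there are
codes of all lengths `n` whose total mean distortion exceeds `n * D` by a constant at most. Each
block scheme is chosen for the law of the relay index that the preceding blocks give rise to. -/
theorem exists_code_of_blockScheme [Fintype Z] [Nonempty X] [Nonempty X₁] [Nonempty Shat]
    (step : X → X₁ → Z → ℝ) (oY : Z → Y) (oY₁ : Z → Y₁) (δ : Z → Shat → ℝ)
    (hstep : ∀ x x₁ z, 0 ≤ step x x₁ z) (hstep1 : ∀ x x₁, ∑ z, step x x₁ z = 1)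
    (hδ : ∀ z s, 0 ≤ δ z s) {D₀ : ℝ} (hD₀0 : 0 ≤ D₀) (hD₀ : ∀ z s, δ z s ≤ D₀) {N M : ℕ}
    (hN : 0 < N) (hM : 0 < M) {D : ℝ}
    (hD : 0 ≤ D) (h : ∀ μ : Fin M → ℝ, (∀ m, 0 ≤ μ m) → ∑ m, μ m = 1 →
      ∃ σ : BlockScheme X X₁ Y Y₁ Shat N M, ∑ m, μ m * σ.cost step oY oY₁ δ (2 * D₀) m ≤ D)
    (n : ℕ) :
    ∃ (x : Fin n → X) (rel : Fin n → (Fin n → Y₁) → X₁) (est : (Fin n → Y) → Fin n → Shat),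
      IsCausal rel ∧ ∑ z : Fin n → Z, seqLaw step oY₁ x rel z *
        ∑ i, δ (z i) (est (fun j => oY (z j)) i) ≤ n * D + 2 * N * D₀ := by
  classical
  have key : ∀ n, ∃ c : OpenCode X X₁ Y Y₁ Shat M n, ∑ z, seqLaw step oY₁ c.x c.rel z = 1 ∧
      c.OscLE oY δ (N * D₀) ∧ c.cost step oY oY₁ δ ≤ n * D + N * D₀ := by
    intro n
    induction n using Nat.strong_induction_on with
    | _ n ih =>
      rcases lt_or_ge n N with hn | hn
      -- the first `n % N` channel uses are wasted
      · obtain ⟨x⟩ := ‹Nonempty X›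
        obtain ⟨x₁⟩ := ‹Nonempty X₁›
        obtain ⟨s⟩ := ‹Nonempty Shat›
        refine ⟨⟨fun _ => x, fun _ _ => x₁, fun _ _ _ _ => rfl, fun _ => ⟨0, hM⟩,
          fun _ _ _ => s⟩, ?_, ?_, ?_⟩
        · exact prod_pmf_sum_one (fun _ z' => step x x₁ z') fun i => hstep1 _ _
        · intro z m m'
          have : 0 ≤ N * D₀ := by positivity
          simpa using this
        · have hn' : (n : ℝ) ≤ N := by exact_mod_cast hn.le
          calc _ ≤ ∑ z : Fin n → Z, (∏ i, step x x₁ (z i)) * (n * D₀) := by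
                refine Finset.sum_le_sum fun z _ => mul_le_mul_of_nonneg_left ?_
                  (Finset.prod_nonneg fun i _ => hstep _ _ _)
                refine (Finset.sum_le_sum fun i _ => hD₀ _ _).trans ?_
                simp
            _ = n * D₀ := by
                rw [← Finset.sum_mul, prod_pmf_sum_one (fun _ z' => step x x₁ z')
                  fun i => hstep1 _ _, one_mul]
            _ ≤ n * D + N * D₀ := by
                have : 0 ≤ n * D := by positivity
                nlinarith
      · obtain ⟨n, rfl⟩ := Nat.exists_eq_add_of_le' hn
        obtain ⟨c, hc1, hosc, hcost⟩ := ih n (by omega)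
        obtain ⟨σ, hσ⟩ := h (fun m => ∑ z : Fin n → Z, if (c.index fun j => oY₁ (z j)) = m then
            seqLaw step oY₁ c.x c.rel z else 0)
          (fun m => Finset.sum_nonneg fun z _ => by
            split_ifs
            exacts [Finset.prod_nonneg fun i _ => hstep _ _ _, le_rfl])
          (by rw [Finset.sum_comm, ← hc1]; simp)
        refine ⟨c.append σ, c.sum_seqLaw_append step oY₁ hstep1 hc1 σ,
          c.oscLE_append oY δ hδ hD₀ σ, ?_⟩
        have h1 := c.cost_append_le step oY oY₁ δ hstep hstep1 hδ hD₀ hN hosc σ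
        have h2 : (N : ℝ) * _ ≤ N * D := mul_le_mul_of_nonneg_left hσ (Nat.cast_nonneg N)
        push_cast
        linarith
  obtain ⟨c, hc1, hosc, hcost⟩ := key n
  -- the index of the last block is never sent; the destination assumes that it is `0`
  refine ⟨c.x, c.rel, c.est ⟨0, hM⟩, c.causal, ?_⟩
  calc _ ≤ ∑ z : Fin n → Z, seqLaw step oY₁ c.x c.rel z *
        (∑ i, δ (z i) (c.est (c.index fun j => oY₁ (z j)) (fun j => oY (z j)) i) + N * D₀) :=
        Finset.sum_le_sum fun z _ => mul_le_mul_of_nonneg_left (hosc z _ _)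
          (Finset.prod_nonneg fun i _ => hstep _ _ _)
    _ = c.cost step oY oY₁ δ + N * D₀ := by
        simp only [mul_add, Finset.sum_add_distrib]
        rw [← Finset.sum_mul, hc1, one_mul]
        rfl
    _ ≤ _ := by linarith

end Chain

/-! ### Information measures as means of logarithms -/

section Marginals

variable {Ω α β γ : Type*} [Fintype Ω]

theorem pmfOf_nonneg {P : Ω → ℝ} (hP : ∀ ω, 0 ≤ P ω) (A : Ω → α) (a : α) : 0 ≤ pmfOf P A a :=
  Finset.sum_nonneg fun ω _ => by split_ifs; exacts [hP ω, le_rfl]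

theorem sum_pmfOf_mul [Fintype α] (P : Ω → ℝ) (A : Ω → α) (f : α → ℝ) :
    ∑ a, pmfOf P A a * f a = ∑ ω, P ω * f (A ω) := by
  classical
  simp only [pmfOf, Finset.sum_mul]
  rw [Finset.sum_comm]
  simp

/-- Marginalization: the event `A = a` is the disjoint union of the events `A' = f b`. -/
theorem pmfOf_eq_sum [Fintype β] (P : Ω → ℝ) {A : Ω → α} {a : α} {γ : Type*} (A' : Ω → γ)
    {f : β → γ} (hf : Function.Injective f) (h : ∀ ω, A ω = a ↔ ∃ b, A' ω = f b) :
    pmfOf P A a = ∑ b, pmfOf P A' (f b) := by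
  classical
  simp only [pmfOf]
  rw [Finset.sum_comm]
  refine Finset.sum_congr rfl fun ω _ => ?_
  split_ifs with ha
  · obtain ⟨b, hb⟩ := (h ω).1 ha
    rw [Finset.sum_eq_single b, if_pos hb]
    · intro b' _ hb'
      rw [if_neg fun h' => hb' (hf (h'.symm.trans hb))]
    · simp
  · refine (Finset.sum_eq_zero fun b _ => ?_).symm
    rw [if_neg fun hb => ha ((h ω).2 ⟨b, hb⟩)]

/-- The value of `pmfOf` depends on the event only. -/
theorem pmfOf_congr (P : Ω → ℝ) {A : Ω → α} {a : α} {γ : Type*} {A' : Ω → γ} {a' : γ}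
    (h : ∀ ω, A ω = a ↔ A' ω = a') : pmfOf P A a = pmfOf P A' a' := by
  classical
  refine Finset.sum_congr rfl fun ω _ => ?_
  by_cases hω : A ω = a
  · rw [if_pos hω, if_pos ((h ω).1 hω)]
  · rw [if_neg hω, if_neg fun h' => hω ((h ω).2 h')]

theorem entropy_eq_mean [Fintype α] (P : Ω → ℝ) (A : Ω → α) :
    entropy P A = -∑ ω, P ω * Real.logb 2 (pmfOf P A (A ω)) := by
  rw [entropy, sum_pmfOf_mul P A fun a => Real.logb 2 (pmfOf P A a)]

theorem condMutualInfo_eq_mean [Fintype α] [Fintype β] [Fintype γ] (P : Ω → ℝ)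
    (A : Ω → α) (B : Ω → β) (C : Ω → γ) :
    condMutualInfo P A B C * Real.log 2 = ∑ ω, P ω *
      (Real.log (pmfOf P (fun ω => (A ω, B ω, C ω)) (A ω, B ω, C ω)) + Real.log (pmfOf P C (C ω)) -
        Real.log (pmfOf P (fun ω => (A ω, C ω)) (A ω, C ω)) -
        Real.log (pmfOf P (fun ω => (B ω, C ω)) (B ω, C ω))) := by
  have h2 : Real.log 2 ≠ 0 := (Real.log_pos one_lt_two).ne'
  simp only [condMutualInfo, condEntropy, entropy_eq_mean, Real.logb, mul_add, mul_sub,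
    Finset.sum_add_distrib, Finset.sum_sub_distrib, ← mul_div_assoc, ← Finset.sum_div]
  field_simp
  ring

end Marginals

/-! ### Single-letter quantities

The law `q x x₁ y₁` of the auxiliary variable enters the constraint and the distortion through its
columns `c = fun x x₁ y₁ => q x x₁ y₁ v`, one for each value `v`, and each column contributes a
term that is homogeneous of degree one. -/

namespace RelayChannel

open LetterOutcome

variable {X X₁ S Sd Shat Y Y₁ : Type*} [Fintype S] [Fintype Sd] [Fintype Y] [Fintype Y₁]

noncomputable section

/-- Law of the output pair given the inputs. -/
def pairLaw (ch : RelayChannel X X₁ S Sd Y Y₁) (x : X) (x₁ : X₁) (y : Y) (y₁ : Y₁) : ℝ :=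
  ∑ s, ∑ sd, ch.state (s, sd) * ch.trans x x₁ s (y, y₁)

/-- Law of the output at the destination given the inputs. -/
def yLaw (ch : RelayChannel X X₁ S Sd Y Y₁) (x : X) (x₁ : X₁) (y : Y) : ℝ :=
  ∑ y₁, ch.pairLaw x x₁ y y₁

/-- Mean distortion of the estimate `s'` on the event that the outputs are `y` and `y₁`. -/
def costLaw (ch : RelayChannel X X₁ S Sd Y Y₁) (d : Sd → Shat → ℝ) (x : X) (x₁ : X₁) (y : Y)
    (y₁ : Y₁) (s' : Shat) : ℝ :=
  ∑ s, ∑ sd, ch.state (s, sd) * ch.trans x x₁ s (y, y₁) * d sd s'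

/-- Weight of the column `c` given the output `y`: the conditional probability of the value of `V`
to which the column belongs. -/
def mix (ch : RelayChannel X X₁ S Sd Y Y₁) (x : X) (x₁ : X₁) (y : Y) (c : Y₁ → ℝ) : ℝ :=
  (∑ y₁, ch.pairLaw x x₁ y y₁ * c y₁) / ch.yLaw x x₁ y

/-- Contribution of a column to `I(V; Y₁ | Y)` (in nats), for given inputs. -/
def infoAt (ch : RelayChannel X X₁ S Sd Y Y₁) (x : X) (x₁ : X₁) (c : Y₁ → ℝ) : ℝ :=
  ∑ y, ∑ y₁, ch.pairLaw x x₁ y y₁ * c y₁ * (Real.log (c y₁) - Real.log (ch.mix x x₁ y c))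

/-- Contribution of a column to the smallest mean distortion, for given inputs. -/
def costAt [Fintype Shat] [Nonempty Shat] (ch : RelayChannel X X₁ S Sd Y Y₁) (d : Sd → Shat → ℝ)
    (x : X) (x₁ : X₁) (c : Y₁ → ℝ) : ℝ :=
  ∑ y, Finset.univ.inf' Finset.univ_nonempty fun s' : Shat => ∑ y₁, c y₁ * ch.costLaw d x x₁ y y₁ s'

/-- `I(X₁; Y | X)` in nats. -/
def chanInfo [Fintype X] [Fintype X₁] (ch : RelayChannel X X₁ S Sd Y Y₁) (p : X × X₁ → ℝ) : ℝ :=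
  ∑ x, ∑ x₁, ∑ y, p (x, x₁) * ch.yLaw x x₁ y * (Real.log (ch.yLaw x x₁ y) -
    Real.log (∑ x₁', p (x, x₁') / (∑ x₁'', p (x, x₁'')) * ch.yLaw x x₁' y))

theorem pairLaw_nonneg (ch : RelayChannel X X₁ S Sd Y Y₁) (x : X) (x₁ : X₁) (y : Y) (y₁ : Y₁) :
    0 ≤ ch.pairLaw x x₁ y y₁ :=
  Finset.sum_nonneg fun _ _ => Finset.sum_nonneg fun _ _ =>
    mul_nonneg (ch.state_mem.1 _) ((ch.trans_mem _ _ _).1 _)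

theorem yLaw_nonneg (ch : RelayChannel X X₁ S Sd Y Y₁) (x : X) (x₁ : X₁) (y : Y) :
    0 ≤ ch.yLaw x x₁ y :=
  Finset.sum_nonneg fun _ _ => ch.pairLaw_nonneg _ _ _ _

theorem sum_yLaw (ch : RelayChannel X X₁ S Sd Y Y₁) (x : X) (x₁ : X₁) :
    ∑ y, ch.yLaw x x₁ y = 1 := by
  simp only [yLaw, pairLaw]
  rw [← ch.state_mem.2, ← Fintype.sum_prod_type' (f := fun y y₁ => ∑ s, ∑ sd,
    ch.state (s, sd) * ch.trans x x₁ s (y, y₁)), Finset.sum_comm, Fintype.sum_prod_type]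
  refine Finset.sum_congr rfl fun s _ => ?_
  rw [Finset.sum_comm]
  refine Finset.sum_congr rfl fun sd _ => ?_
  rw [← Finset.mul_sum, (ch.trans_mem x x₁ s).2, mul_one]

theorem costLaw_nonneg (ch : RelayChannel X X₁ S Sd Y Y₁) {d : Sd → Shat → ℝ}
    (hd : ∀ sd s', 0 ≤ d sd s') (x : X) (x₁ : X₁) (y : Y) (y₁ : Y₁) (s' : Shat) :
    0 ≤ ch.costLaw d x x₁ y y₁ s' :=
  Finset.sum_nonneg fun _ _ => Finset.sum_nonneg fun _ _ =>
    mul_nonneg (mul_nonneg (ch.state_mem.1 _) ((ch.trans_mem _ _ _).1 _)) (hd _ _)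

theorem letterPMF_nonneg (ch : RelayChannel X X₁ S Sd Y Y₁) {k : ℕ} {p : X × X₁ → ℝ}
    {q : X → X₁ → Y₁ → Fin k → ℝ} (hp : ∀ a, 0 ≤ p a) (hq : ∀ x x₁ y₁ v, 0 ≤ q x x₁ y₁ v)
    (ω : LetterOutcome X X₁ S Sd Y Y₁ k) : 0 ≤ ch.letterPMF p q ω :=
  mul_nonneg (mul_nonneg (mul_nonneg (hp _) (ch.state_mem.1 _)) ((ch.trans_mem _ _ _).1 _))
    (hq _ _ _ _)

section LetterMarginals

variable [Fintype X] [Fintype X₁] (ch : RelayChannel X X₁ S Sd Y Y₁) {k : ℕ} (p : X × X₁ → ℝ)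
    (q : X → X₁ → Y₁ → Fin k → ℝ)

theorem pmfOf_letterPMF_V_Y₁_XX₁Y (v : Fin k) (y₁ : Y₁) (x : X) (x₁ : X₁) (y : Y) :
    pmfOf (ch.letterPMF p q) (fun ω => (rvV ω, rvY₁ ω, rvXX₁Y ω)) (v, y₁, x, x₁, y) =
      p (x, x₁) * ch.pairLaw x x₁ y y₁ * q x x₁ y₁ v := by
  classical
  simp only [pmfOf, letterPMF, rvXX₁Y, rvX, rvX₁, rvY, rvY₁, rvV, Prod.mk.injEq, ite_and,
    Fintype.sum_prod_type, pairLaw]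
  simp [Finset.mul_sum, Finset.sum_mul, mul_assoc]

theorem pmfOf_letterPMF_V_XX₁Y (v : Fin k) (x : X) (x₁ : X₁) (y : Y) :
    pmfOf (ch.letterPMF p q) (fun ω => (rvV ω, rvXX₁Y ω)) (v, x, x₁, y) =
      p (x, x₁) * ∑ y₁, ch.pairLaw x x₁ y y₁ * q x x₁ y₁ v := by
  rw [pmfOf_eq_sum _ (fun ω => (rvV ω, rvY₁ ω, rvXX₁Y ω)) (f := fun y₁ => (v, y₁, x, x₁, y))
    (fun _ _ h => by simpa using h) (fun ω => by simp [rvXX₁Y])]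
  simp only [pmfOf_letterPMF_V_Y₁_XX₁Y, Finset.mul_sum, mul_assoc]

theorem pmfOf_letterPMF_Sd_XX₁YV (sd : Sd) (x : X) (x₁ : X₁) (y : Y) (v : Fin k) :
    pmfOf (ch.letterPMF p q) (fun ω => (rvSd ω, rvXX₁YV ω)) (sd, x, x₁, y, v) =
      p (x, x₁) * ∑ y₁, q x x₁ y₁ v * ∑ s, ch.state (s, sd) * ch.trans x x₁ s (y, y₁) := by
  classical
  simp only [pmfOf, letterPMF, rvXX₁YV, rvX, rvX₁, rvY, rvV, rvSd, Prod.mk.injEq, ite_and,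
    Fintype.sum_prod_type]
  simp only [Finset.sum_ite_irrel, Finset.sum_const_zero, Finset.sum_ite_eq', Finset.mem_univ,
    if_true, Finset.mul_sum]
  rw [Finset.sum_comm]
  refine Finset.sum_congr rfl fun s _ => Finset.sum_congr rfl fun y₁ _ => ?_
  ring

theorem pmfOf_letterPMF_Y₁_XX₁Y (hq1 : ∀ x x₁ y₁, ∑ v, q x x₁ y₁ v = 1)
    (y₁ : Y₁) (x : X) (x₁ : X₁) (y : Y) :
    pmfOf (ch.letterPMF p q) (fun ω => (rvY₁ ω, rvXX₁Y ω)) (y₁, x, x₁, y) =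
      p (x, x₁) * ch.pairLaw x x₁ y y₁ := by
  rw [pmfOf_eq_sum _ (fun ω => (rvV ω, rvY₁ ω, rvXX₁Y ω)) (f := fun v => (v, y₁, x, x₁, y))
    (fun _ _ h => by simpa using h) (fun ω => by simp)]
  simp only [pmfOf_letterPMF_V_Y₁_XX₁Y, ← Finset.mul_sum, hq1, mul_one]

theorem pmfOf_letterPMF_XX₁Y (hq1 : ∀ x x₁ y₁, ∑ v, q x x₁ y₁ v = 1) (x : X) (x₁ : X₁) (y : Y) :
    pmfOf (ch.letterPMF p q) rvXX₁Y (x, x₁, y) = p (x, x₁) * ch.yLaw x x₁ y := by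
  rw [pmfOf_eq_sum _ (fun ω => (rvY₁ ω, rvXX₁Y ω)) (f := fun y₁ => (y₁, x, x₁, y))
    (fun _ _ h => by simpa using h) (fun ω => by simp)]
  simp only [pmfOf_letterPMF_Y₁_XX₁Y ch p q hq1, ← Finset.mul_sum, yLaw]

theorem pmfOf_letterPMF_X₁_Y_X (hq1 : ∀ x x₁ y₁, ∑ v, q x x₁ y₁ v = 1) (x : X) (x₁ : X₁) (y : Y) :
    pmfOf (ch.letterPMF p q) (fun ω => (rvX₁ ω, rvY ω, rvX ω)) (x₁, y, x) =
      p (x, x₁) * ch.yLaw x x₁ y := by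
  rw [← pmfOf_letterPMF_XX₁Y ch p q hq1]
  exact pmfOf_congr _ fun ω => by simp only [rvXX₁Y, Prod.mk.injEq]; tauto

theorem pmfOf_letterPMF_Y_X (hq1 : ∀ x x₁ y₁, ∑ v, q x x₁ y₁ v = 1) (x : X) (y : Y) :
    pmfOf (ch.letterPMF p q) (fun ω => (rvY ω, rvX ω)) (y, x) =
      ∑ x₁, p (x, x₁) * ch.yLaw x x₁ y := by
  rw [pmfOf_eq_sum _ (fun ω => (rvX₁ ω, rvY ω, rvX ω)) (f := fun x₁ => (x₁, y, x))
    (fun _ _ h => by simpa using h) (fun ω => by simp)]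
  simp only [pmfOf_letterPMF_X₁_Y_X ch p q hq1]

theorem pmfOf_letterPMF_X₁_X (hq1 : ∀ x x₁ y₁, ∑ v, q x x₁ y₁ v = 1) (x : X) (x₁ : X₁) :
    pmfOf (ch.letterPMF p q) (fun ω => (rvX₁ ω, rvX ω)) (x₁, x) = p (x, x₁) := by
  rw [pmfOf_eq_sum _ (fun ω => (rvX₁ ω, rvY ω, rvX ω)) (f := fun y => (x₁, y, x))
    (fun _ _ h => by simpa using h) (fun ω => by simp)]
  simp only [pmfOf_letterPMF_X₁_Y_X ch p q hq1, ← Finset.mul_sum, sum_yLaw, mul_one]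

theorem pmfOf_letterPMF_X (hq1 : ∀ x x₁ y₁, ∑ v, q x x₁ y₁ v = 1) (x : X) :
    pmfOf (ch.letterPMF p q) rvX x = ∑ x₁, p (x, x₁) := by
  rw [pmfOf_eq_sum _ (fun ω => (rvX₁ ω, rvX ω)) (f := fun x₁ => (x₁, x))
    (fun _ _ h => by simpa using h) (fun ω => by simp)]
  simp only [pmfOf_letterPMF_X₁_X ch p q hq1]

theorem condMutualInfo_V_Y₁ (hp : ∀ a, 0 ≤ p a) (hq : ∀ x x₁ y₁ v, 0 ≤ q x x₁ y₁ v)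
    (hq1 : ∀ x x₁ y₁, ∑ v, q x x₁ y₁ v = 1) :
    condMutualInfo (ch.letterPMF p q) rvV rvY₁ rvXX₁Y * Real.log 2 =
      ∑ v, ∑ x, ∑ x₁, p (x, x₁) * ch.infoAt x x₁ fun y₁ => q x x₁ y₁ v := by
  rw [condMutualInfo_eq_mean]
  rw [← sum_pmfOf_mul (ch.letterPMF p q) (fun ω => (rvV ω, rvY₁ ω, rvXX₁Y ω)) (fun a =>
    Real.log (pmfOf (ch.letterPMF p q) (fun ω => (rvV ω, rvY₁ ω, rvXX₁Y ω)) a) +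
    Real.log (pmfOf (ch.letterPMF p q) rvXX₁Y a.2.2) -
    Real.log (pmfOf (ch.letterPMF p q) (fun ω => (rvV ω, rvXX₁Y ω)) (a.1, a.2.2)) -
    Real.log (pmfOf (ch.letterPMF p q) (fun ω => (rvY₁ ω, rvXX₁Y ω)) a.2))]
  simp only [Fintype.sum_prod_type, pmfOf_letterPMF_V_Y₁_XX₁Y, pmfOf_letterPMF_V_XX₁Y,
    pmfOf_letterPMF_Y₁_XX₁Y ch p q hq1, pmfOf_letterPMF_XX₁Y ch p q hq1]
  refine Finset.sum_congr rfl fun v _ => ?_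
  rw [Finset.sum_comm]
  refine Finset.sum_congr rfl fun x _ => ?_
  rw [Finset.sum_comm]
  refine Finset.sum_congr rfl fun x₁ _ => ?_
  rw [infoAt, Finset.mul_sum, Finset.sum_comm]
  refine Finset.sum_congr rfl fun y _ => ?_
  conv_rhs => rw [Finset.mul_sum]
  refine Finset.sum_congr rfl fun y₁ _ => ?_
  rcases (hp (x, x₁)).eq_or_lt with h0 | hp0
  · simp [← h0]
  rcases (ch.pairLaw_nonneg x x₁ y y₁).eq_or_lt with h0 | hw0
  · simp [← h0]
  rcases (hq x x₁ y₁ v).eq_or_lt with h0 | hq0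
  · simp [← h0]
  have hy : 0 < ch.yLaw x x₁ y := hw0.trans_le
    (Finset.single_le_sum (f := fun y₁ => ch.pairLaw x x₁ y y₁)
      (fun _ _ => ch.pairLaw_nonneg _ _ _ _) (Finset.mem_univ y₁))
  have hm : 0 < ∑ y₁, ch.pairLaw x x₁ y y₁ * q x x₁ y₁ v := (mul_pos hw0 hq0).trans_le
    (Finset.single_le_sum (f := fun y₁ => ch.pairLaw x x₁ y y₁ * q x x₁ y₁ v)
      (fun _ _ => mul_nonneg (ch.pairLaw_nonneg _ _ _ _) (hq _ _ _ _)) (Finset.mem_univ y₁))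
  rw [mix, Real.log_div hm.ne' hy.ne', Real.log_mul (by positivity) hq0.ne',
    Real.log_mul hp0.ne' hw0.ne', Real.log_mul hp0.ne' hm.ne', Real.log_mul hp0.ne' hy.ne']
  ring

theorem condMutualInfo_X₁_Y (hp : ∀ a, 0 ≤ p a) (hq1 : ∀ x x₁ y₁, ∑ v, q x x₁ y₁ v = 1) :
    condMutualInfo (ch.letterPMF p q) rvX₁ rvY rvX * Real.log 2 = ch.chanInfo p := by
  rw [condMutualInfo_eq_mean]
  rw [← sum_pmfOf_mul (ch.letterPMF p q) (fun ω => (rvX₁ ω, rvY ω, rvX ω)) (fun a =>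
    Real.log (pmfOf (ch.letterPMF p q) (fun ω => (rvX₁ ω, rvY ω, rvX ω)) a) +
    Real.log (pmfOf (ch.letterPMF p q) rvX a.2.2) -
    Real.log (pmfOf (ch.letterPMF p q) (fun ω => (rvX₁ ω, rvX ω)) (a.1, a.2.2)) -
    Real.log (pmfOf (ch.letterPMF p q) (fun ω => (rvY ω, rvX ω)) a.2))]
  simp only [Fintype.sum_prod_type, pmfOf_letterPMF_X₁_Y_X ch p q hq1,
    pmfOf_letterPMF_X ch p q hq1, pmfOf_letterPMF_X₁_X ch p q hq1, pmfOf_letterPMF_Y_X ch p q hq1]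
  rw [chanInfo]
  conv_rhs => rw [Finset.sum_comm]
  refine Finset.sum_congr rfl fun x₁ _ => ?_
  rw [Finset.sum_comm]
  refine Finset.sum_congr rfl fun x _ => Finset.sum_congr rfl fun y _ => ?_
  rcases (hp (x, x₁)).eq_or_lt with h0 | hp0
  · simp [← h0]
  rcases (ch.yLaw_nonneg x x₁ y).eq_or_lt with h0 | hw0
  · simp [← h0]
  have hx : 0 < ∑ x₁, p (x, x₁) := hp0.trans_le
    (Finset.single_le_sum (f := fun x₁ => p (x, x₁)) (fun _ _ => hp _) (Finset.mem_univ x₁))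
  have hm : 0 < ∑ x₁, p (x, x₁) * ch.yLaw x x₁ y := (mul_pos hp0 hw0).trans_le
    (Finset.single_le_sum (f := fun x₁ => p (x, x₁) * ch.yLaw x x₁ y)
      (fun _ _ => mul_nonneg (hp _) (ch.yLaw_nonneg _ _ _)) (Finset.mem_univ x₁))
  have h1 : ∑ x₁', p (x, x₁') / (∑ x₁'', p (x, x₁'')) * ch.yLaw x x₁' y =
      (∑ x₁, p (x, x₁) * ch.yLaw x x₁ y) / ∑ x₁, p (x, x₁) := by
    rw [Finset.sum_div]
    exact Finset.sum_congr rfl fun _ _ => by ring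
  rw [h1, Real.log_div hm.ne' hx.ne', Real.log_mul hp0.ne' hw0.ne']
  ring

theorem sum_pmfOf_Sd_mul (d : Sd → Shat → ℝ) (s' : Shat) (x : X) (x₁ : X₁) (y : Y) (v : Fin k) :
    ∑ sd, pmfOf (ch.letterPMF p q) (fun ω => (rvSd ω, rvXX₁YV ω)) (sd, x, x₁, y, v) * d sd s' =
      p (x, x₁) * ∑ y₁, q x x₁ y₁ v * ch.costLaw d x x₁ y y₁ s' := by
  simp only [pmfOf_letterPMF_Sd_XX₁YV, costLaw, mul_assoc, Finset.sum_mul]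
  rw [← Finset.mul_sum, Finset.sum_comm]
  congr 1
  refine Finset.sum_congr rfl fun y₁ _ => ?_
  rw [← Finset.mul_sum, Finset.sum_comm]

/-- Mean distortion of an arbitrary estimator. -/
theorem expect_letterPMF (d : Sd → Shat → ℝ) (g : X × X₁ × Y × Fin k → Shat) :
    expect (ch.letterPMF p q) (fun ω => d (rvSd ω) (g (rvXX₁YV ω))) =
      ∑ v, ∑ x, ∑ x₁, ∑ y, p (x, x₁) * ∑ y₁, q x x₁ y₁ v *
        ch.costLaw d x x₁ y y₁ (g (x, x₁, y, v)) := by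
  rw [expect, ← sum_pmfOf_mul (ch.letterPMF p q) (fun ω => (rvSd ω, rvXX₁YV ω))
    (fun a => d a.1 (g a.2)), Fintype.sum_prod_type_right]
  simp only [Fintype.sum_prod_type, sum_pmfOf_Sd_mul]
  conv_rhs => rw [Finset.sum_comm]
  refine Finset.sum_congr rfl fun x _ => ?_
  conv_rhs => rw [Finset.sum_comm]
  refine Finset.sum_congr rfl fun x₁ _ => ?_
  rw [Finset.sum_comm]

theorem isBayesEstimator_iff (hp : ∀ a, 0 ≤ p a) (hq : ∀ x x₁ y₁ v, 0 ≤ q x x₁ y₁ v)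
    (d : Sd → Shat → ℝ) (g : X × X₁ × Y × Fin k → Shat) :
    IsBayesEstimator d (ch.letterPMF p q) g ↔ ∀ x x₁ y v s',
      p (x, x₁) * ∑ y₁, q x x₁ y₁ v * ch.costLaw d x x₁ y y₁ (g (x, x₁, y, v)) ≤
      p (x, x₁) * ∑ y₁, q x x₁ y₁ v * ch.costLaw d x x₁ y y₁ s' := by
  have hP := ch.letterPMF_nonneg hp hq
  simp only [← sum_pmfOf_Sd_mul]
  simp only [IsBayesEstimator, posterior, div_mul_eq_mul_div, ← Finset.sum_div, Prod.forall]
  refine forall_congr' fun x => forall_congr' fun x₁ => forall_congr' fun y =>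
    forall_congr' fun v => forall_congr' fun s' => ?_
  rcases (pmfOf_nonneg hP rvXX₁YV (x, x₁, y, v)).eq_or_lt with h0 | h0
  · have hsum : pmfOf (ch.letterPMF p q) rvXX₁YV (x, x₁, y, v) = ∑ sd,
        pmfOf (ch.letterPMF p q) (fun ω => (rvSd ω, rvXX₁YV ω)) (sd, x, x₁, y, v) :=
      pmfOf_eq_sum _ _ (f := fun sd => (sd, x, x₁, y, v))
        (fun _ _ h => by simpa using h) (fun ω => by simp)
    rw [← h0] at hsum
    have hz := (Finset.sum_eq_zero_iff_of_nonneg fun sd _ => pmfOf_nonneg hP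
      (fun ω => (rvSd ω, rvXX₁YV ω)) (sd, x, x₁, y, v)).1 hsum.symm
    simp only [Finset.mem_univ, true_imp_iff] at hz
    simp [hz]
  · exact div_le_div_iff_of_pos_right h0

/-- The smallest mean distortion of an estimator, as a sum over the columns of `q`. -/
def bayesCost [Fintype Shat] [Nonempty Shat] (d : Sd → Shat → ℝ) : ℝ :=
  ∑ v, ∑ x, ∑ x₁, p (x, x₁) * ch.costAt d x x₁ fun y₁ => q x x₁ y₁ v

theorem bayesCost_le_expect [Fintype Shat] [Nonempty Shat] (hp : ∀ a, 0 ≤ p a)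
    (d : Sd → Shat → ℝ) (g : X × X₁ × Y × Fin k → Shat) :
    ch.bayesCost p q d ≤ expect (ch.letterPMF p q) (fun ω => d (rvSd ω) (g (rvXX₁YV ω))) := by
  rw [expect_letterPMF, bayesCost]
  refine Finset.sum_le_sum fun v _ => Finset.sum_le_sum fun x _ => Finset.sum_le_sum fun x₁ _ => ?_
  rw [costAt, Finset.mul_sum]
  exact Finset.sum_le_sum fun y _ => mul_le_mul_of_nonneg_left
    (Finset.inf'_le (fun s' => ∑ y₁, q x x₁ y₁ v * ch.costLaw d x x₁ y y₁ s')
      (Finset.mem_univ _)) (hp _)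

theorem bayesCost_eq_expect [Fintype Shat] [Nonempty Shat] (hp : ∀ a, 0 ≤ p a)
    (hq : ∀ x x₁ y₁ v, 0 ≤ q x x₁ y₁ v) (d : Sd → Shat → ℝ) (g : X × X₁ × Y × Fin k → Shat)
    (hg : IsBayesEstimator d (ch.letterPMF p q) g) :
    expect (ch.letterPMF p q) (fun ω => d (rvSd ω) (g (rvXX₁YV ω))) = ch.bayesCost p q d := by
  refine le_antisymm ?_ (ch.bayesCost_le_expect p q hp d g)
  rw [isBayesEstimator_iff ch p q hp hq] at hg
  rw [expect_letterPMF, bayesCost]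
  refine Finset.sum_le_sum fun v _ => Finset.sum_le_sum fun x _ => Finset.sum_le_sum fun x₁ _ => ?_
  rw [costAt, Finset.mul_sum]
  refine Finset.sum_le_sum fun y _ => ?_
  obtain ⟨s', -, hs'⟩ := Finset.exists_mem_eq_inf' (Finset.univ_nonempty (α := Shat))
    fun s' => ∑ y₁, q x x₁ y₁ v * ch.costLaw d x x₁ y y₁ s'
  rw [hs']
  exact hg x x₁ y v s'

theorem exists_isBayesEstimator [Finite Shat] [Nonempty Shat] (hp : ∀ a, 0 ≤ p a)
    (hq : ∀ x x₁ y₁ v, 0 ≤ q x x₁ y₁ v) (d : Sd → Shat → ℝ) :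
    ∃ g, IsBayesEstimator d (ch.letterPMF p q) g := by
  have : ∀ t : X × X₁ × Y × Fin k, ∃ s, ∀ s', p (t.1, t.2.1) * ∑ y₁, q t.1 t.2.1 y₁ t.2.2.2 *
      ch.costLaw d t.1 t.2.1 t.2.2.1 y₁ s ≤ p (t.1, t.2.1) * ∑ y₁, q t.1 t.2.1 y₁ t.2.2.2 *
      ch.costLaw d t.1 t.2.1 t.2.2.1 y₁ s' := fun t => Finite.exists_min _
  choose g hg using this
  exact ⟨g, (isBayesEstimator_iff ch p q hp hq d g).2 fun x x₁ y v s' => hg (x, x₁, y, v) s'⟩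

/-- The constraint on the auxiliary variable in terms of the column functionals. -/
theorem condMutualInfo_le_iff (hp : p ∈ stdSimplex ℝ (X × X₁))
    (hq : ∀ x x₁ y₁, q x x₁ y₁ ∈ stdSimplex ℝ (Fin k)) :
    condMutualInfo (ch.letterPMF p q) rvV rvY₁ rvXX₁Y ≤
      condMutualInfo (ch.letterPMF p q) rvX₁ rvY rvX ↔
    (∑ v, ∑ x, ∑ x₁, p (x, x₁) * ch.infoAt x x₁ fun y₁ => q x x₁ y₁ v) ≤ ch.chanInfo p := by
  rw [← condMutualInfo_V_Y₁ ch p q hp.1 (fun x x₁ y₁ => (hq x x₁ y₁).1)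
    (fun x x₁ y₁ => (hq x x₁ y₁).2), ← condMutualInfo_X₁_Y ch p q hp.1
    (fun x x₁ y₁ => (hq x x₁ y₁).2)]
  exact (mul_le_mul_iff_left₀ (Real.log_pos one_lt_two)).symm

/-- Membership in `letterDistortions` in terms of the column functionals. -/
theorem mem_letterDistortions_iff [Fintype Shat] [Nonempty Shat] (d : Sd → Shat → ℝ) (D : ℝ) :
    D ∈ ch.letterDistortions d ↔ ∃ (k : ℕ) (p : X × X₁ → ℝ) (q : X → X₁ → Y₁ → Fin k → ℝ),
      p ∈ stdSimplex ℝ (X × X₁) ∧ (∀ x x₁ y₁, q x x₁ y₁ ∈ stdSimplex ℝ (Fin k)) ∧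
      (∑ v, ∑ x, ∑ x₁, p (x, x₁) * ch.infoAt x x₁ fun y₁ => q x x₁ y₁ v) ≤ ch.chanInfo p ∧
      D = ch.bayesCost p q d := by
  constructor
  · rintro ⟨k, p, q, g, hp, hq, hI, hg, rfl⟩
    exact ⟨k, p, q, hp, hq, (ch.condMutualInfo_le_iff p q hp hq).1 hI,
      ch.bayesCost_eq_expect p q hp.1 (fun x x₁ y₁ => (hq x x₁ y₁).1) d g hg⟩
  · rintro ⟨k, p, q, hp, hq, hI, rfl⟩
    obtain ⟨g, hg⟩ := ch.exists_isBayesEstimator p q hp.1 (fun x x₁ y₁ => (hq x x₁ y₁).1) d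
    exact ⟨k, p, q, g, hp, hq, (ch.condMutualInfo_le_iff p q hp hq).2 hI, hg,
      (ch.bayesCost_eq_expect p q hp.1 (fun x x₁ y₁ => (hq x x₁ y₁).1) d g hg).symm⟩

end LetterMarginals

end

end RelayChannel

/-! ### Causal products -/

section Causal

variable {U : Type*} [Fintype U]

/-- A sum over sequences in which the coordinate `i` enters through the last argument only. -/
theorem card_mul_sum_eq {ι : Type*} [Fintype ι] [DecidableEq ι] (i : ι) (H : (ι → U) → U → ℝ)
    (hH : ∀ u t s, H (Function.update u i t) s = H u s) :
    Fintype.card U * ∑ u : ι → U, H u (u i) = ∑ u : ι → U, ∑ s, H u s := by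
  let e : (ι → U) × U ≃ (ι → U) × U :=
    { toFun := fun a => (Function.update a.1 i a.2, a.1 i)
      invFun := fun a => (Function.update a.1 i a.2, a.1 i)
      left_inv := fun a => by simp
      right_inv := fun a => by simp }
  have h1 := Equiv.sum_comp e fun a => H a.1 (a.1 i)
  simp only [e, Equiv.coe_fn_mk, Function.update_self, hH] at h1
  rw [Fintype.sum_prod_type, Fintype.sum_prod_type] at h1
  simp only at h1
  rw [h1, Finset.mul_sum]
  simp

theorem sum_ite_eq_coord {ι : Type*} [Fintype ι] [DecidableEq ι] [DecidableEq U] (i : ι)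
    (H : (ι → U) → ℝ) (hH : ∀ u t, H (Function.update u i t) = H u) (c : U) :
    Fintype.card U * ∑ u : ι → U, (if u i = c then H u else 0) = ∑ u, H u := by
  rw [card_mul_sum_eq i (fun u s => if s = c then H u else 0) fun u t s => by rw [hH]]
  simp

/-- In a product of causal kernels the factors from time `m` on sum to one. -/
theorem sum_causal_prod {n : ℕ} (K : Fin n → (Fin n → U) → U → ℝ) (hK : IsCausal K)
    (hK1 : ∀ j u, ∑ t, K j u t = 1) (m : ℕ) (G : (Fin n → U) → ℝ)
    (hG : ∀ u u', (∀ j : Fin n, (j : ℕ) < m → u j = u' j) → G u = G u') (r : ℕ) (hr : m + r ≤ n) :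
    (Fintype.card U : ℝ) ^ r * ∑ u, G u * ∏ j with (j : Fin n).val < m + r, K j u (u j) =
      ∑ u, G u * ∏ j with (j : Fin n).val < m, K j u (u j) := by
  classical
  induction r with
  | zero => simp
  | succ r ih =>
    rw [← ih (by omega), pow_succ, mul_assoc]
    congr 1
    set i : Fin n := ⟨m + r, by omega⟩ with hi
    have hset : (Finset.univ.filter fun j : Fin n => j.val < m + (r + 1)) =
        insert i (Finset.univ.filter fun j : Fin n => j.val < m + r) := by
      ext j
      simp only [Finset.mem_filter, Finset.mem_univ, true_and, Finset.mem_insert, hi, Fin.ext_iff]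
      omega
    have hnot : i ∉ Finset.univ.filter fun j : Fin n => j.val < m + r := by simp [hi]
    have hGi : ∀ u t, G (Function.update u i t) = G u := fun u t =>
      hG _ _ fun j hj => by
        rw [Function.update_of_ne]
        rintro rfl
        simp [hi] at hj
    have hKi : ∀ j : Fin n, j ≤ i → ∀ u t, K j (Function.update u i t) = K j u := fun j hj u t =>
      hK j _ _ fun l hl => by
        rw [Function.update_of_ne]
        exact (hl.trans_le hj).ne
    rw [Finset.sum_congr rfl fun u _ => by rw [hset, Finset.prod_insert hnot]]
    have := card_mul_sum_eq i (fun u s => G u * (K i u s *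
      ∏ j with (j : Fin n).val < m + r, K j u (u j))) (fun u t s => by
        simp only [hGi, hKi i le_rfl]
        congr 2
        refine Finset.prod_congr rfl fun j hj => ?_
        have hj' : j < i := by simpa [hi, Fin.lt_def] using hj
        rw [hKi j hj'.le, Function.update_of_ne hj'.ne])
    rw [this]
    refine Finset.sum_congr rfl fun u _ => ?_
    rw [← Finset.mul_sum, ← Finset.sum_mul, hK1, one_mul]

theorem sum_causal_prod_eq_one [Nonempty U] {n : ℕ} (K : Fin n → (Fin n → U) → U → ℝ)
    (hK : IsCausal K) (hK1 : ∀ j u, ∑ t, K j u t = 1) : ∑ u, ∏ j, K j u (u j) = 1 := by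
  have h := sum_causal_prod K hK hK1 0 (fun _ => 1) (fun _ _ _ => rfl) n (by omega)
  have hc : (Fintype.card U : ℝ) ^ n ≠ 0 := by
    have : (Fintype.card U : ℝ) ≠ 0 := by exact_mod_cast Fintype.card_ne_zero
    positivity
  simp at h
  exact mul_left_cancel₀ hc (by rw [h, mul_one])

/-- What happens before time `i` is not affected by a change of the kernel at time `i`. -/
theorem sum_causal_prod_congr [Nonempty U] {n : ℕ} (K K' : Fin n → (Fin n → U) → U → ℝ)
    (hK : IsCausal K) (hK' : IsCausal K') (hK1 : ∀ j u, ∑ t, K j u t = 1)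
    (hK1' : ∀ j u, ∑ t, K' j u t = 1) (i : Fin n) (h : ∀ j, j < i → K j = K' j)
    (G : (Fin n → U) → ℝ) (hG : ∀ u u', (∀ j, j < i → u j = u' j) → G u = G u') :
    ∑ u, G u * ∏ j, K j u (u j) = ∑ u, G u * ∏ j, K' j u (u j) := by
  have hi : (i : ℕ) + (n - i) = n := by omega
  have h1 := sum_causal_prod K hK hK1 i G hG (n - i) hi.le
  have h2 := sum_causal_prod K' hK' hK1' i G hG (n - i) hi.le
  have hu : (Finset.univ.filter fun j : Fin n => j.val < i + (n - i)) = Finset.univ := by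
    ext j; simp [hi]
  rw [hu] at h1 h2
  have hc : (Fintype.card U : ℝ) ^ (n - i) ≠ 0 := by
    have : (Fintype.card U : ℝ) ≠ 0 := by exact_mod_cast Fintype.card_ne_zero
    positivity
  refine mul_left_cancel₀ hc (h1.trans (Eq.trans ?_ h2.symm))
  refine Finset.sum_congr rfl fun u _ => ?_
  congr 1
  exact Finset.prod_congr rfl fun j hj => by
    rw [h j (Finset.mem_filter.1 hj).2]

/-- Gibbs' inequality, for a measure `R` of total mass at most one. -/
theorem sum_mul_log_sub_log_nonneg {α : Type*} [Fintype α] (P R : α → ℝ) (hP : ∀ a, 0 ≤ P a)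
    (hP1 : ∑ a, P a = 1) (hR : ∀ a, 0 ≤ R a) (hR1 : ∑ a, R a ≤ 1)
    (hPR : ∀ a, 0 < P a → 0 < R a) : 0 ≤ ∑ a, P a * (Real.log (P a) - Real.log (R a)) := by
  have : ∀ a, P a - R a ≤ P a * (Real.log (P a) - Real.log (R a)) := by
    intro a
    rcases (hP a).eq_or_lt with h | h
    · rw [← h]; simpa using hR a
    · have hr := hPR a h
      have h1 := Real.log_le_sub_one_of_pos (div_pos hr h)
      rw [Real.log_div hr.ne' h.ne'] at h1
      have h2 := mul_le_mul_of_nonneg_left h1 h.le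
      rw [mul_sub (P a) (R a / P a), mul_div_cancel₀ _ h.ne'] at h2
      linarith
  have h := Finset.sum_le_sum fun a (_ : a ∈ Finset.univ) => this a
  rw [Finset.sum_sub_distrib] at h
  linarith

end Causal

/-! ### Converse -/

namespace RelayChannel

open LetterOutcome

variable {X X₁ S Sd Shat Y Y₁ : Type*}

noncomputable section

/-- Values of the auxiliary variable of the converse: message, time, past relay outputs, and past
and future outputs at the destination. -/
abbrev AuxType (Y Y₁ : Type*) (M n : ℕ) := Fin M × Fin n × (Fin n → Y₁) × (Fin n → Y)

/-- The auxiliary variable at time `i`. The relay outputs from time `i` on, and the output at the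
destination at time `i`, are overwritten by dummy values: given the inputs and the relay output at
time `i`, it must be independent of the output at the destination at that time. -/
def auxVar {M n : ℕ} (t₀ : Y × Y₁) (w : Fin M) (i : Fin n) (u : Fin n → Y × Y₁) :
    AuxType Y Y₁ M n :=
  (w, i, fun j => if j < i then (u j).2 else t₀.2, Function.update (fun j => (u j).1) i t₀.1)

theorem auxVar_update {M n : ℕ} (t₀ : Y × Y₁) (w : Fin M) (i : Fin n) (u : Fin n → Y × Y₁)
    (t : Y × Y₁) : auxVar t₀ w i (Function.update u i t) = auxVar t₀ w i u := by
  simp only [auxVar, Prod.mk.injEq, true_and]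
  constructor
  · funext j
    split_ifs with h
    · rw [Function.update_of_ne h.ne]
    · rfl
  · funext j
    by_cases h : j = i
    · subst h; simp
    · simp [Function.update_of_ne h]

theorem auxVar_eq_iff {M n : ℕ} (t₀ : Y × Y₁) (w w' : Fin M) (i i' : Fin n)
    (u u' : Fin n → Y × Y₁) : auxVar t₀ w' i' u' = auxVar t₀ w i u ↔
      w' = w ∧ i' = i ∧ (∀ j, j < i → (u' j).2 = (u j).2) ∧
        ∀ j, j ≠ i → (u' j).1 = (u j).1 := by
  simp only [auxVar, Prod.mk.injEq]
  refine and_congr_right fun _ => and_congr_right fun hi => ?_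
  subst hi
  refine and_congr ⟨fun h j hj => ?_, fun h => ?_⟩ ⟨fun h j hj => ?_, fun h => ?_⟩
  · simpa [hj] using congrFun h j
  · funext j
    split_ifs with hj
    exacts [h j hj, rfl]
  · simpa [hj] using congrFun h j
  · funext j
    by_cases hj : j = i'
    · subst hj; simp
    · simpa [hj] using h j hj

theorem rel_update {n : ℕ} {rel : Fin n → (Fin n → Y₁) → X₁} (hrel : IsCausal rel) (i : Fin n)
    (u : Fin n → Y × Y₁) (t : Y × Y₁) :
    rel i (fun l => (Function.update u i t l).2) = rel i fun l => (u l).2 :=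
  hrel i _ _ fun l hl => by rw [Function.update_of_ne hl.ne]

variable [Fintype S] [Fintype Sd] [Fintype Y] [Fintype Y₁]

theorem sum_pairLaw (ch : RelayChannel X X₁ S Sd Y Y₁) (x : X) (x₁ : X₁) :
    ∑ t : Y × Y₁, ch.pairLaw x x₁ t.1 t.2 = 1 := by
  rw [Fintype.sum_prod_type, ← ch.sum_yLaw x x₁]
  rfl

/-- An auxiliary variable with values in any finite type is as good as one with values in
`Fin k`. -/
theorem mem_letterDistortions_of_fintype [Fintype X] [Fintype X₁] [Fintype Shat] [Nonempty Shat]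
    (ch : RelayChannel X X₁ S Sd Y Y₁)
    (d : Sd → Shat → ℝ) {V : Type*} [Fintype V] (p : X × X₁ → ℝ) (q : X → X₁ → Y₁ → V → ℝ)
    (hp : p ∈ stdSimplex ℝ (X × X₁)) (hq : ∀ x x₁ y₁, q x x₁ y₁ ∈ stdSimplex ℝ V)
    (hI : (∑ v, ∑ x, ∑ x₁, p (x, x₁) * ch.infoAt x x₁ fun y₁ => q x x₁ y₁ v) ≤ ch.chanInfo p) :
    (∑ v, ∑ x, ∑ x₁, p (x, x₁) * ch.costAt d x x₁ fun y₁ => q x x₁ y₁ v) ∈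
      ch.letterDistortions d := by
  rw [mem_letterDistortions_iff]
  let e := Fintype.equivFin V
  refine ⟨Fintype.card V, p, fun x x₁ y₁ v => q x x₁ y₁ (e.symm v), hp,
    fun x x₁ y₁ => ⟨fun v => (hq x x₁ y₁).1 _, ?_⟩, ?_, ?_⟩
  · rw [Equiv.sum_comp e.symm (q x x₁ y₁)]
    exact (hq x x₁ y₁).2
  · rwa [Equiv.sum_comp e.symm fun v => ∑ x, ∑ x₁, p (x, x₁) * ch.infoAt x x₁ fun y₁ => q x x₁ y₁ v]
  · rw [bayesCost, Equiv.sum_comp e.symm fun v => ∑ x, ∑ x₁, p (x, x₁) *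
      ch.costAt d x x₁ fun y₁ => q x x₁ y₁ v]

section Converse

variable (ch : RelayChannel X X₁ S Sd Y Y₁) {M n : ℕ} (enc : Fin M → Fin n → X)
  (rel : Fin n → (Fin n → Y₁) → X₁)

/-- The law of the outputs at time `j`, given the message and the outputs before time `j`. -/
def outKernel (w : Fin M) (j : Fin n) (u : Fin n → Y × Y₁) (t : Y × Y₁) : ℝ :=
  ch.pairLaw (enc w j) (rel j fun l => (u l).2) t.1 t.2

/-- The probability of the output sequences `u`, with the factor of time `i` left out. -/
def outLawExcept (w : Fin M) (i : Fin n) (u : Fin n → Y × Y₁) : ℝ :=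
  ∏ j ∈ Finset.univ.erase i, ch.outKernel enc rel w j u (u j)

open Classical in
/-- The joint weight of the inputs, the relay output and the auxiliary variable at a uniformly
chosen time. The outputs of the chosen time are forced to be `(t₀.1, y₁)`. -/
def auxLaw (t₀ : Y × Y₁) (x : X) (x₁ : X₁) (y₁ : Y₁) (v : AuxType Y Y₁ M n) : ℝ :=
  1 / ((M : ℝ) * n) * ∑ w, ∑ i, ∑ u : Fin n → Y × Y₁,
    if u i = (t₀.1, y₁) then
      (if enc w i = x ∧ rel i (fun l => (u l).2) = x₁ ∧ auxVar t₀ w i u = v then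
        ch.outLawExcept enc rel w i u else 0) else 0

variable {enc rel} (hrel : IsCausal rel)

include hrel in
theorem outKernel_causal (w : Fin M) : IsCausal (ch.outKernel enc rel w) := by
  intro j u u' h
  funext t
  rw [outKernel, outKernel,
    hrel j (fun l => (u l).2) (fun l => (u' l).2) fun l hl => by rw [h l hl]]

theorem sum_outKernel (w : Fin M) (j : Fin n) (u : Fin n → Y × Y₁) :
    ∑ t, ch.outKernel enc rel w j u t = 1 := ch.sum_pairLaw _ _

theorem outKernel_nonneg (w : Fin M) (j : Fin n) (u : Fin n → Y × Y₁) (t : Y × Y₁) :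
    0 ≤ ch.outKernel enc rel w j u t := ch.pairLaw_nonneg _ _ _ _

theorem outLawExcept_nonneg (w : Fin M) (i : Fin n) (u : Fin n → Y × Y₁) :
    0 ≤ ch.outLawExcept enc rel w i u := Finset.prod_nonneg fun _ _ => ch.outKernel_nonneg _ _ _ _

theorem auxLaw_nonneg (t₀ : Y × Y₁) (x : X) (x₁ : X₁) (y₁ : Y₁) (v : AuxType Y Y₁ M n) :
    0 ≤ ch.auxLaw enc rel t₀ x x₁ y₁ v := by
  refine mul_nonneg (by positivity) (Finset.sum_nonneg fun w _ => Finset.sum_nonneg fun i _ =>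
    Finset.sum_nonneg fun u _ => ?_)
  split_ifs
  exacts [ch.outLawExcept_nonneg _ _ _, le_rfl, le_rfl]

theorem outKernel_mul_outLawExcept (w : Fin M) (i : Fin n) (u : Fin n → Y × Y₁) :
    ch.outLawExcept enc rel w i u * ch.outKernel enc rel w i u (u i) =
      ∏ j, ch.outKernel enc rel w j u (u j) :=
  Finset.prod_erase_mul _ _ (Finset.mem_univ i)

/-- The output at the destination at time `i` does not affect the other factors. -/
theorem outLawExcept_update_fst (w : Fin M) (i : Fin n) (u : Fin n → Y × Y₁) (y : Y) :
    ch.outLawExcept enc rel w i (Function.update u i (y, (u i).2)) =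
      ch.outLawExcept enc rel w i u := by
  refine Finset.prod_congr rfl fun j hj => ?_
  have h : (fun l => (Function.update u i (y, (u i).2) l).2) = fun l => (u l).2 := by
    funext l
    by_cases h : l = i
    · subst h; simp
    · rw [Function.update_of_ne h]
  rw [outKernel, outKernel, h, Function.update_of_ne (Finset.ne_of_mem_erase hj)]

include hrel in
/-- Means with respect to the single-letter law are means over a uniformly chosen message and time.
The function `F` stands in for the factor of the chosen time. -/
theorem sum_auxLaw_mul [Fintype X] [Fintype X₁] (t₀ : Y × Y₁)
    (F : X → X₁ → Y → Y₁ → AuxType Y Y₁ M n → ℝ) :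
    ∑ v, ∑ x, ∑ x₁, ∑ y, ∑ y₁, ch.auxLaw enc rel t₀ x x₁ y₁ v * F x x₁ y y₁ v =
      1 / ((M : ℝ) * n) * ∑ w, ∑ i, ∑ u : Fin n → Y × Y₁, ch.outLawExcept enc rel w i u *
        F (enc w i) (rel i fun l => (u l).2) (u i).1 (u i).2 (auxVar t₀ w i u) := by
  classical
  -- given message, time and outputs, only one value of `(v, x, x₁)` contributes
  have hflat : ∑ v, ∑ x, ∑ x₁, ∑ y, ∑ y₁, ch.auxLaw enc rel t₀ x x₁ y₁ v * F x x₁ y y₁ v =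
      1 / ((M : ℝ) * n) * ∑ w, ∑ i, ∑ t : Y × Y₁, ∑ u : Fin n → Y × Y₁,
        if u i = (t₀.1, t.2) then ch.outLawExcept enc rel w i u *
          F (enc w i) (rel i fun l => (u l).2) t.1 t.2 (auxVar t₀ w i u) else 0 := by
    calc _ = ∑ t : Y × Y₁, ∑ a : AuxType Y Y₁ M n × X × X₁,
          ch.auxLaw enc rel t₀ a.2.1 a.2.2 t.2 a.1 * F a.2.1 a.2.2 t.1 t.2 a.1 := by
          conv_rhs => rw [Finset.sum_comm, Fintype.sum_prod_type]
          refine Finset.sum_congr rfl fun v _ => ?_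
          rw [Fintype.sum_prod_type]
          refine Finset.sum_congr rfl fun x _ => Finset.sum_congr rfl fun x₁ _ => ?_
          rw [Fintype.sum_prod_type]
      _ = ∑ t : Y × Y₁, 1 / ((M : ℝ) * n) * ∑ w, ∑ i, ∑ u : Fin n → Y × Y₁,
          if u i = (t₀.1, t.2) then ch.outLawExcept enc rel w i u *
            F (enc w i) (rel i fun l => (u l).2) t.1 t.2 (auxVar t₀ w i u) else 0 := by
          refine Finset.sum_congr rfl fun t _ => ?_
          simp only [auxLaw, mul_assoc]
          rw [← Finset.mul_sum]
          congr 1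
          simp only [Finset.sum_mul]
          rw [Finset.sum_comm]
          refine Finset.sum_congr rfl fun w _ => ?_
          rw [Finset.sum_comm]
          refine Finset.sum_congr rfl fun i _ => ?_
          rw [Finset.sum_comm]
          refine Finset.sum_congr rfl fun u _ => ?_
          split_ifs with h
          · rw [Finset.sum_eq_single (auxVar t₀ w i u, enc w i, rel i fun l => (u l).2)]
            · simp
            · intro a _ ha
              rw [if_neg, zero_mul]
              rintro ⟨h1, h2, h3⟩
              exact ha (by rw [h1, h2, h3])
            · simp
          · simp
      _ = _ := by
          rw [← Finset.mul_sum]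
          congr 1
          rw [Finset.sum_comm]
          refine Finset.sum_congr rfl fun w _ => ?_
          rw [Finset.sum_comm]
  rw [hflat]
  congr 1
  refine Finset.sum_congr rfl fun w _ => Finset.sum_congr rfl fun i _ => ?_
  have hcard : (Fintype.card (Y × Y₁) : ℝ) ≠ 0 := by
    have : Nonempty (Y × Y₁) := ⟨t₀⟩
    exact_mod_cast Fintype.card_ne_zero
  -- up to a factor, both sides are sums over `u` and over a separate output `t` of time `i`, since
  -- apart from `t` the summands do not involve `u i`
  refine mul_left_cancel₀ hcard ?_
  have h2 := card_mul_sum_eq i (fun (u : Fin n → Y × Y₁) t =>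
    ch.outLawExcept enc rel w i (Function.update u i t) *
      F (enc w i) (rel i fun l => (u l).2) t.1 t.2 (auxVar t₀ w i u)) (fun u t s => by
        simp only [Function.update_idem, rel_update hrel, auxVar_update])
  simp only [Function.update_eq_self] at h2
  rw [h2, Finset.mul_sum]
  conv_rhs => rw [Finset.sum_comm]
  refine Finset.sum_congr rfl fun t _ => ?_
  have h3 := sum_ite_eq_coord i (fun (u : Fin n → Y × Y₁) =>
    ch.outLawExcept enc rel w i (Function.update u i t) *
      F (enc w i) (rel i fun l => (u l).2) t.1 t.2 (auxVar t₀ w i u)) (fun u s => by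
        simp only [Function.update_idem, rel_update hrel, auxVar_update]) (t₀.1, t.2)
  rw [← h3]
  congr 1
  refine Finset.sum_congr rfl fun u _ => ?_
  split_ifs with h
  · congr 1
    have := ch.outLawExcept_update_fst (enc := enc) (rel := rel) w i u t.1
    rw [h] at this
    exact this.symm
  · rfl

include hrel in
/-- The law of the inputs at the chosen time does not depend on the relay output forced at that
time, because the relay is causal. -/
theorem sum_auxLaw_eq (t₀ : Y × Y₁) (x : X) (x₁ : X₁) (y₁ y₁' : Y₁) :
    ∑ v, ch.auxLaw (M := M) enc rel t₀ x x₁ y₁ v = ∑ v, ch.auxLaw enc rel t₀ x x₁ y₁' v := by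
  classical
  have : Nonempty (Y × Y₁) := ⟨t₀⟩
  -- the kernel that forces the output at time `i` to be `c`
  set K : Y × Y₁ → Fin M → Fin n → Fin n → (Fin n → Y × Y₁) → Y × Y₁ → ℝ := fun c w i j u t =>
    if j = i then (if t = c then 1 else 0) else ch.outKernel enc rel w j u t with hKdef
  have hKc : ∀ c w i, IsCausal (K c w i) := by
    intro c w i j u u' h
    funext t
    simp only [hKdef]
    rw [ch.outKernel_causal hrel w j u u' h]
  have hK1 : ∀ c w i j u, ∑ t, K c w i j u t = 1 := by
    intro c w i j u
    simp only [hKdef]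
    split_ifs
    · simp
    · exact ch.sum_outKernel w j u
  have hprod : ∀ c w i u, ∏ j, K c w i j u (u j) =
      if u i = c then ch.outLawExcept enc rel w i u else 0 := by
    intro c w i u
    rw [← Finset.mul_prod_erase _ _ (Finset.mem_univ i), outLawExcept]
    have h1 : ∏ j ∈ Finset.univ.erase i, K c w i j u (u j) =
        ∏ j ∈ Finset.univ.erase i, ch.outKernel enc rel w j u (u j) :=
      Finset.prod_congr rfl fun j hj => by simp only [hKdef, if_neg (Finset.ne_of_mem_erase hj)]
    rw [h1]
    simp [hKdef]
  have hsum : ∀ y₁, ∑ v, ch.auxLaw (M := M) enc rel t₀ x x₁ y₁ v =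
      1 / ((M : ℝ) * n) * ∑ w, ∑ i, ∑ u : Fin n → Y × Y₁,
        (if enc w i = x ∧ rel i (fun l => (u l).2) = x₁ then 1 else 0) *
          ∏ j, K (t₀.1, y₁) w i j u (u j) := by
    intro y₁
    simp only [auxLaw, hprod]
    rw [← Finset.mul_sum]
    congr 1
    rw [Finset.sum_comm]
    refine Finset.sum_congr rfl fun w _ => ?_
    rw [Finset.sum_comm]
    refine Finset.sum_congr rfl fun i _ => ?_
    rw [Finset.sum_comm]
    refine Finset.sum_congr rfl fun u _ => ?_
    by_cases h : u i = (t₀.1, y₁)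
    · simp only [if_pos h]
      rw [Finset.sum_eq_single (auxVar t₀ w i u)]
      · simp only [and_true, ite_mul, one_mul, zero_mul]
      · intro v _ hv
        rw [if_neg fun h' => hv h'.2.2.symm]
      · simp
    · simp [h]
  rw [hsum, hsum]
  congr 1
  refine Finset.sum_congr rfl fun w _ => Finset.sum_congr rfl fun i _ => ?_
  refine sum_causal_prod_congr _ _ (hKc _ w i) (hKc _ w i) (hK1 _ w i) (hK1 _ w i) i
    (fun j hj => ?_) _ fun u u' h => ?_
  · funext u t
    simp only [hKdef, if_neg hj.ne]
  · rw [hrel i (fun l => (u l).2) (fun l => (u' l).2) fun l hl => by rw [h l hl]]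

variable (enc rel) in
/-- The law of the inputs at a uniformly chosen time. -/
def auxInput (t₀ : Y × Y₁) (a : X × X₁) : ℝ :=
  ∑ v, ch.auxLaw (M := M) enc rel t₀ a.1 a.2 t₀.2 v

include hrel in
theorem auxInput_mem [Fintype X] [Fintype X₁] (t₀ : Y × Y₁) (hM : 0 < M) (hn : 0 < n) :
    ch.auxInput enc rel t₀ ∈ stdSimplex ℝ (X × X₁) := by
  refine ⟨fun a => Finset.sum_nonneg fun v _ => ch.auxLaw_nonneg _ _ _ _ _, ?_⟩
  have : Nonempty (Y × Y₁) := ⟨t₀⟩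
  have hM0 : (M : ℝ) ≠ 0 := by exact_mod_cast hM.ne'
  have hn0 : (n : ℝ) ≠ 0 := by exact_mod_cast hn.ne'
  have h := ch.sum_auxLaw_mul hrel (M := M) (enc := enc) t₀ fun x x₁ y y₁ _ => ch.pairLaw x x₁ y y₁
  have h1 : ∀ w i, ∑ u : Fin n → Y × Y₁, ch.outLawExcept enc rel w i u *
      ch.pairLaw (enc w i) (rel i fun l => (u l).2) (u i).1 (u i).2 = 1 := fun w i => by
    rw [← sum_causal_prod_eq_one _ (ch.outKernel_causal hrel w)
      (ch.sum_outKernel (enc := enc) (rel := rel) w)]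
    exact Finset.sum_congr rfl fun u _ => ch.outKernel_mul_outLawExcept w i u
  simp only [h1] at h
  simp only [Finset.sum_const, Finset.card_univ, Fintype.card_fin, nsmul_eq_mul, mul_one] at h
  rw [one_div_mul_cancel (mul_ne_zero hM0 hn0)] at h
  rw [← h, Fintype.sum_prod_type]
  simp only [auxInput]
  conv_rhs => rw [Finset.sum_comm]
  refine Finset.sum_congr rfl fun x _ => ?_
  conv_rhs => rw [Finset.sum_comm]
  refine Finset.sum_congr rfl fun x₁ _ => ?_
  conv_rhs =>
    rw [Finset.sum_comm]
    enter [2, y]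
    rw [Finset.sum_comm]
    enter [2, y₁]
    rw [← Finset.sum_mul, ch.sum_auxLaw_eq hrel t₀ x x₁ y₁ t₀.2]
  simp only [← Finset.mul_sum]
  have h2 := ch.sum_pairLaw x x₁
  rw [Fintype.sum_prod_type] at h2
  rw [h2, mul_one]

variable (enc rel) in
open Classical in
/-- The conditional law of the auxiliary variable (uniform where the inputs have weight zero). -/
def auxCond (t₀ : Y × Y₁) (x : X) (x₁ : X₁) (y₁ : Y₁) (v : AuxType Y Y₁ M n) : ℝ :=
  if ch.auxInput (M := M) enc rel t₀ (x, x₁) = 0 then 1 / Fintype.card (AuxType Y Y₁ M n)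
  else ch.auxLaw enc rel t₀ x x₁ y₁ v / ch.auxInput (M := M) enc rel t₀ (x, x₁)

include hrel in
theorem auxCond_mem (t₀ : Y × Y₁) (hM : 0 < M) (hn : 0 < n) (x : X) (x₁ : X₁) (y₁ : Y₁) :
    ch.auxCond enc rel t₀ x x₁ y₁ ∈ stdSimplex ℝ (AuxType Y Y₁ M n) := by
  have : Nonempty (AuxType Y Y₁ M n) := ⟨auxVar t₀ ⟨0, hM⟩ ⟨0, hn⟩ fun _ => t₀⟩
  have hc : (Fintype.card (AuxType Y Y₁ M n) : ℝ) ≠ 0 := by exact_mod_cast Fintype.card_ne_zero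
  have h0 : 0 ≤ ch.auxInput (M := M) enc rel t₀ (x, x₁) :=
    Finset.sum_nonneg fun v _ => ch.auxLaw_nonneg _ _ _ _ _
  constructor
  · intro v
    rw [auxCond]
    split_ifs
    · positivity
    · exact div_nonneg (ch.auxLaw_nonneg _ _ _ _ _) h0
  · simp only [auxCond]
    split_ifs with h
    · rw [Finset.sum_const, Finset.card_univ, nsmul_eq_mul, mul_one_div_cancel hc]
    · rw [← Finset.sum_div, ch.sum_auxLaw_eq hrel t₀ x x₁ y₁ t₀.2]
      exact div_self h

include hrel in
theorem auxInput_mul_auxCond (t₀ : Y × Y₁) (x : X) (x₁ : X₁) (y₁ : Y₁) (v : AuxType Y Y₁ M n) :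
    ch.auxInput (M := M) enc rel t₀ (x, x₁) * ch.auxCond enc rel t₀ x x₁ y₁ v =
      ch.auxLaw enc rel t₀ x x₁ y₁ v := by
  rw [auxCond]
  split_ifs with h
  · rw [h, zero_mul]
    rw [auxInput, ← ch.sum_auxLaw_eq hrel t₀ x x₁ y₁ t₀.2] at h
    exact ((Finset.sum_eq_zero_iff_of_nonneg fun v _ => ch.auxLaw_nonneg _ _ _ _ _).1 h v
      (Finset.mem_univ v)).symm
  · exact mul_div_cancel₀ _ h

include hrel in
open Classical in
/-- The joint law of inputs, outputs and auxiliary variable at the chosen time. Only the message `w`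
and the time `i` contribute, since both are components of the auxiliary variable. -/
theorem auxLaw_mul_pairLaw [Fintype X] [Fintype X₁] (t₀ : Y × Y₁) (w : Fin M) (i : Fin n)
    (u : Fin n → Y × Y₁) (y : Y) (y₁ : Y₁) :
    ch.auxLaw enc rel t₀ (enc w i) (rel i fun l => (u l).2) y₁ (auxVar t₀ w i u) *
      ch.pairLaw (enc w i) (rel i fun l => (u l).2) y y₁ =
    1 / ((M : ℝ) * n) * ∑ u' : Fin n → Y × Y₁,
      if u' i = (y, y₁) ∧ auxVar t₀ w i u' = auxVar t₀ w i u then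
        ∏ j, ch.outKernel enc rel w j u' (u' j) else 0 := by
  have h := ch.sum_auxLaw_mul hrel (M := M) (enc := enc) t₀ fun x x₁ y' y₁' v =>
    if y₁' = y₁ then if y' = y then if x₁ = rel i (fun l => (u l).2) then if x = enc w i then
      if v = auxVar t₀ w i u then ch.pairLaw x x₁ y' y₁' else 0 else 0 else 0 else 0 else 0
  simp only [mul_ite, mul_zero, Finset.sum_ite_eq', Finset.mem_univ, if_true] at h
  rw [h]
  congr 1
  rw [Finset.sum_eq_single w, Finset.sum_eq_single i]
  · refine Finset.sum_congr rfl fun u' _ => ?_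
    by_cases hv : auxVar t₀ w i u' = auxVar t₀ w i u
    · have hr : rel i (fun l => (u' l).2) = rel i (fun l => (u l).2) :=
        hrel i _ _ ((auxVar_eq_iff t₀ w w i i u u').1 hv).2.2.1
      by_cases hu : u' i = (y, y₁)
      · rw [← ch.outKernel_mul_outLawExcept w i u', outKernel]
        simp [hv, hr, hu]
      · have hn : ¬(u' i = (y, y₁) ∧ auxVar t₀ w i u' = auxVar t₀ w i u) := fun h' => hu h'.1
        rw [if_neg hn]
        by_cases h1 : (u' i).2 = y₁
        · rw [if_pos h1, if_neg fun h2 => hu (Prod.ext h2 h1)]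
        · rw [if_neg h1]
    · simp [hv]
  · intro i' _ hi'
    refine Finset.sum_eq_zero fun u' _ => ?_
    have : auxVar t₀ w i' u' ≠ auxVar t₀ w i u := fun h' =>
      hi' ((auxVar_eq_iff t₀ w w i i' u u').1 h').2.1
    simp [this]
  · simp
  · intro w' _ hw'
    refine Finset.sum_eq_zero fun i' _ => Finset.sum_eq_zero fun u' _ => ?_
    have : auxVar t₀ w' i' u' ≠ auxVar t₀ w i u := fun h' =>
      hw' ((auxVar_eq_iff t₀ w w' i i' u u').1 h').1
    simp [this]
  · simp

variable (enc rel) in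
open Classical in
/-- The probability, given the message, that the destination receives the same outputs as in `u`
and the relay the same first `l` outputs. -/
def matchProb (w : Fin M) (l : ℕ) (u : Fin n → Y × Y₁) : ℝ :=
  ∑ u' : Fin n → Y × Y₁, if (∀ j, (u' j).1 = (u j).1) ∧ ∀ j : Fin n, j.val < l →
    (u' j).2 = (u j).2 then ∏ j, ch.outKernel enc rel w j u' (u' j) else 0

theorem prod_outKernel_nonneg (w : Fin M) (u : Fin n → Y × Y₁) :
    0 ≤ ∏ j, ch.outKernel enc rel w j u (u j) :=
  Finset.prod_nonneg fun _ _ => ch.outKernel_nonneg _ _ _ _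

theorem prod_outKernel_le_matchProb (w : Fin M) (l : ℕ) (u : Fin n → Y × Y₁) :
    ∏ j, ch.outKernel enc rel w j u (u j) ≤ ch.matchProb enc rel w l u := by
  classical
  rw [matchProb]
  refine le_trans (le_of_eq ?_) (Finset.single_le_sum (f := fun u' : Fin n → Y × Y₁ =>
    if (∀ j, (u' j).1 = (u j).1) ∧ ∀ j : Fin n, j.val < l →
    (u' j).2 = (u j).2 then ∏ j, ch.outKernel enc rel w j u' (u' j) else 0) (fun u' _ => ?_)
    (Finset.mem_univ u))
  · simp
  · split_ifs
    exacts [ch.prod_outKernel_nonneg w u', le_rfl]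

theorem matchProb_self (w : Fin M) (u : Fin n → Y × Y₁) :
    ch.matchProb enc rel w n u = ∏ j, ch.outKernel enc rel w j u (u j) := by
  classical
  rw [matchProb, Finset.sum_eq_single u]
  · simp
  · intro u' _ hu'
    rw [if_neg]
    rintro ⟨h1, h2⟩
    exact hu' (funext fun j => Prod.ext (h1 j) (h2 j j.isLt))
  · simp

include hrel in
theorem auxLaw_mul_pairLaw_self [Fintype X] [Fintype X₁] (t₀ : Y × Y₁) (w : Fin M) (i : Fin n)
    (u : Fin n → Y × Y₁) :
    ch.auxLaw enc rel t₀ (enc w i) (rel i fun l => (u l).2) (u i).2 (auxVar t₀ w i u) *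
      ch.pairLaw (enc w i) (rel i fun l => (u l).2) (u i).1 (u i).2 =
    1 / ((M : ℝ) * n) * ch.matchProb enc rel w (i + 1) u := by
  classical
  rw [ch.auxLaw_mul_pairLaw hrel, matchProb]
  congr 1
  refine Finset.sum_congr rfl fun u' _ => if_congr ?_ rfl rfl
  rw [auxVar_eq_iff]
  simp only [true_and, Prod.ext_iff]
  constructor
  · rintro ⟨⟨h1, h2⟩, h3, h4⟩
    refine ⟨fun j => ?_, fun j hj => ?_⟩
    · by_cases h : j = i
      · rw [h, h1]
      · exact h4 j h
    · rcases (Nat.lt_succ_iff.1 hj).eq_or_lt with h | h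
      · rw [Fin.ext h, h2]
      · exact h3 j h
  · rintro ⟨h1, h2⟩
    exact ⟨⟨h1 i, h2 i (Nat.lt_succ_self _)⟩, fun j hj => h2 j (Nat.lt_succ_of_lt hj),
      fun j _ => h1 j⟩

include hrel in
theorem sum_pairLaw_mul_auxLaw [Fintype X] [Fintype X₁] (t₀ : Y × Y₁) (w : Fin M) (i : Fin n)
    (u : Fin n → Y × Y₁) :
    ∑ y₁, ch.pairLaw (enc w i) (rel i fun l => (u l).2) (u i).1 y₁ *
      ch.auxLaw enc rel t₀ (enc w i) (rel i fun l => (u l).2) y₁ (auxVar t₀ w i u) =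
    1 / ((M : ℝ) * n) * ch.matchProb enc rel w i u := by
  classical
  simp only [mul_comm (ch.pairLaw _ _ _ _), ch.auxLaw_mul_pairLaw hrel]
  rw [← Finset.mul_sum, Finset.sum_comm, matchProb]
  congr 1
  refine Finset.sum_congr rfl fun u' _ => ?_
  by_cases h : (∀ j, (u' j).1 = (u j).1) ∧ ∀ j : Fin n, j.val < i → (u' j).2 = (u j).2
  · rw [if_pos h, Finset.sum_eq_single (u' i).2]
    · rw [if_pos]
      exact ⟨Prod.ext (h.1 i) rfl, (auxVar_eq_iff _ _ _ _ _ _ _).2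
        ⟨rfl, rfl, fun j hj => h.2 j hj, fun j _ => h.1 j⟩⟩
    · intro y₁ _ hy
      rw [if_neg]
      rintro ⟨h1, -⟩
      exact hy (by rw [h1])
    · simp
  · rw [if_neg h]
    refine Finset.sum_eq_zero fun y₁ _ => if_neg ?_
    rintro ⟨h1, h2⟩
    rw [auxVar_eq_iff] at h2
    refine h ⟨fun j => ?_, fun j hj => h2.2.2.1 j hj⟩
    by_cases hj : j = i
    · rw [hj, h1]
    · exact h2.2.2.2 j hj

end Converse

end

end RelayChannel

theorem RelayCode.isCausal {X X₁ Y Y₁ Shat : Type*} {M n : ℕ} (c : RelayCode X X₁ Y Y₁ Shat M n) :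
    IsCausal fun (i : Fin n) (y₁ : Fin n → Y₁) =>
      c.relay i fun j => y₁ (Fin.castLE i.isLt.le j) := by
  intro i u u' h
  dsimp only
  congr 1
  funext j
  exact h _ j.isLt

namespace RelayChannel

open LetterOutcome

variable {X X₁ S Sd Shat Y Y₁ : Type*}

noncomputable section

variable [Fintype S] [Fintype Sd] [Fintype Y] [Fintype Y₁]

section ConverseInfo

variable (ch : RelayChannel X X₁ S Sd Y Y₁) {M n : ℕ} {enc : Fin M → Fin n → X}
  {rel : Fin n → (Fin n → Y₁) → X₁} (hrel : IsCausal rel)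

theorem pairLaw_le_yLaw (x : X) (x₁ : X₁) (y : Y) (y₁ : Y₁) :
    ch.pairLaw x x₁ y y₁ ≤ ch.yLaw x x₁ y :=
  Finset.single_le_sum (f := fun y₁ => ch.pairLaw x x₁ y y₁)
    (fun _ _ => ch.pairLaw_nonneg _ _ _ _) (Finset.mem_univ y₁)

variable [Fintype X₁]

/-- The law of the output at the destination given the input of the source only. -/
def yLawX (p : X × X₁ → ℝ) (x : X) (y : Y) : ℝ :=
  ∑ x₁, p (x, x₁) / (∑ x₁', p (x, x₁')) * ch.yLaw x x₁ y

theorem yLawX_nonneg {p : X × X₁ → ℝ} (hp : ∀ a, 0 ≤ p a) (x : X) (y : Y) :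
    0 ≤ ch.yLawX p x y :=
  Finset.sum_nonneg fun _ _ => mul_nonneg (div_nonneg (hp _) (Finset.sum_nonneg fun _ _ => hp _))
    (ch.yLaw_nonneg _ _ _)

theorem yLawX_pos {p : X × X₁ → ℝ} (hp : ∀ a, 0 ≤ p a) {x : X} {x₁ : X₁} {y : Y}
    (h : 0 < p (x, x₁)) (hy : 0 < ch.yLaw x x₁ y) : 0 < ch.yLawX p x y := by
  have hs : 0 < ∑ x₁, p (x, x₁) := h.trans_le
    (Finset.single_le_sum (f := fun x₁ => p (x, x₁)) (fun _ _ => hp _) (Finset.mem_univ x₁))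
  refine (mul_pos (div_pos h hs) hy).trans_le (Finset.single_le_sum
    (f := fun x₁ => p (x, x₁) / (∑ x₁', p (x, x₁')) * ch.yLaw x x₁ y) (fun _ _ => ?_)
    (Finset.mem_univ x₁))
  exact mul_nonneg (div_nonneg (hp _) hs.le) (ch.yLaw_nonneg _ _ _)

theorem sum_yLawX_le_one (p : X × X₁ → ℝ) (x : X) : ∑ y, ch.yLawX p x y ≤ 1 := by
  simp only [yLawX]
  rw [Finset.sum_comm]
  simp only [← Finset.mul_sum, sum_yLaw, mul_one]
  exact sum_div_sum_le_one fun x₁ => p (x, x₁)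

variable [Fintype X]

include hrel in
theorem chanInfo_auxInput (t₀ : Y × Y₁) :
    ch.chanInfo (ch.auxInput (M := M) enc rel t₀) =
      ∑ v, ∑ x, ∑ x₁, ∑ y, ∑ y₁, ch.auxLaw (M := M) enc rel t₀ x x₁ y₁ v *
        (ch.pairLaw x x₁ y y₁ * (Real.log (ch.yLaw x x₁ y) -
          Real.log (ch.yLawX (ch.auxInput (M := M) enc rel t₀) x y))) := by
  rw [chanInfo, Finset.sum_comm]
  conv_rhs => rw [Finset.sum_comm]
  rw [Finset.sum_comm]
  refine Finset.sum_congr rfl fun x _ => ?_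
  conv_rhs => rw [Finset.sum_comm]
  refine Finset.sum_congr rfl fun x₁ _ => ?_
  conv_rhs => rw [Finset.sum_comm]
  refine Finset.sum_congr rfl fun y _ => ?_
  conv_rhs => rw [Finset.sum_comm]
  simp only [← Finset.sum_mul]
  have : ∀ y₁, ∑ v, ch.auxLaw (M := M) enc rel t₀ x x₁ y₁ v =
    ch.auxInput (M := M) enc rel t₀ (x, x₁) := fun y₁ => ch.sum_auxLaw_eq hrel t₀ x x₁ y₁ t₀.2
  simp only [this, ← mul_assoc]
  rw [← Finset.sum_mul, ← Finset.mul_sum]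
  rfl

include hrel in
theorem sum_auxInput_mul_infoAt (t₀ : Y × Y₁) :
    (∑ v, ∑ x, ∑ x₁, ch.auxInput (M := M) enc rel t₀ (x, x₁) *
      ch.infoAt x x₁ fun y₁ => ch.auxCond enc rel t₀ x x₁ y₁ v) =
      ∑ v, ∑ x, ∑ x₁, ∑ y, ∑ y₁, ch.auxLaw (M := M) enc rel t₀ x x₁ y₁ v *
        (ch.pairLaw x x₁ y y₁ * (Real.log (ch.auxCond enc rel t₀ x x₁ y₁ v) -
          Real.log (ch.mix x x₁ y fun y₁ => ch.auxCond enc rel t₀ x x₁ y₁ v))) := by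
  refine Finset.sum_congr rfl fun v _ => Finset.sum_congr rfl fun x _ =>
    Finset.sum_congr rfl fun x₁ _ => ?_
  rw [infoAt, Finset.mul_sum]
  refine Finset.sum_congr rfl fun y _ => ?_
  rw [Finset.mul_sum]
  refine Finset.sum_congr rfl fun y₁ _ => ?_
  rw [← ch.auxInput_mul_auxCond hrel]
  ring

include hrel in
theorem auxInput_pos (t₀ : Y × Y₁) (hM : 0 < M) (w : Fin M) (i : Fin n)
    (u : Fin n → Y × Y₁) (hu : 0 < ∏ j, ch.outKernel enc rel w j u (u j)) :
    0 < ch.auxLaw enc rel t₀ (enc w i) (rel i fun l => (u l).2) (u i).2 (auxVar t₀ w i u) ∧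
    0 < ch.auxInput (M := M) enc rel t₀ (enc w i, rel i fun l => (u l).2) := by
  have hn : 0 < n := i.pos
  have h1 : 0 < ch.auxLaw enc rel t₀ (enc w i) (rel i fun l => (u l).2) (u i).2
      (auxVar t₀ w i u) := by
    refine pos_of_mul_pos_left ?_ (ch.pairLaw_nonneg (enc w i) (rel i fun l => (u l).2) (u i).1
      (u i).2)
    rw [ch.auxLaw_mul_pairLaw_self hrel]
    have := hu.trans_le (ch.prod_outKernel_le_matchProb w (i + 1) u)
    positivity
  refine ⟨h1, h1.trans_le ?_⟩
  rw [auxInput, ← ch.sum_auxLaw_eq hrel t₀ _ _ (u i).2]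
  exact Finset.single_le_sum (f := fun v => ch.auxLaw enc rel t₀ (enc w i)
    (rel i fun l => (u l).2) (u i).2 v) (fun _ _ => ch.auxLaw_nonneg _ _ _ _ _)
    (Finset.mem_univ _)

include hrel in
/-- The logarithms in the constraint at time `i`, up to those that telescope. -/
theorem log_auxCond_sub_log_mix (t₀ : Y × Y₁) (hM : 0 < M) (w : Fin M) (i : Fin n)
    (u : Fin n → Y × Y₁) (hu : 0 < ∏ j, ch.outKernel enc rel w j u (u j)) :
    Real.log (ch.auxCond enc rel t₀ (enc w i) (rel i fun l => (u l).2) (u i).2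
      (auxVar t₀ w i u)) -
    Real.log (ch.mix (enc w i) (rel i fun l => (u l).2) (u i).1 fun y₁ =>
      ch.auxCond enc rel t₀ (enc w i) (rel i fun l => (u l).2) y₁ (auxVar t₀ w i u)) =
    Real.log (ch.matchProb enc rel w (i + 1) u) - Real.log (ch.matchProb enc rel w i u) -
      Real.log (ch.outKernel enc rel w i u (u i)) +
      Real.log (ch.yLaw (enc w i) (rel i fun l => (u l).2) (u i).1) := by
  have hn : 0 < n := i.pos
  set x := enc w i with hx
  set x₁ := rel i fun l => (u l).2 with hx₁
  set v := auxVar t₀ w i u with hv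
  obtain ⟨hA, hp⟩ := ch.auxInput_pos hrel t₀ hM w i u hu
  rw [← hx, ← hx₁, ← hv] at hA
  rw [← hx, ← hx₁] at hp
  have hK : 0 < ch.pairLaw x x₁ (u i).1 (u i).2 :=
    (ch.pairLaw_nonneg _ _ _ _).lt_of_ne' (Finset.prod_ne_zero_iff.1 hu.ne' i (Finset.mem_univ i))
  have hy : 0 < ch.yLaw x x₁ (u i).1 := hK.trans_le (ch.pairLaw_le_yLaw _ _ _ _)
  have hm : ∀ l, 0 < ch.matchProb enc rel w l u := fun l =>
    hu.trans_le (ch.prod_outKernel_le_matchProb w l u)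
  have hMn : 0 < 1 / ((M : ℝ) * n) := by positivity
  have hq : ∀ y₁, ch.auxCond enc rel t₀ x x₁ y₁ v =
      ch.auxLaw enc rel t₀ x x₁ y₁ v / ch.auxInput (M := M) enc rel t₀ (x, x₁) := fun y₁ => by
    rw [auxCond, if_neg hp.ne']
  have h1 := ch.auxLaw_mul_pairLaw_self (enc := enc) hrel t₀ w i u
  have h2 := ch.sum_pairLaw_mul_auxLaw (enc := enc) hrel t₀ w i u
  rw [← hx, ← hx₁, ← hv] at h1 h2
  have hmix : (ch.mix x x₁ (u i).1 fun y₁ => ch.auxCond enc rel t₀ x x₁ y₁ v) =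
      1 / ((M : ℝ) * n) * ch.matchProb enc rel w i u /
        ch.auxInput (M := M) enc rel t₀ (x, x₁) / ch.yLaw x x₁ (u i).1 := by
    rw [mix, ← h2]
    simp only [hq, ← mul_div_assoc]
    rw [← Finset.sum_div]
  have h3 := congrArg Real.log h1
  rw [Real.log_mul hA.ne' hK.ne', Real.log_mul hMn.ne' (hm _).ne'] at h3
  rw [hmix, hq, Real.log_div (div_ne_zero (mul_ne_zero hMn.ne' (hm _).ne') hp.ne') hy.ne',
    Real.log_div (mul_ne_zero hMn.ne' (hm _).ne') hp.ne', Real.log_div hA.ne' hp.ne',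
    Real.log_mul hMn.ne' (hm _).ne', outKernel, ← hx, ← hx₁]
  linarith

include hrel in
/-- The constraint on the auxiliary variable. The difference of the two sides is the mean, over the
messages, of a divergence between the law of the output sequence and a product law, divided by
`n`. -/
theorem sum_auxInput_mul_infoAt_le (t₀ : Y × Y₁) (hM : 0 < M) (hn : 0 < n) :
    (∑ v, ∑ x, ∑ x₁, ch.auxInput (M := M) enc rel t₀ (x, x₁) *
      ch.infoAt x x₁ fun y₁ => ch.auxCond enc rel t₀ x x₁ y₁ v) ≤
      ch.chanInfo (ch.auxInput (M := M) enc rel t₀) := by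
  classical
  have : Nonempty (Y × Y₁) := ⟨t₀⟩
  set p := ch.auxInput (M := M) enc rel t₀ with hp
  have hpmem := ch.auxInput_mem (M := M) (enc := enc) hrel t₀ hM hn
  rw [← hp] at hpmem
  rw [← sub_nonneg, hp, ch.chanInfo_auxInput hrel, ch.sum_auxInput_mul_infoAt hrel, ← hp]
  simp only [← Finset.sum_sub_distrib, ← mul_sub]
  rw [ch.sum_auxLaw_mul hrel t₀ fun x x₁ y y₁ v => ch.pairLaw x x₁ y y₁ *
    (Real.log (ch.yLaw x x₁ y) - Real.log (ch.yLawX p x y) -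
      (Real.log (ch.auxCond enc rel t₀ x x₁ y₁ v) -
        Real.log (ch.mix x x₁ y fun y₁ => ch.auxCond enc rel t₀ x x₁ y₁ v)))]
  refine mul_nonneg (by positivity) (Finset.sum_nonneg fun w _ => ?_)
  rw [Finset.sum_comm]
  set P : (Fin n → Y × Y₁) → ℝ := fun u => ∏ j, ch.outKernel enc rel w j u (u j) with hPdef
  have hP0 : ∀ u, 0 ≤ P u := fun u => ch.prod_outKernel_nonneg w u
  set Py := pmfOf P (fun u j => (u j).1) with hPy
  -- the logarithms of `matchProb` telescope from the law of the destination's outputs alone to the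
  -- law of all outputs, and the latter cancels against the factors `outKernel`
  have hterm : ∀ u : Fin n → Y × Y₁, ∑ i, ch.outLawExcept enc rel w i u *
      (ch.pairLaw (enc w i) (rel i fun l => (u l).2) (u i).1 (u i).2 *
      (Real.log (ch.yLaw (enc w i) (rel i fun l => (u l).2) (u i).1) -
        Real.log (ch.yLawX p (enc w i) (u i).1) -
      (Real.log (ch.auxCond enc rel t₀ (enc w i) (rel i fun l => (u l).2) (u i).2
        (auxVar t₀ w i u)) -
        Real.log (ch.mix (enc w i) (rel i fun l => (u l).2) (u i).1 fun y₁ =>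
          ch.auxCond enc rel t₀ (enc w i) (rel i fun l => (u l).2) y₁ (auxVar t₀ w i u))))) =
      P u * (Real.log (Py fun j => (u j).1) -
        Real.log (∏ j, ch.yLawX p (enc w j) (u j).1)) := by
    intro u
    have h1 : ∀ i, ch.outLawExcept enc rel w i u *
        ch.pairLaw (enc w i) (rel i fun l => (u l).2) (u i).1 (u i).2 = P u :=
      fun i => ch.outKernel_mul_outLawExcept w i u
    simp only [← mul_assoc, h1]
    rw [← Finset.mul_sum]
    rcases (hP0 u).eq_or_lt with h0 | hu
    · rw [← h0, zero_mul, zero_mul]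
    congr 1
    have hK : ∀ i, 0 < ch.outKernel enc rel w i u (u i) := fun i =>
      (ch.outKernel_nonneg _ _ _ _).lt_of_ne'
        (Finset.prod_ne_zero_iff.1 hu.ne' i (Finset.mem_univ i))
    have hX : ∀ i, 0 < ch.yLawX p (enc w i) (u i).1 := fun i =>
      ch.yLawX_pos hpmem.1 (ch.auxInput_pos hrel t₀ hM w i u hu).2
        ((hK i).trans_le (ch.pairLaw_le_yLaw _ _ _ _))
    simp only [ch.log_auxCond_sub_log_mix hrel t₀ hM w _ u hu]
    have h2 : ∀ i : Fin n, Real.log (ch.yLaw (enc w i) (rel i fun l => (u l).2) (u i).1) -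
        Real.log (ch.yLawX p (enc w i) (u i).1) -
        (Real.log (ch.matchProb enc rel w (i + 1) u) - Real.log (ch.matchProb enc rel w i u) -
          Real.log (ch.outKernel enc rel w i u (u i)) +
          Real.log (ch.yLaw (enc w i) (rel i fun l => (u l).2) (u i).1)) =
        (Real.log (ch.matchProb enc rel w i u) - Real.log (ch.matchProb enc rel w (i + 1) u)) +
        Real.log (ch.outKernel enc rel w i u (u i)) - Real.log (ch.yLawX p (enc w i) (u i).1) :=
      fun i => by ring
    simp only [h2]
    rw [Finset.sum_sub_distrib, Finset.sum_add_distrib,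
      Fin.sum_univ_eq_sum_range (fun i => Real.log (ch.matchProb enc rel w i u) -
        Real.log (ch.matchProb enc rel w (i + 1) u)), Finset.sum_range_sub',
      ch.matchProb_self, Real.log_prod fun i _ => (hK i).ne', Real.log_prod fun i _ => (hX i).ne']
    have h3 : ch.matchProb enc rel w 0 u = Py fun j => (u j).1 := by
      rw [hPy, pmfOf, matchProb]
      refine Finset.sum_congr rfl fun u' _ => ?_
      by_cases h : (fun j => (u' j).1) = fun j => (u j).1
      · rw [if_pos h, if_pos ⟨congrFun h, fun j hj => absurd hj (Nat.not_lt_zero _)⟩]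
      · rw [if_neg h, if_neg fun h' => h (funext h'.1)]
    rw [h3]
    ring
  rw [Finset.sum_congr rfl fun u _ => hterm u,
    ← sum_pmfOf_mul P (fun (u : Fin n → Y × Y₁) j => (u j).1) fun y =>
      Real.log (Py y) - Real.log (∏ j, ch.yLawX p (enc w j) (y j))]
  have hPy0 : ∀ y, 0 ≤ Py y := fun y => pmfOf_nonneg hP0 _ _
  refine sum_mul_log_sub_log_nonneg Py (fun y => ∏ j, ch.yLawX p (enc w j) (y j)) hPy0 ?_
    (fun y => Finset.prod_nonneg fun j _ => ch.yLawX_nonneg hpmem.1 _ _) ?_ ?_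
  · have h := sum_pmfOf_mul P (fun (u : Fin n → Y × Y₁) j => (u j).1) fun _ => 1
    simp only [mul_one] at h
    rw [hPy, h]
    exact sum_causal_prod_eq_one _ (ch.outKernel_causal hrel w) (ch.sum_outKernel w)
  · rw [sum_prod_apply fun j y => ch.yLawX p (enc w j) y]
    exact Finset.prod_le_one (fun j _ => Finset.sum_nonneg fun y _ => ch.yLawX_nonneg hpmem.1 _ _)
      fun j _ => ch.sum_yLawX_le_one p _
  · intro y hy
    obtain ⟨u, -, hu⟩ := Finset.exists_ne_zero_of_sum_ne_zero (ne_of_gt hy)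
    have huy : (fun j => (u j).1) = y := by
      by_contra h
      exact hu (if_neg h)
    rw [if_pos huy] at hu
    have hu' : 0 < P u := (hP0 u).lt_of_ne' hu
    refine Finset.prod_pos fun i _ => ?_
    rw [← huy]
    exact ch.yLawX_pos hpmem.1 (ch.auxInput_pos hrel t₀ hM w i u hu').2
      (((ch.outKernel_nonneg _ _ _ _).lt_of_ne'
        (Finset.prod_ne_zero_iff.1 hu'.ne' i (Finset.mem_univ i))).trans_le
        (ch.pairLaw_le_yLaw _ _ _ _))

omit [Fintype X] [Fintype X₁] in
theorem auxInput_nonneg (t₀ : Y × Y₁) (a : X × X₁) : 0 ≤ ch.auxInput (M := M) enc rel t₀ a :=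
  Finset.sum_nonneg fun _ _ => ch.auxLaw_nonneg _ _ _ _ _

/-- The estimate at the chosen time is a function of the auxiliary variable and the output. -/
def auxEst (est : (Fin n → Y) → Fin n → Shat) (v : AuxType Y Y₁ M n) (y : Y) : Shat :=
  est (Function.update v.2.2.2 v.2.1 y) v.2.1

omit [Fintype Y] [Fintype Y₁] in
theorem auxEst_auxVar (est : (Fin n → Y) → Fin n → Shat) (t₀ : Y × Y₁) (w : Fin M) (i : Fin n)
    (u : Fin n → Y × Y₁) : auxEst est (auxVar t₀ w i u) (u i).1 = est (fun j => (u j).1) i := by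
  have : Function.update (fun j => (u j).1) i (u i).1 = fun j => (u j).1 :=
    Function.update_eq_self i fun j => (u j).1
  simp only [auxEst, auxVar, Function.update_idem, this]

include hrel in
theorem sum_auxInput_mul_costAt_le [Fintype Shat] [Nonempty Shat] (d : Sd → Shat → ℝ)
    (t₀ : Y × Y₁) (est : (Fin n → Y) → Fin n → Shat) :
    (∑ v, ∑ x, ∑ x₁, ch.auxInput (M := M) enc rel t₀ (x, x₁) *
      ch.costAt d x x₁ fun y₁ => ch.auxCond enc rel t₀ x x₁ y₁ v) ≤
    1 / ((M : ℝ) * n) * ∑ w, ∑ i, ∑ u : Fin n → Y × Y₁, ch.outLawExcept enc rel w i u *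
      ch.costLaw d (enc w i) (rel i fun l => (u l).2) (u i).1 (u i).2
        (est (fun j => (u j).1) i) := by
  have h := ch.sum_auxLaw_mul hrel (M := M) (enc := enc) t₀ fun x x₁ y y₁ v =>
    ch.costLaw d x x₁ y y₁ (auxEst est v y)
  simp only [auxEst_auxVar] at h
  rw [← h]
  refine Finset.sum_le_sum fun v _ => Finset.sum_le_sum fun x _ => Finset.sum_le_sum fun x₁ _ => ?_
  rw [costAt, Finset.mul_sum]
  refine Finset.sum_le_sum fun y _ => ?_
  refine (mul_le_mul_of_nonneg_left (Finset.inf'_le (fun s' => ∑ y₁,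
    ch.auxCond enc rel t₀ x x₁ y₁ v * ch.costLaw d x x₁ y y₁ s')
    (Finset.mem_univ (auxEst est v y)))
    (ch.auxInput_nonneg t₀ (x, x₁))).trans_eq ?_
  rw [Finset.mul_sum]
  exact Finset.sum_congr rfl fun y₁ _ => by rw [← mul_assoc, ch.auxInput_mul_auxCond hrel]

omit [Fintype X] [Fintype X₁] in
theorem codeDistortion_eq_sum (d : Sd → Shat → ℝ) (c : RelayCode X X₁ Y Y₁ Shat M n) :
    ch.codeDistortion d c = 1 / ((M : ℝ) * n) * ∑ w, ∑ i, ∑ s : Fin n → S, ∑ sd : Fin n → Sd,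
      ∑ y : Fin n → Y, ∑ y₁ : Fin n → Y₁, (∏ j, ch.state (s j, sd j) *
        ch.trans (c.enc w j) (c.relay j fun l => y₁ (Fin.castLE j.isLt.le l)) (s j)
          (y j, y₁ j)) * d (sd i) (c.est y i) := by
  have h : 1 / ((M : ℝ) * n) = 1 / (n : ℝ) * (1 / M) := by rw [one_div_mul_one_div, mul_comm]
  rw [codeDistortion, h, mul_assoc, Nat.cast_one]
  congr 1
  simp only [expect, blockPMF, Fintype.sum_prod_type, mul_assoc (1 / (M : ℝ)), ← Finset.mul_sum]
  congr 1
  rw [Finset.sum_comm]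

omit [Fintype X] [Fintype X₁] in
/-- The states are summed out: at time `i` they leave the factor `costLaw`, at the other times the
factors of `outLawExcept`. -/
theorem codeDistortion_eq (d : Sd → Shat → ℝ) (c : RelayCode X X₁ Y Y₁ Shat M n) :
    ch.codeDistortion d c = 1 / ((M : ℝ) * n) * ∑ w, ∑ i, ∑ u : Fin n → Y × Y₁,
      ch.outLawExcept c.enc (fun i y₁ => c.relay i fun j => y₁ (Fin.castLE i.isLt.le j)) w i u *
      ch.costLaw d (c.enc w i) (c.relay i fun j => (u (Fin.castLE i.isLt.le j)).2) (u i).1 (u i).2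
        (c.est (fun j => (u j).1) i) := by
  rw [codeDistortion_eq_sum]
  congr 1
  refine Finset.sum_congr rfl fun w _ => Finset.sum_congr rfl fun i _ => ?_
  have key : ∀ u : Fin n → Y × Y₁,
      ch.outLawExcept c.enc (fun i y₁ => c.relay i fun j => y₁ (Fin.castLE i.isLt.le j)) w i u *
      ch.costLaw d (c.enc w i) (c.relay i fun j => (u (Fin.castLE i.isLt.le j)).2) (u i).1 (u i).2
        (c.est (fun j => (u j).1) i) =
      ∑ s : Fin n → S, ∑ sd : Fin n → Sd, (∏ j, ch.state (s j, sd j) *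
        ch.trans (c.enc w j) (c.relay j fun l => (u (Fin.castLE j.isLt.le l)).2) (s j) (u j)) *
        d (sd i) (c.est (fun j => (u j).1) i) := by
    intro u
    rw [← sum_arrow_prod fun s sd => (∏ j, ch.state (s j, sd j) *
        ch.trans (c.enc w j) (c.relay j fun l => (u (Fin.castLE j.isLt.le l)).2) (s j) (u j)) *
        d (sd i) (c.est (fun j => (u j).1) i)]
    have h := sum_prod_apply fun (j : Fin n) (z : S × Sd) => (ch.state z *
      ch.trans (c.enc w j) (c.relay j fun l => (u (Fin.castLE j.isLt.le l)).2) z.1 (u j)) *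
        if j = i then d z.2 (c.est (fun j => (u j).1) i) else 1
    rw [← Finset.prod_erase_mul _ _ (Finset.mem_univ i)] at h
    simp only [Finset.prod_mul_distrib (g := fun j => if j = i then _ else _),
      Finset.prod_ite_eq', Finset.mem_univ, if_true, Fintype.sum_prod_type (α₁ := S)] at h
    rw [h, outLawExcept, costLaw]
    congr 1
    refine Finset.prod_congr rfl fun j hj => ?_
    simp only [if_neg (Finset.ne_of_mem_erase hj), mul_one]
    rfl
  simp only [key]
  rw [← Fintype.sum_prod_type']
  conv_lhs =>
    enter [2, a]
    rw [← sum_arrow_prod fun y y₁ => (∏ j, ch.state (a.1 j, a.2 j) *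
        ch.trans (c.enc w j) (c.relay j fun l => y₁ (Fin.castLE j.isLt.le l)) (a.1 j)
          (y j, y₁ j)) * d (a.2 i) (c.est y i)]
  rw [Finset.sum_comm]
  refine Finset.sum_congr rfl fun u _ => ?_
  rw [Fintype.sum_prod_type]

/-- Every code has at least the distortion of some choice in the single-letter expression. -/
theorem exists_mem_letterDistortions_le [Fintype Shat] [Nonempty Shat] (d : Sd → Shat → ℝ)
    (hM : 0 < M) (hn : 0 < n) (t₀ : Y × Y₁) (c : RelayCode X X₁ Y Y₁ Shat M n) :
    ∃ D ∈ ch.letterDistortions d, D ≤ ch.codeDistortion d c := by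
  have hrel := c.isCausal
  refine ⟨_, ch.mem_letterDistortions_of_fintype d _ _ (ch.auxInput_mem hrel t₀ hM hn)
    (fun x x₁ y₁ => ch.auxCond_mem hrel t₀ hM hn x x₁ y₁)
    (ch.sum_auxInput_mul_infoAt_le (enc := c.enc) hrel t₀ hM hn), ?_⟩
  rw [codeDistortion_eq]
  exact ch.sum_auxInput_mul_costAt_le hrel d t₀ c.est

end ConverseInfo

end

end RelayChannel

/-! ### The column functionals -/

namespace RelayChannel

variable {X X₁ S Sd Shat Y Y₁ : Type*} [Fintype S] [Fintype Sd] [Fintype Y] [Fintype Y₁]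

section Columns

variable (ch : RelayChannel X X₁ S Sd Y Y₁) (x : X) (x₁ : X₁) (y : Y) (y₁ : Y₁)

theorem pairLaw_eq_zero (h : ch.yLaw x x₁ y = 0) : ch.pairLaw x x₁ y y₁ = 0 :=
  (Finset.sum_eq_zero_iff_of_nonneg fun _ _ => ch.pairLaw_nonneg _ _ _ _).1 h y₁
    (Finset.mem_univ y₁)

theorem mix_mul_yLaw (c : Y₁ → ℝ) :
    ch.mix x x₁ y c * ch.yLaw x x₁ y = ∑ y₁, ch.pairLaw x x₁ y y₁ * c y₁ := by
  by_cases h : ch.yLaw x x₁ y = 0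
  · simp [h, ch.pairLaw_eq_zero x x₁ y _ h]
  · exact div_mul_cancel₀ _ h

theorem mix_smul (a : ℝ) (c : Y₁ → ℝ) :
    (ch.mix x x₁ y fun y₁ => a * c y₁) = a * ch.mix x x₁ y c := by
  simp only [mix, mul_left_comm _ a, ← Finset.mul_sum, mul_div_assoc]

theorem mix_nonneg {c : Y₁ → ℝ} (hc : ∀ y₁, 0 ≤ c y₁) : 0 ≤ ch.mix x x₁ y c :=
  div_nonneg (Finset.sum_nonneg fun _ _ => mul_nonneg (ch.pairLaw_nonneg _ _ _ _) (hc _))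
    (ch.yLaw_nonneg _ _ _)

theorem mix_pos {c : Y₁ → ℝ} (hc : ∀ y₁, 0 ≤ c y₁) (h : 0 < ch.pairLaw x x₁ y y₁)
    (h' : 0 < c y₁) : 0 < ch.mix x x₁ y c :=
  div_pos ((mul_pos h h').trans_le (Finset.single_le_sum
    (f := fun y₁ => ch.pairLaw x x₁ y y₁ * c y₁)
    (fun _ _ => mul_nonneg (ch.pairLaw_nonneg _ _ _ _) (hc _)) (Finset.mem_univ y₁)))
    (h.trans_le (ch.pairLaw_le_yLaw _ _ _ _))

theorem mix_const (h : ch.yLaw x x₁ y ≠ 0) (a : ℝ) : (ch.mix x x₁ y fun _ => a) = a := by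
  rw [mix, ← Finset.sum_mul]
  exact mul_div_cancel_left₀ a h

theorem sum_mix {V : Type*} [Fintype V] (q : Y₁ → V → ℝ) (hq : ∀ y₁, ∑ v, q y₁ v = 1)
    (h : ch.yLaw x x₁ y ≠ 0) : ∑ v, ch.mix x x₁ y (fun y₁ => q y₁ v) = 1 := by
  simp only [mix]
  rw [← Finset.sum_div, Finset.sum_comm]
  simp only [← Finset.mul_sum, hq, mul_one]
  exact div_self h

theorem infoAt_smul {a : ℝ} (ha : 0 ≤ a) {c : Y₁ → ℝ} (hc : ∀ y₁, 0 ≤ c y₁) :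
    (ch.infoAt x x₁ fun y₁ => a * c y₁) = a * ch.infoAt x x₁ c := by
  rcases ha.eq_or_lt with rfl | ha
  · simp [infoAt]
  simp only [infoAt, mix_smul, Finset.mul_sum]
  refine Finset.sum_congr rfl fun y _ => Finset.sum_congr rfl fun y₁ _ => ?_
  rcases (ch.pairLaw_nonneg x x₁ y y₁).eq_or_lt with h | h
  · simp [← h]
  rcases (hc y₁).eq_or_lt with h' | h'
  · simp [← h']
  rw [Real.log_mul ha.ne' h'.ne', Real.log_mul ha.ne' (ch.mix_pos x x₁ y y₁ hc h h').ne']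
  ring

theorem infoAt_const (a : ℝ) : (ch.infoAt x x₁ fun _ => a) = 0 := by
  refine Finset.sum_eq_zero fun y _ => Finset.sum_eq_zero fun y₁ _ => ?_
  by_cases h : ch.yLaw x x₁ y = 0
  · simp [ch.pairLaw_eq_zero x x₁ y y₁ h]
  · rw [ch.mix_const x x₁ y h, sub_self, mul_zero]

theorem infoAt_eq_sum (c : Y₁ → ℝ) : ch.infoAt x x₁ c = ∑ y, ∑ y₁, ch.pairLaw x x₁ y y₁ *
    (c y₁ * (Real.log (c y₁) - Real.log (ch.mix x x₁ y c)) - (c y₁ - ch.mix x x₁ y c)) := by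
  refine Finset.sum_congr rfl fun y _ => ?_
  have h : ∑ y₁, ch.pairLaw x x₁ y y₁ * (c y₁ - ch.mix x x₁ y c) = 0 := by
    simp only [mul_sub, Finset.sum_sub_distrib, ← Finset.sum_mul]
    rw [← ch.mix_mul_yLaw, mul_comm, yLaw, sub_self]
  rw [← sub_zero (∑ y₁, _), ← h, ← Finset.sum_sub_distrib]
  exact Finset.sum_congr rfl fun y₁ _ => by ring

theorem sub_lt_mul_log_sub_log {a b : ℝ} (ha : 0 ≤ a) (hb : 0 ≤ b) (hab : 0 < a → 0 < b)
    (hne : a ≠ b) : a - b < a * (Real.log a - Real.log b) := by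
  rcases ha.eq_or_lt with rfl | ha
  · simpa using hb.lt_of_ne hne
  have hb := hab ha
  have h := Real.log_lt_sub_one_of_pos (div_pos hb ha)
    (by rw [ne_eq, div_eq_one_iff_eq ha.ne']; exact hne.symm)
  rw [Real.log_div hb.ne' ha.ne'] at h
  have h2 := mul_lt_mul_of_pos_left h ha
  rw [mul_sub a (b / a), mul_div_cancel₀ _ ha.ne'] at h2
  linarith

theorem infoAt_term_nonneg {c : Y₁ → ℝ} (hc : ∀ y₁, 0 ≤ c y₁) :
    0 ≤ ch.pairLaw x x₁ y y₁ *
      (c y₁ * (Real.log (c y₁) - Real.log (ch.mix x x₁ y c)) - (c y₁ - ch.mix x x₁ y c)) := by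
  rcases (ch.pairLaw_nonneg x x₁ y y₁).eq_or_lt with h | h
  · rw [← h, zero_mul]
  refine mul_nonneg h.le (sub_nonneg.2 ?_)
  by_cases hne : c y₁ = ch.mix x x₁ y c
  · rw [← hne]; simp
  · exact (sub_lt_mul_log_sub_log (hc _) (ch.mix_nonneg x x₁ y hc)
      (fun h' => ch.mix_pos x x₁ y y₁ hc h h') hne).le

theorem infoAt_nonneg {c : Y₁ → ℝ} (hc : ∀ y₁, 0 ≤ c y₁) : 0 ≤ ch.infoAt x x₁ c := by
  rw [infoAt_eq_sum]
  exact Finset.sum_nonneg fun y _ => Finset.sum_nonneg fun y₁ _ =>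
    ch.infoAt_term_nonneg x x₁ y y₁ hc

theorem eq_mix_of_infoAt_eq_zero {c : Y₁ → ℝ} (hc : ∀ y₁, 0 ≤ c y₁) (h0 : ch.infoAt x x₁ c = 0)
    (h : 0 < ch.pairLaw x x₁ y y₁) : c y₁ = ch.mix x x₁ y c := by
  rw [infoAt_eq_sum, Finset.sum_eq_zero_iff_of_nonneg fun y _ =>
    Finset.sum_nonneg fun y₁ _ => ch.infoAt_term_nonneg x x₁ y y₁ hc] at h0
  have h1 := (Finset.sum_eq_zero_iff_of_nonneg fun y₁ _ =>
    ch.infoAt_term_nonneg x x₁ y y₁ hc).1 (h0 y (Finset.mem_univ _)) y₁ (Finset.mem_univ _)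
  by_contra hne
  have h2 := sub_lt_mul_log_sub_log (hc _) (ch.mix_nonneg x x₁ y hc)
      (fun h' => ch.mix_pos x x₁ y y₁ hc h h') hne
  exact (mul_pos h (sub_pos.2 h2)).ne' h1

theorem inf'_const_mul {ι : Type*} {s : Finset ι} (hs : s.Nonempty) {a : ℝ} (ha : 0 ≤ a)
    (f : ι → ℝ) : (s.inf' hs fun i => a * f i) = a * s.inf' hs f := by
  obtain ⟨i, hi, h⟩ := s.exists_mem_eq_inf' hs f
  refine le_antisymm ?_ ?_
  · rw [h]
    exact s.inf'_le (fun i => a * f i) hi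
  · exact s.le_inf' hs _ fun j hj => mul_le_mul_of_nonneg_left (s.inf'_le f hj) ha

theorem costLaw_eq_zero (d : Sd → Shat → ℝ) (s' : Shat) (h : ch.pairLaw x x₁ y y₁ = 0) :
    ch.costLaw d x x₁ y y₁ s' = 0 := by
  have h0 : ∀ s sd, 0 ≤ ch.state (s, sd) * ch.trans x x₁ s (y, y₁) := fun s sd =>
    mul_nonneg (ch.state_mem.1 _) ((ch.trans_mem _ _ _).1 _)
  refine Finset.sum_eq_zero fun s _ => Finset.sum_eq_zero fun sd _ => ?_
  rw [(Finset.sum_eq_zero_iff_of_nonneg fun sd _ => h0 s sd).1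
    ((Finset.sum_eq_zero_iff_of_nonneg fun s _ => Finset.sum_nonneg fun sd _ => h0 s sd).1 h s
    (Finset.mem_univ _)) sd (Finset.mem_univ _), zero_mul]

theorem costLaw_le {d : Sd → Shat → ℝ} {D₀ : ℝ} (hd : ∀ sd s', d sd s' ≤ D₀) (s' : Shat) :
    ch.costLaw d x x₁ y y₁ s' ≤ ch.pairLaw x x₁ y y₁ * D₀ := by
  rw [costLaw, pairLaw, Finset.sum_mul]
  refine Finset.sum_le_sum fun s _ => ?_
  rw [Finset.sum_mul]
  exact Finset.sum_le_sum fun sd _ => mul_le_mul_of_nonneg_left (hd _ _)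
    (mul_nonneg (ch.state_mem.1 _) ((ch.trans_mem _ _ _).1 _))

variable [Fintype Shat] [Nonempty Shat]

theorem costAt_smul (d : Sd → Shat → ℝ) {a : ℝ} (ha : 0 ≤ a) (c : Y₁ → ℝ) :
    (ch.costAt d x x₁ fun y₁ => a * c y₁) = a * ch.costAt d x x₁ c := by
  simp only [costAt, mul_assoc, ← Finset.mul_sum, inf'_const_mul _ ha]

theorem costAt_nonneg {d : Sd → Shat → ℝ} (hd : ∀ sd s', 0 ≤ d sd s') {c : Y₁ → ℝ}
    (hc : ∀ y₁, 0 ≤ c y₁) : 0 ≤ ch.costAt d x x₁ c :=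
  Finset.sum_nonneg fun _ _ => Finset.le_inf' _ _ fun _ _ => Finset.sum_nonneg fun _ _ =>
    mul_nonneg (hc _) (ch.costLaw_nonneg hd _ _ _ _ _)

theorem costAt_one_le {d : Sd → Shat → ℝ} {D₀ : ℝ} (hd : ∀ sd s', d sd s' ≤ D₀) :
    (ch.costAt d x x₁ fun _ => 1) ≤ D₀ := by
  obtain ⟨s'⟩ := ‹Nonempty Shat›
  calc _ ≤ ∑ y, ch.yLaw x x₁ y * D₀ := by
        refine Finset.sum_le_sum fun y _ => (Finset.inf'_le (fun s' : Shat =>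
          ∑ y₁, 1 * ch.costLaw d x x₁ y y₁ s') (Finset.mem_univ s')).trans ?_
        rw [yLaw, Finset.sum_mul]
        refine Finset.sum_le_sum fun y₁ _ => ?_
        rw [one_mul]
        exact ch.costLaw_le x x₁ y y₁ hd s'
    _ = D₀ := by rw [← Finset.sum_mul, sum_yLaw, one_mul]

/-- An auxiliary variable without information about the relay output does not help. -/
theorem sum_costAt_of_infoAt_eq_zero (d : Sd → Shat → ℝ) {V : Type*} [Fintype V]
    (q : Y₁ → V → ℝ) (hq : ∀ y₁, q y₁ ∈ stdSimplex ℝ V)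
    (h0 : ∀ v, ch.infoAt x x₁ (fun y₁ => q y₁ v) = 0) :
    ∑ v, ch.costAt d x x₁ (fun y₁ => q y₁ v) = ch.costAt d x x₁ fun _ => 1 := by
  simp only [costAt]
  rw [Finset.sum_comm]
  refine Finset.sum_congr rfl fun y _ => ?_
  have h1 : ∀ v, (Finset.univ.inf' Finset.univ_nonempty fun s' : Shat =>
      ∑ y₁, q y₁ v * ch.costLaw d x x₁ y y₁ s') = ch.mix x x₁ y (fun y₁ => q y₁ v) *
      Finset.univ.inf' Finset.univ_nonempty fun s' : Shat =>
        ∑ y₁, 1 * ch.costLaw d x x₁ y y₁ s' := by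
    intro v
    rw [← inf'_const_mul _ (ch.mix_nonneg x x₁ y fun y₁ => (hq y₁).1 v)]
    congr 1
    funext s'
    rw [Finset.mul_sum]
    refine Finset.sum_congr rfl fun y₁ _ => ?_
    rcases (ch.pairLaw_nonneg x x₁ y y₁).eq_or_lt with h | h
    · simp [ch.costLaw_eq_zero x x₁ y y₁ d s' h.symm]
    · rw [one_mul, ch.eq_mix_of_infoAt_eq_zero x x₁ y y₁ (fun y₁ => (hq y₁).1 v) (h0 v) h]
  simp only [h1, ← Finset.sum_mul]
  by_cases h : ch.yLaw x x₁ y = 0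
  · have : (fun s' : Shat => ∑ y₁, 1 * ch.costLaw d x x₁ y y₁ s') = fun _ => 0 := by
      funext s'
      exact Finset.sum_eq_zero fun y₁ _ => by
        rw [ch.costLaw_eq_zero x x₁ y y₁ d s' (ch.pairLaw_eq_zero x x₁ y y₁ h), mul_zero]
    rw [this, Finset.inf'_const, mul_zero]
  · rw [ch.sum_mix x x₁ y q (fun y₁ => (hq y₁).2) h, one_mul]

end Columns

end RelayChannel

/-! ### Achievability -/

theorem sum_arrow_prod₄ {A B C D : Type*} [Fintype A] [Fintype B] [Fintype C] [Fintype D] {n : ℕ}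
    (G : (Fin n → A) → (Fin n → B) → (Fin n → C) → (Fin n → D) → ℝ) :
    ∑ z : Fin n → A × B × C × D, G (fun i => (z i).1) (fun i => (z i).2.1) (fun i => (z i).2.2.1)
      (fun i => (z i).2.2.2) = ∑ a, ∑ b, ∑ c, ∑ e, G a b c e := by
  rw [sum_arrow_prod fun a (b : Fin n → B × C × D) => G a (fun i => (b i).1) (fun i => (b i).2.1)
    (fun i => (b i).2.2)]
  refine Finset.sum_congr rfl fun a _ => ?_
  rw [sum_arrow_prod fun b (c : Fin n → C × D) => G a b (fun i => (c i).1) (fun i => (c i).2)]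
  refine Finset.sum_congr rfl fun b _ => ?_
  rw [sum_arrow_prod fun c e => G a b c e]

theorem exists_dist_le {Sd Shat : Type*} [Finite Sd] [Finite Shat] (d : Sd → Shat → ℝ) :
    ∃ D₀ : ℝ, 0 < D₀ ∧ ∀ sd s', d sd s' ≤ D₀ := by
  obtain ⟨B, hB⟩ := Set.finite_range (fun a : Sd × Shat => d a.1 a.2) |>.bddAbove
  exact ⟨max B 1, by positivity, fun sd s' => (hB ⟨(sd, s'), rfl⟩).trans (le_max_left _ _)⟩

namespace RelayChannel

variable {X X₁ S Sd Shat Y Y₁ : Type*} [Fintype S] [Fintype Sd] [Fintype Y] [Fintype Y₁]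

section Achievability

variable (ch : RelayChannel X X₁ S Sd Y Y₁)

/-- Law of the outcome `(s, s_d, y, y₁)` of one channel use given the inputs. -/
def stepLaw (x : X) (x₁ : X₁) (z : S × Sd × Y × Y₁) : ℝ :=
  ch.state (z.1, z.2.1) * ch.trans x x₁ z.1 z.2.2

theorem stepLaw_nonneg (x : X) (x₁ : X₁) (z : S × Sd × Y × Y₁) : 0 ≤ ch.stepLaw x x₁ z :=
  mul_nonneg (ch.state_mem.1 _) ((ch.trans_mem _ _ _).1 _)

theorem sum_stepLaw_mul (x : X) (x₁ : X₁) (F : Y → Y₁ → ℝ) :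
    ∑ z, ch.stepLaw x x₁ z * F z.2.2.1 z.2.2.2 = ∑ y, ∑ y₁, ch.pairLaw x x₁ y y₁ * F y y₁ := by
  rw [← Fintype.sum_prod_type' (f := fun y y₁ => ch.pairLaw x x₁ y y₁ * F y y₁)]
  simp only [pairLaw, stepLaw, Finset.sum_mul]
  rw [Finset.sum_comm, Fintype.sum_prod_type]
  refine Finset.sum_congr rfl fun s _ => ?_
  rw [Finset.sum_comm, Fintype.sum_prod_type]

theorem sum_stepLaw_mul_dist (d : Sd → Shat → ℝ) (x : X) (x₁ : X₁) (c : Y → Y₁ → ℝ)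
    (g : Y → Shat) :
    ∑ z, ch.stepLaw x x₁ z * (c z.2.2.1 z.2.2.2 * d z.2.1 (g z.2.2.1)) =
      ∑ y, ∑ y₁, c y y₁ * ch.costLaw d x x₁ y y₁ (g y) := by
  rw [← Fintype.sum_prod_type' (f := fun y y₁ => c y y₁ * ch.costLaw d x x₁ y y₁ (g y))]
  simp only [costLaw, stepLaw, Finset.mul_sum]
  rw [Finset.sum_comm, Fintype.sum_prod_type]
  refine Finset.sum_congr rfl fun s _ => ?_
  rw [Finset.sum_comm, Fintype.sum_prod_type]
  exact Finset.sum_congr rfl fun sd _ => Finset.sum_congr rfl fun u _ => by ring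

theorem sum_stepLaw (x : X) (x₁ : X₁) : ∑ z, ch.stepLaw x x₁ z = 1 := by
  have h := ch.sum_stepLaw_mul x x₁ fun _ _ => 1
  simp only [mul_one] at h
  rw [h]
  exact ch.sum_yLaw x x₁

theorem outLaw_stepLaw (x : X) (x₁ : X₁) (y : Y) :
    outLaw ch.stepLaw (fun z => z.2.2.1) x x₁ y = ch.yLaw x x₁ y := by
  classical
  have h := ch.sum_stepLaw_mul x x₁ fun y' _ => if y' = y then 1 else 0
  simp only [mul_ite, mul_one, mul_zero] at h
  rw [outLaw, yLaw]
  refine Eq.trans (Finset.sum_congr rfl fun z _ => ?_) (h.trans ?_)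
  · exact if_congr Iff.rfl rfl rfl
  · rw [Finset.sum_comm]
    simp

theorem outLawX_stepLaw [Fintype X₁] (p : X × X₁ → ℝ) (x : X) (y : Y) :
    outLawX ch.stepLaw (fun z => z.2.2.1) p x y = ch.yLawX p x y := by
  simp only [outLawX, yLawX, outLaw_stepLaw]

/-- There are codes, with any number of messages and any length `n`, whose distortion exceeds `D`
by `O(1 / n)` at most. -/
def IsCodable (d : Sd → Shat → ℝ) (D : ℝ) : Prop :=
  ∃ B : ℝ, ∀ M n : ℕ, 0 < M → 0 < n → ∃ c : RelayCode X X₁ Y Y₁ Shat M n,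
    ch.codeDistortion d c ≤ D + B / n

/-- A sequence of inputs, a causal relay and an estimator make up a code, by which no information
about the message is sent. -/
theorem exists_relayCode (d : Sd → Shat → ℝ) {M n : ℕ} (hM : 0 < M) (x : Fin n → X)
    (rel : Fin n → (Fin n → Y₁) → X₁) (hrel : IsCausal rel) (est : (Fin n → Y) → Fin n → Shat)
    (y₀ : Y₁) : ∃ c : RelayCode X X₁ Y Y₁ Shat M n, ch.codeDistortion d c =
      1 / (n : ℝ) * ∑ z, seqLaw ch.stepLaw (fun z => z.2.2.2) x rel z *
        ∑ i, d (z i).2.1 (est (fun j => (z j).2.2.1) i) := by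
  let c : RelayCode X X₁ Y Y₁ Shat M n :=
    { enc := fun _ => x
      relay := fun i u => rel i fun j => if h : j < i then u ⟨j, h⟩ else y₀
      dec := fun _ => ⟨0, hM⟩
      est := est }
  have hc : ∀ (i : Fin n) (y₁ : Fin n → Y₁),
      c.relay i (fun j => y₁ (Fin.castLE i.isLt.le j)) = rel i y₁ := by
    intro i y₁
    refine hrel i _ _ fun j hj => ?_
    rw [dif_pos hj]
    rfl
  refine ⟨c, ?_⟩
  have h : 1 / ((M : ℝ) * n) = 1 / (n : ℝ) * (1 / M) := by rw [one_div_mul_one_div, mul_comm]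
  have hM0 : (M : ℝ) ≠ 0 := by exact_mod_cast hM.ne'
  rw [codeDistortion_eq_sum, h, mul_assoc]
  congr 1
  have henc : ∀ w i, c.enc w i = x i := fun _ _ => rfl
  simp only [hc, henc]
  rw [Finset.sum_const, Finset.card_univ, Fintype.card_fin, nsmul_eq_mul, ← mul_assoc,
    one_div_mul_cancel hM0, one_mul]
  simp only [Finset.mul_sum]
  conv_rhs => rw [Finset.sum_comm]
  refine Finset.sum_congr rfl fun i _ => ?_
  rw [← sum_arrow_prod₄ fun (s : Fin n → S) (sd : Fin n → Sd) (y : Fin n → Y) (y₁ : Fin n → Y₁) =>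
    (∏ j, ch.state (s j, sd j) * ch.trans (x j) (rel j y₁) (s j) (y j, y₁ j)) *
      d (sd i) (est y i)]
  rfl

variable [Nonempty X] [Nonempty X₁] [Fintype Shat] [Nonempty Shat]

include ch in
omit [Fintype Shat] [Nonempty Shat] in
theorem nonempty_outputs : Nonempty (S × Sd × Y × Y₁) := by
  obtain ⟨x⟩ := ‹Nonempty X›
  obtain ⟨x₁⟩ := ‹Nonempty X₁›
  by_contra h
  rw [not_nonempty_iff] at h
  have h1 := ch.sum_stepLaw x x₁
  rw [Finset.univ_eq_empty, Finset.sum_empty] at h1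
  exact zero_ne_one h1

omit [Fintype Shat] in
theorem isCodable_of_blockScheme {d : Sd → Shat → ℝ} (hd : ∀ sd s', 0 ≤ d sd s') {D₀ : ℝ}
    (hD₀0 : 0 ≤ D₀) (hD₀ : ∀ sd s', d sd s' ≤ D₀) {N M : ℕ} (hN : 0 < N) (hM : 0 < M) {D : ℝ}
    (hD : 0 ≤ D) (h : ∀ μ : Fin M → ℝ, (∀ m, 0 ≤ μ m) → ∑ m, μ m = 1 →
      ∃ σ : BlockScheme X X₁ Y Y₁ Shat N M, ∑ m, μ m * σ.cost ch.stepLaw (fun z => z.2.2.1)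
        (fun z => z.2.2.2) (fun z s' => d z.2.1 s') (2 * D₀) m ≤ D) : ch.IsCodable d D := by
  obtain ⟨z₀⟩ := ch.nonempty_outputs
  refine ⟨2 * N * D₀, fun M' n hM' hn => ?_⟩
  obtain ⟨x, rel, est, hrel, hle⟩ := exists_code_of_blockScheme ch.stepLaw (fun z => z.2.2.1)
    (fun z => z.2.2.2) (fun z s' => d z.2.1 s') ch.stepLaw_nonneg ch.sum_stepLaw
    (fun z s' => hd _ _) hD₀0 (fun z s' => hD₀ _ _) hN hM hD h n
  obtain ⟨c, hc⟩ := ch.exists_relayCode d hM' x rel hrel est z₀.2.2.2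
  refine ⟨c, ?_⟩
  have hn0 : (0 : ℝ) < n := by exact_mod_cast hn
  rw [hc, one_div_mul_eq_div, div_le_iff₀ hn0, add_mul, div_mul_cancel₀ _ hn0.ne', mul_comm D]
  exact hle

/-- Constant inputs without any help from the relay: block schemes of length one with a single
relay index. -/
theorem isCodable_const {d : Sd → Shat → ℝ} (hd : ∀ sd s', 0 ≤ d sd s') {D₀ : ℝ}
    (hD₀0 : 0 ≤ D₀) (hD₀ : ∀ sd s', d sd s' ≤ D₀) (x : X) (x₁ : X₁) :
    ch.IsCodable d (ch.costAt d x x₁ fun _ => 1) := by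
  classical
  refine ch.isCodable_of_blockScheme hd hD₀0 hD₀ one_pos one_pos
    (ch.costAt_nonneg x x₁ hd fun _ => zero_le_one) fun μ hμ hμ1 => ?_
  choose g _ hg using fun y => Finset.exists_mem_eq_inf' (Finset.univ_nonempty (α := Shat))
    fun s' => ∑ y₁, 1 * ch.costLaw d x x₁ y y₁ s'
  refine ⟨⟨fun _ => x, fun _ _ => x₁, fun m _ => m, fun _ => 0, fun _ _ y i => g (y i)⟩, ?_⟩
  have h1 : ∀ m : Fin 1, (0 : Fin 1) = m := fun m => Subsingleton.elim _ _
  have h2 := sum_prod_mul_single (fun (_ : Fin 1) => ch.stepLaw x x₁)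
    (fun _ => ch.sum_stepLaw x x₁) 0 fun z => d z.2.1 (g z.2.2.1)
  have h3 := ch.sum_stepLaw_mul_dist d x x₁ (fun _ _ => 1) g
  simp only [one_mul] at h3
  have h4 : (ch.costAt d x x₁ fun _ => 1) = ∑ y, ∑ y₁, ch.costLaw d x x₁ y y₁ (g y) :=
    Finset.sum_congr rfl fun y _ => by rw [hg y]; simp only [one_mul]
  have h5 : ∀ m, BlockScheme.cost ch.stepLaw (fun z => z.2.2.1) (fun z => z.2.2.2)
      (fun z s' => d z.2.1 s') (2 * D₀)
      (⟨fun _ => x, fun _ _ => x₁, fun m _ => m, fun _ => 0, fun _ _ y i => g (y i)⟩ :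
        BlockScheme X X₁ Y Y₁ Shat 1 1) m = ch.costAt d x x₁ fun _ => 1 := by
    intro m
    rw [h4, ← h3, ← h2, BlockScheme.cost]
    refine Finset.sum_congr rfl fun z _ => ?_
    rw [if_pos (h1 m)]
    simp
  simp only [h5]
  rw [← Finset.sum_mul, hμ1, one_mul]

variable [Fintype X] [Fintype X₁]

omit [Nonempty X] [Nonempty X₁] in
theorem sum_jointLaw_mul {V : Type*} [Fintype V] (p : X × X₁ → ℝ) (q : X → X₁ → Y₁ → V → ℝ)
    (F : X → X₁ → S × Sd × Y × Y₁ → V → ℝ) :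
    ∑ ω, jointLaw ch.stepLaw (fun z => z.2.2.2) p q ω * F ω.1 ω.2.1 ω.2.2.1 ω.2.2.2 =
    ∑ v, ∑ x, ∑ x₁, p (x, x₁) * ∑ z, ch.stepLaw x x₁ z *
      (q x x₁ z.2.2.2 v * F x x₁ z v) := by
  rw [Fintype.sum_prod_type]
  conv_rhs => rw [Finset.sum_comm]
  refine Finset.sum_congr rfl fun x _ => ?_
  rw [Fintype.sum_prod_type]
  conv_rhs => rw [Finset.sum_comm]
  refine Finset.sum_congr rfl fun x₁ _ => ?_
  rw [Fintype.sum_prod_type_right]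
  refine Finset.sum_congr rfl fun v _ => ?_
  rw [Finset.mul_sum]
  refine Finset.sum_congr rfl fun z _ => ?_
  rw [jointLaw]
  ring

/-- Compress-and-forward. The destination's guess of the law of the auxiliary variable, given what
it observes, is the true conditional law `mix`. -/
theorem isCodable_of_lt {d : Sd → Shat → ℝ} (hd : ∀ sd s', 0 ≤ d sd s') {D₀ : ℝ}
    (hD₀0 : 0 < D₀) (hD₀ : ∀ sd s', d sd s' ≤ D₀) {V : Type*} [Fintype V] (p : X × X₁ → ℝ)
    (q : X → X₁ → Y₁ → V → ℝ)
    (hp : p ∈ stdSimplex ℝ (X × X₁)) (hq : ∀ x x₁ y₁, q x x₁ y₁ ∈ stdSimplex ℝ V)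
    (hI : (∑ v, ∑ x, ∑ x₁, p (x, x₁) * ch.infoAt x x₁ fun y₁ => q x x₁ y₁ v) < ch.chanInfo p)
    {η : ℝ} (hη : 0 < η) :
    ch.IsCodable d ((∑ v, ∑ x, ∑ x₁, p (x, x₁) * ch.costAt d x x₁ fun y₁ => q x x₁ y₁ v) + η) := by
  classical
  have hV : Nonempty V := by
    obtain ⟨x⟩ := ‹Nonempty X›
    obtain ⟨x₁⟩ := ‹Nonempty X₁›
    obtain ⟨z⟩ := ch.nonempty_outputs
    by_contra h
    rw [not_nonempty_iff] at h
    have h1 := (hq x x₁ z.2.2.2).2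
    rw [Finset.univ_eq_empty, Finset.sum_empty] at h1
    exact zero_ne_one h1
  choose g _ hg using fun (x : X) (x₁ : X₁) (y : Y) (v : V) =>
    Finset.exists_mem_eq_inf' (Finset.univ_nonempty (α := Shat))
      fun s' => ∑ y₁, q x x₁ y₁ v * ch.costLaw d x x₁ y y₁ s'
  have hcost : ∑ ω, jointLaw ch.stepLaw (fun z => z.2.2.2) p q ω *
      d ω.2.2.1.2.1 (g ω.1 ω.2.1 ω.2.2.1.2.2.1 ω.2.2.2) =
      ∑ v, ∑ x, ∑ x₁, p (x, x₁) * ch.costAt d x x₁ fun y₁ => q x x₁ y₁ v := by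
    rw [ch.sum_jointLaw_mul p q fun x x₁ z v => d z.2.1 (g x x₁ z.2.2.1 v)]
    refine Finset.sum_congr rfl fun v _ => Finset.sum_congr rfl fun x _ =>
      Finset.sum_congr rfl fun x₁ _ => ?_
    rw [ch.sum_stepLaw_mul_dist d x x₁ (fun _ y₁ => q x x₁ y₁ v) fun y => g x x₁ y v, costAt]
    congr 1
    exact Finset.sum_congr rfl fun y _ => (hg x x₁ y v).symm
  have hinfo : ∑ ω, jointLaw ch.stepLaw (fun z => z.2.2.2) p q ω *
      (Real.log (q ω.1 ω.2.1 ω.2.2.1.2.2.2 ω.2.2.2) -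
        Real.log (ch.mix ω.1 ω.2.1 ω.2.2.1.2.2.1 fun y₁ => q ω.1 ω.2.1 y₁ ω.2.2.2)) =
      ∑ v, ∑ x, ∑ x₁, p (x, x₁) * ch.infoAt x x₁ fun y₁ => q x x₁ y₁ v := by
    rw [ch.sum_jointLaw_mul p q fun x x₁ z v => Real.log (q x x₁ z.2.2.2 v) -
        Real.log (ch.mix x x₁ z.2.2.1 fun y₁ => q x x₁ y₁ v)]
    refine Finset.sum_congr rfl fun v _ => Finset.sum_congr rfl fun x _ =>
      Finset.sum_congr rfl fun x₁ _ => ?_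
    rw [ch.sum_stepLaw_mul x x₁ fun y y₁ => q x x₁ y₁ v * (Real.log (q x x₁ y₁ v) -
        Real.log (ch.mix x x₁ y fun y₁ => q x x₁ y₁ v)), infoAt]
    simp only [mul_assoc]
  have hchan : ∑ ω, jointLaw ch.stepLaw (fun z => z.2.2.2) p q ω *
      (Real.log (outLaw ch.stepLaw (fun z => z.2.2.1) ω.1 ω.2.1 ω.2.2.1.2.2.1) -
        Real.log (outLawX ch.stepLaw (fun z => z.2.2.1) p ω.1 ω.2.2.1.2.2.1)) =
      ch.chanInfo p := by
    rw [ch.sum_jointLaw_mul p q fun x x₁ z _ =>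
      Real.log (outLaw ch.stepLaw (fun z => z.2.2.1) x x₁ z.2.2.1) -
        Real.log (outLawX ch.stepLaw (fun z => z.2.2.1) p x z.2.2.1), chanInfo, Finset.sum_comm]
    refine Finset.sum_congr rfl fun x _ => ?_
    rw [Finset.sum_comm]
    refine Finset.sum_congr rfl fun x₁ _ => ?_
    rw [← Finset.mul_sum, Finset.sum_comm]
    simp only [mul_assoc, ← Finset.mul_sum, ← Finset.sum_mul, (hq x x₁ _).2, one_mul]
    rw [ch.sum_stepLaw_mul x x₁ fun y _ =>
      Real.log (outLaw ch.stepLaw (fun z => z.2.2.1) x x₁ y) -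
        Real.log (outLawX ch.stepLaw (fun z => z.2.2.1) p x y)]
    simp only [outLaw_stepLaw, outLawX_stepLaw, ← Finset.sum_mul]
    rfl
  have hmix : ∀ x x₁ y, ∑ v, ch.mix x x₁ y (fun y₁ => q x x₁ y₁ v) ≤ 1 := by
    intro x x₁ y
    by_cases hy : ch.yLaw x x₁ y = 0
    · simp [mix, hy]
    · exact (ch.sum_mix x x₁ y (q x x₁) (fun y₁ => (hq x x₁ y₁).2) hy).le
  have hsupp : ∀ ω : X × X₁ × (S × Sd × Y × Y₁) × V,
      0 < jointLaw ch.stepLaw (fun z => z.2.2.2) p q ω →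
      0 < ch.mix ω.1 ω.2.1 ω.2.2.1.2.2.1 fun y₁ => q ω.1 ω.2.1 y₁ ω.2.2.2 := by
    rintro ⟨x, x₁, z, v⟩ hpos
    have hq0 := (hq x x₁ z.2.2.2).1 v
    have hs : ch.stepLaw x x₁ z ≤ ch.pairLaw x x₁ z.2.2.1 z.2.2.2 := by
      have h1 := Finset.single_le_sum (f := fun s => ∑ sd, ch.stepLaw x x₁ (s, sd, z.2.2))
        (fun s _ => Finset.sum_nonneg fun sd _ => ch.stepLaw_nonneg _ _ _) (Finset.mem_univ z.1)
      exact (Finset.single_le_sum (f := fun sd => ch.stepLaw x x₁ (z.1, sd, z.2.2))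
        (fun sd _ => ch.stepLaw_nonneg _ _ _) (Finset.mem_univ z.2.1)).trans h1
    refine ch.mix_pos x x₁ z.2.2.1 z.2.2.2 (fun y₁ => (hq x x₁ y₁).1 v)
      (((ch.stepLaw_nonneg x x₁ z).lt_of_ne fun h0 => ?_).trans_le hs)
      (hq0.lt_of_ne fun h0 => ?_)
    · simp [jointLaw, ← h0] at hpos
    · simp [jointLaw, ← h0] at hpos
  obtain ⟨N, M, hN, hM, h⟩ := exists_blockScheme ch.stepLaw (fun z => z.2.2.1) (fun z => z.2.2.2)
    (fun z s' => d z.2.1 s') ch.stepLaw_nonneg ch.sum_stepLaw (fun z s' => hd _ _)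
    (fun z s' => hD₀ _ _) (L := 2 * D₀) (by positivity) p hp.1 hp.2 q
    (fun x x₁ y₁ => (hq x x₁ y₁).1) (fun x x₁ y₁ => (hq x x₁ y₁).2)
    (fun x x₁ y v => ch.mix x x₁ y fun y₁ => q x x₁ y₁ v)
    (fun x x₁ y v => ch.mix_nonneg x x₁ y fun y₁ => (hq x x₁ y₁).1 v) hmix hsupp g
    (by rw [hinfo, hchan]; exact hI) hη
  rw [hcost] at h
  refine ch.isCodable_of_blockScheme hd hD₀0.le hD₀ hN hM (add_nonneg ?_ hη.le) h
  exact Finset.sum_nonneg fun v _ => Finset.sum_nonneg fun x _ => Finset.sum_nonneg fun x₁ _ =>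
    mul_nonneg (hp.1 _) (ch.costAt_nonneg x x₁ hd fun y₁ => (hq x x₁ y₁).1 v)

/-- Every value of the single-letter expression can be approached by codes. If the constraint
holds with equality, the auxiliary variable is erased with a small probability, which makes it
strict, unless both sides vanish; in that case the relay is of no use. -/
theorem isCodable_of_mem_letterDistortions {d : Sd → Shat → ℝ} (hd : ∀ sd s', 0 ≤ d sd s')
    {D : ℝ} (hD : D ∈ ch.letterDistortions d) {η : ℝ} (hη : 0 < η) : ch.IsCodable d (D + η) := by
  obtain ⟨D₀, hD₀0, hD₀⟩ := exists_dist_le d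
  obtain ⟨k, p, q, hp, hq, hI, rfl⟩ := (ch.mem_letterDistortions_iff d D).1 hD
  rcases hI.lt_or_eq with hlt | heq
  · exact ch.isCodable_of_lt hd hD₀0 hD₀ p q hp hq hlt hη
  have hinfo0 : ∀ v x x₁, 0 ≤ p (x, x₁) * ch.infoAt x x₁ fun y₁ => q x x₁ y₁ v := fun v x x₁ =>
    mul_nonneg (hp.1 _) (ch.infoAt_nonneg x x₁ fun y₁ => (hq x x₁ y₁).1 v)
  rcases le_or_gt (ch.chanInfo p) 0 with h0 | hpos
  · rw [← heq] at h0
    have hz : ∀ v x x₁, p (x, x₁) * (ch.infoAt x x₁ fun y₁ => q x x₁ y₁ v) = 0 := by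
      intro v x x₁
      have h1 := Finset.single_le_sum (f := fun v => ∑ x, ∑ x₁, p (x, x₁) *
        ch.infoAt x x₁ fun y₁ => q x x₁ y₁ v) (fun v _ => Finset.sum_nonneg fun x _ =>
          Finset.sum_nonneg fun x₁ _ => hinfo0 v x x₁) (Finset.mem_univ v)
      have h2 := Finset.single_le_sum (f := fun x => ∑ x₁, p (x, x₁) *
        ch.infoAt x x₁ fun y₁ => q x x₁ y₁ v) (fun x _ =>
          Finset.sum_nonneg fun x₁ _ => hinfo0 v x x₁) (Finset.mem_univ x)
      have h3 := Finset.single_le_sum (f := fun x₁ => p (x, x₁) *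
        ch.infoAt x x₁ fun y₁ => q x x₁ y₁ v) (fun x₁ _ => hinfo0 v x x₁) (Finset.mem_univ x₁)
      exact le_antisymm (h3.trans (h2.trans (h1.trans h0))) (hinfo0 v x x₁)
    have hb : ch.bayesCost p q d = ∑ a, p a * ch.costAt d a.1 a.2 fun _ => 1 := by
      rw [bayesCost, Fintype.sum_prod_type, Finset.sum_comm]
      refine Finset.sum_congr rfl fun x _ => ?_
      rw [Finset.sum_comm]
      refine Finset.sum_congr rfl fun x₁ _ => ?_
      rw [← Finset.mul_sum]
      by_cases hpx : p (x, x₁) = 0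
      · rw [hpx, zero_mul, zero_mul]
      · rw [ch.sum_costAt_of_infoAt_eq_zero x x₁ d (q x x₁) (hq x x₁) fun v =>
          (mul_eq_zero.1 (hz v x x₁)).resolve_left hpx]
    obtain ⟨a, -, ha⟩ := exists_le_mean p (fun a => ch.costAt d a.1 a.2 fun _ => 1) hp.1 hp.2
    obtain ⟨B, hB⟩ := ch.isCodable_const hd hD₀0.le hD₀ a.1 a.2
    refine ⟨B, fun M n hM hn => ?_⟩
    obtain ⟨c, hc⟩ := hB M n hM hn
    refine ⟨c, hc.trans ?_⟩
    rw [hb]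
    linarith
  -- `θ` is the probability of erasure; an erasure costs at most `D₀`
  · set θ : ℝ := min 1 (η / (2 * D₀)) with hθ
    have hθ0 : 0 < θ := lt_min one_pos (by positivity)
    have hθ1 : θ ≤ 1 := min_le_left _ _
    have hθD : θ * D₀ ≤ η / 2 := by
      calc θ * D₀ ≤ η / (2 * D₀) * D₀ := mul_le_mul_of_nonneg_right (min_le_right _ _) hD₀0.le
        _ = η / 2 := by field_simp
    have h1θ : 0 ≤ 1 - θ := sub_nonneg.2 hθ1
    let q' : X → X₁ → Y₁ → Option (Fin k) → ℝ := fun x x₁ y₁ v =>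
      v.elim θ fun v => (1 - θ) * q x x₁ y₁ v
    have hq' : ∀ x x₁ y₁, q' x x₁ y₁ ∈ stdSimplex ℝ (Option (Fin k)) := by
      refine fun x x₁ y₁ => ⟨?_, ?_⟩
      · rintro (_ | v)
        · exact hθ0.le
        · exact mul_nonneg h1θ ((hq x x₁ y₁).1 v)
      · rw [Fintype.sum_option]
        simp only [q', Option.elim_none, Option.elim_some]
        rw [← Finset.mul_sum, (hq x x₁ y₁).2]
        ring
    have h1 : (∑ v, ∑ x, ∑ x₁, p (x, x₁) * ch.infoAt x x₁ fun y₁ => q' x x₁ y₁ v) =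
        (1 - θ) * ∑ v, ∑ x, ∑ x₁, p (x, x₁) * ch.infoAt x x₁ fun y₁ => q x x₁ y₁ v := by
      rw [Fintype.sum_option]
      simp only [q', Option.elim_none, Option.elim_some, infoAt_const, mul_zero,
        Finset.sum_const_zero, zero_add, Finset.mul_sum]
      refine Finset.sum_congr rfl fun v _ => Finset.sum_congr rfl fun x _ =>
        Finset.sum_congr rfl fun x₁ _ => ?_
      rw [ch.infoAt_smul x x₁ h1θ fun y₁ => (hq x x₁ y₁).1 v]
      ring
    have h2 : (∑ v, ∑ x, ∑ x₁, p (x, x₁) * ch.costAt d x x₁ fun y₁ => q' x x₁ y₁ v) ≤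
        ch.bayesCost p q d + η / 2 := by
      rw [Fintype.sum_option]
      simp only [q', Option.elim_none, Option.elim_some, costAt_smul _ _ _ _ h1θ]
      have h3 : ∑ x, ∑ x₁, p (x, x₁) * (ch.costAt d x x₁ fun _ => θ) ≤ θ * D₀ := by
        have h4 : ∀ x x₁, (ch.costAt d x x₁ fun _ => θ) ≤ θ * D₀ := fun x x₁ => by
          have h5 := ch.costAt_smul x x₁ d hθ0.le fun _ => 1
          simp only [mul_one] at h5
          rw [h5]
          exact mul_le_mul_of_nonneg_left (ch.costAt_one_le x x₁ hD₀) hθ0.le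
        calc _ ≤ ∑ x, ∑ x₁, p (x, x₁) * (θ * D₀) := Finset.sum_le_sum fun x _ =>
              Finset.sum_le_sum fun x₁ _ => mul_le_mul_of_nonneg_left (h4 x x₁) (hp.1 _)
          _ = θ * D₀ := by
              rw [← Fintype.sum_prod_type' (f := fun x x₁ => p (x, x₁) * (θ * D₀)),
                ← Finset.sum_mul, hp.2, one_mul]
      have h6 : (∑ v, ∑ x, ∑ x₁, p (x, x₁) * ((1 - θ) * ch.costAt d x x₁ fun y₁ => q x x₁ y₁ v)) ≤
          ch.bayesCost p q d := by
        refine Finset.sum_le_sum fun v _ => Finset.sum_le_sum fun x _ => Finset.sum_le_sum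
          fun x₁ _ => mul_le_mul_of_nonneg_left ?_ (hp.1 _)
        exact mul_le_of_le_one_left (ch.costAt_nonneg x x₁ hd fun y₁ => (hq x x₁ y₁).1 v)
          (by linarith)
      linarith
    obtain ⟨B, hB⟩ := ch.isCodable_of_lt hd hD₀0 hD₀ p q' hp hq'
      (by rw [h1, heq]; nlinarith) (half_pos hη)
    refine ⟨B, fun M n hM hn => ?_⟩
    obtain ⟨c, hc⟩ := hB M n hM hn
    exact ⟨c, hc.trans (by linarith)⟩

end Achievability

end RelayChannel

/-! ### Existence of the minimum -/

namespace RelayChannel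

open LetterOutcome

variable {X X₁ S Sd Shat Y Y₁ : Type*} [Fintype X] [Fintype X₁] [Fintype S] [Fintype Sd]
  [Fintype Y] [Fintype Y₁]

section Continuity

variable {T : Type*} [TopologicalSpace T]

theorem continuous_pmfOf {Ω α : Type*} [Fintype Ω] {P : T → Ω → ℝ} (hP : Continuous P) (A : Ω → α)
    (a : α) : Continuous fun τ => pmfOf (P τ) A a := by
  refine continuous_finsetSum _ fun ω _ => ?_
  split_ifs
  · exact (continuous_apply ω).comp hP
  · exact continuous_const

theorem continuous_entropy {Ω α : Type*} [Fintype Ω] [Fintype α] {P : T → Ω → ℝ}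
    (hP : Continuous P) (A : Ω → α) : Continuous fun τ => entropy (P τ) A := by
  refine (continuous_finsetSum _ fun a _ => ?_).neg
  simp only [Real.logb, ← mul_div_assoc]
  exact (Real.continuous_mul_log.comp (continuous_pmfOf hP A a)).div_const _

theorem continuous_condMutualInfo {Ω α β γ : Type*} [Fintype Ω] [Fintype α] [Fintype β] [Fintype γ]
    {P : T → Ω → ℝ} (hP : Continuous P) (A : Ω → α) (B : Ω → β) (C : Ω → γ) :
    Continuous fun τ => condMutualInfo (P τ) A B C :=
  ((continuous_entropy hP _).sub (continuous_entropy hP _)).sub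
    ((continuous_entropy hP _).sub (continuous_entropy hP _))

variable (ch : RelayChannel X X₁ S Sd Y Y₁)

omit [Fintype X] [Fintype X₁] in
theorem continuous_letterPMF (k : ℕ) : Continuous
    fun τ : (X × X₁ → ℝ) × (X → X₁ → Y₁ → Fin k → ℝ) => ch.letterPMF τ.1 τ.2 := by
  refine continuous_pi fun ⟨x, x₁, s, sd, y, y₁, v⟩ => ?_
  simp only [letterPMF]
  fun_prop

theorem continuous_bayesCost [Fintype Shat] [Nonempty Shat] (d : Sd → Shat → ℝ) (k : ℕ) :
    Continuous fun τ : (X × X₁ → ℝ) × (X → X₁ → Y₁ → Fin k → ℝ) =>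
      ch.bayesCost τ.1 τ.2 d := by
  simp only [bayesCost, costAt]
  refine continuous_finsetSum _ fun v _ => continuous_finsetSum _ fun x _ =>
    continuous_finsetSum _ fun x₁ _ => Continuous.mul (by fun_prop) <|
    continuous_finsetSum _ fun y _ => ?_
  refine Continuous.finset_inf'_apply _ fun s' _ => ?_
  fun_prop

end Continuity

section Minimum

variable (ch : RelayChannel X X₁ S Sd Y Y₁) [Fintype Shat] [Nonempty Shat]

/-- Alphabets of a fixed size suffice for the auxiliary variable. By Carathéodory's theorem, the
mean of the columns, together with their contributions to constraint and distortion, is a convex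
combination of few of them; by homogeneity, the columns may be rescaled by the weights. -/
theorem exists_bounded_alphabet [Nonempty X] [Nonempty X₁] (d : Sd → Shat → ℝ) : ∃ K : ℕ,
    ∀ (k : ℕ) (p : X × X₁ → ℝ) (q : X → X₁ → Y₁ → Fin k → ℝ),
      (∀ x x₁ y₁, q x x₁ y₁ ∈ stdSimplex ℝ (Fin k)) →
      ∃ q' : X → X₁ → Y₁ → Fin K → ℝ, (∀ x x₁ y₁, q' x x₁ y₁ ∈ stdSimplex ℝ (Fin K)) ∧
        (∑ v, ∑ x, ∑ x₁, p (x, x₁) * ch.infoAt x x₁ fun y₁ => q' x x₁ y₁ v) =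
          (∑ v, ∑ x, ∑ x₁, p (x, x₁) * ch.infoAt x x₁ fun y₁ => q x x₁ y₁ v) ∧
        ch.bayesCost p q' d = ch.bayesCost p q d := by
  refine ⟨Module.finrank ℝ ((X × X₁ × Y₁ → ℝ) × ℝ × ℝ) + 1, fun k p q hq => ?_⟩
  have hk : 0 < k := by
    obtain ⟨x⟩ := ‹Nonempty X›
    obtain ⟨x₁⟩ := ‹Nonempty X₁›
    obtain ⟨z⟩ := ch.nonempty_outputs
    by_contra h
    obtain rfl : k = 0 := by omega
    have h1 := (hq x x₁ z.2.2.2).2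
    rw [Finset.univ_eq_empty, Finset.sum_empty] at h1
    exact zero_ne_one h1
  have hk0 : (0 : ℝ) < k := by exact_mod_cast hk
  let I : Fin k → ℝ := fun v => ∑ x, ∑ x₁, p (x, x₁) * ch.infoAt x x₁ fun y₁ => q x x₁ y₁ v
  let C : Fin k → ℝ := fun v => ∑ x, ∑ x₁, p (x, x₁) * ch.costAt d x x₁ fun y₁ => q x x₁ y₁ v
  let f : Fin k → ((X × X₁ × Y₁ → ℝ) × ℝ × ℝ) := fun v => (fun a => q a.1 a.2.1 a.2.2 v, I v, C v)
  have hmean : ∑ v, (1 / (k : ℝ)) • f v ∈ convexHull ℝ (Set.range f) := by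
    refine (convex_convexHull ℝ _).sum_mem (fun _ _ => by positivity) ?_ fun v _ =>
      subset_convexHull ℝ _ ⟨v, rfl⟩
    simp [hk0.ne']
  obtain ⟨ι, _, z, w, hz, hind, hw0, hw1, hw⟩ := eq_pos_convex_span_of_mem_convexHull hmean
  choose u hu using fun i => hz ⟨i, rfl⟩
  have hcard : Fintype.card ι ≤
      Fintype.card (Fin (Module.finrank ℝ ((X × X₁ × Y₁ → ℝ) × ℝ × ℝ) + 1)) := by
    rw [Fintype.card_fin]
    exact hind.card_le_finrank_succ.trans (Nat.succ_le_succ (Submodule.finrank_le _))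
  obtain ⟨e⟩ := Function.Embedding.nonempty_of_card_le hcard
  -- the sum of the columns is `k` times their mean
  have hw' : ∑ i, (k * w i) • f (u i) = ∑ v, f v := by
    have h1 := congrArg (fun a => (k : ℝ) • a) hw
    simp only [Finset.smul_sum, smul_smul, mul_one_div_cancel hk0.ne', one_smul] at h1
    rw [← h1]
    simp only [hu]
  have hwk : ∀ i, 0 ≤ k * w i := fun i => mul_nonneg hk0.le (hw0 i).le
  let q' : X → X₁ → Y₁ → Fin (Module.finrank ℝ ((X × X₁ × Y₁ → ℝ) × ℝ × ℝ) + 1) → ℝ :=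
    fun x x₁ y₁ => Function.extend e (fun i => k * w i * q x x₁ y₁ (u i)) 0
  have hq'e : ∀ x x₁ y₁ i, q' x x₁ y₁ (e i) = k * w i * q x x₁ y₁ (u i) := fun x x₁ y₁ i =>
    e.injective.extend_apply _ _ _
  have hq'0 : ∀ x x₁ y₁ v, v ∉ Set.range e → q' x x₁ y₁ v = 0 := fun x x₁ y₁ v hv =>
    Function.extend_apply' _ _ _ fun ⟨i, hi⟩ => hv ⟨i, hi⟩
  refine ⟨q', fun x x₁ y₁ => ⟨fun v => ?_, ?_⟩, ?_, ?_⟩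
  · by_cases hv : v ∈ Set.range e
    · obtain ⟨i, rfl⟩ := hv
      rw [hq'e]
      exact mul_nonneg (hwk i) ((hq x x₁ y₁).1 _)
    · exact (hq'0 x x₁ y₁ v hv).ge
  · have h1 := congrFun (congrArg Prod.fst hw') (x, x₁, y₁)
    simp only [Prod.fst_sum, Finset.sum_apply, Prod.smul_fst, Pi.smul_apply, smul_eq_mul, f,
      (hq x x₁ y₁).2] at h1
    rw [← h1]
    exact (Fintype.sum_of_injective e e.injective _ _ (hq'0 x x₁ y₁)
      fun i => (hq'e x x₁ y₁ i).symm).symm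
  · have h1 := congrArg (fun a : ((X × X₁ × Y₁ → ℝ) × ℝ × ℝ) => a.2.1) hw'
    simp only [Prod.snd_sum, Prod.fst_sum, Prod.smul_snd, Prod.smul_fst, smul_eq_mul, f, I] at h1
    rw [← h1]
    refine (Fintype.sum_of_injective e e.injective _ _ (fun v hv => ?_) fun i => ?_).symm
    · simp only [hq'0 _ _ _ v hv, infoAt_const, mul_zero, Finset.sum_const_zero]
    · simp only [hq'e, Finset.mul_sum]
      refine Finset.sum_congr rfl fun x _ => Finset.sum_congr rfl fun x₁ _ => ?_
      rw [ch.infoAt_smul x x₁ (hwk i) fun y₁ => (hq x x₁ y₁).1 _]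
      ring
  · have h1 := congrArg (fun a : ((X × X₁ × Y₁ → ℝ) × ℝ × ℝ) => a.2.2) hw'
    simp only [Prod.snd_sum, Prod.smul_snd, smul_eq_mul, f, C] at h1
    rw [bayesCost, bayesCost, ← h1]
    refine (Fintype.sum_of_injective e e.injective _ _ (fun v hv => ?_) fun i => ?_).symm
    · have h2 : ∀ x x₁, (ch.costAt d x x₁ fun _ => 0) = 0 := fun x x₁ => by
        simpa using ch.costAt_smul x x₁ d le_rfl fun _ => 0
      simp only [hq'0 _ _ _ v hv, h2, mul_zero, Finset.sum_const_zero]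
    · simp only [hq'e, Finset.mul_sum]
      refine Finset.sum_congr rfl fun x _ => Finset.sum_congr rfl fun x₁ _ => ?_
      rw [ch.costAt_smul x x₁ d (hwk i)]
      ring

theorem exists_isLeast_letterDistortions [Nonempty X] [Nonempty X₁] (d : Sd → Shat → ℝ) :
    ∃ D, IsLeast (ch.letterDistortions d) D := by
  obtain ⟨K, hK⟩ := ch.exists_bounded_alphabet d
  let A : Set ((X × X₁ → ℝ) × (X → X₁ → Y₁ → Fin K → ℝ)) :=
    (stdSimplex ℝ (X × X₁) ×ˢ Set.univ.pi fun _ => Set.univ.pi fun _ => Set.univ.pi fun _ =>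
      stdSimplex ℝ (Fin K)) ∩
    {τ | condMutualInfo (ch.letterPMF τ.1 τ.2) rvV rvY₁ rvXX₁Y ≤
      condMutualInfo (ch.letterPMF τ.1 τ.2) rvX₁ rvY rvX}
  have hA : IsCompact A := by
    refine IsCompact.inter_right ((isCompact_stdSimplex ℝ _).prod (isCompact_univ_pi fun _ =>
      isCompact_univ_pi fun _ => isCompact_univ_pi fun _ => isCompact_stdSimplex ℝ _)) ?_
    exact isClosed_le (continuous_condMutualInfo (ch.continuous_letterPMF K) _ _ _)
      (continuous_condMutualInfo (ch.continuous_letterPMF K) _ _ _)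
  have hmem : ∀ p q, (p, q) ∈ A ↔ p ∈ stdSimplex ℝ (X × X₁) ∧
      (∀ x x₁ y₁, q x x₁ y₁ ∈ stdSimplex ℝ (Fin K)) ∧
      (∑ v, ∑ x, ∑ x₁, p (x, x₁) * ch.infoAt x x₁ fun y₁ => q x x₁ y₁ v) ≤ ch.chanInfo p := by
    intro p q
    simp only [A, Set.mem_inter_iff, Set.mem_prod, Set.mem_univ_pi, Set.mem_ofPred_eq, and_assoc]
    exact and_congr_right fun hp => and_congr_right fun hq => ch.condMutualInfo_le_iff p q hp hq
  have himage : ∀ D, D ∈ ch.letterDistortions d ↔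
      D ∈ (fun τ : (X × X₁ → ℝ) × (X → X₁ → Y₁ → Fin K → ℝ) => ch.bayesCost τ.1 τ.2 d) '' A := by
    intro D
    rw [mem_letterDistortions_iff]
    constructor
    · rintro ⟨k, p, q, hp, hq, hI, rfl⟩
      obtain ⟨q', hq', hI', hC'⟩ := hK k p q hq
      exact ⟨(p, q'), (hmem p q').2 ⟨hp, hq', hI'.le.trans hI⟩, hC'⟩
    · rintro ⟨⟨p, q⟩, hA, rfl⟩
      obtain ⟨hp, hq, hI⟩ := (hmem p q).1 hA
      exact ⟨K, p, q, hp, hq, hI, rfl⟩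
  have hne : (ch.letterDistortions d).Nonempty := by
    obtain ⟨x⟩ := ‹Nonempty X›
    obtain ⟨x₁⟩ := ‹Nonempty X₁›
    obtain ⟨s'⟩ := ‹Nonempty Shat›
    obtain ⟨z⟩ := ch.nonempty_outputs
    obtain ⟨D, hD, -⟩ := ch.exists_mem_letterDistortions_le d one_pos one_pos z.2.2
      (⟨fun _ _ => x, fun _ _ => x₁, fun _ => 0, fun _ _ => s'⟩ : RelayCode X X₁ Y Y₁ Shat 1 1)
    exact ⟨D, hD⟩
  rw [Set.ext himage] at hne ⊢
  exact (hA.image (ch.continuous_bayesCost d K)).exists_isLeast hne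

end Minimum

end RelayChannel

/-! ### The minimum distortion -/

namespace RelayChannel

variable {X X₁ S Sd Shat Y Y₁ : Type*} [Fintype S] [Fintype Sd] [Fintype Y] [Fintype Y₁]

section Operational

variable (ch : RelayChannel X X₁ S Sd Y Y₁) {M n : ℕ}

theorem codeDistortion_nonneg {d : Sd → Shat → ℝ} (hd : ∀ sd s', 0 ≤ d sd s')
    (c : RelayCode X X₁ Y Y₁ Shat M n) : 0 ≤ ch.codeDistortion d c := by
  rw [codeDistortion_eq]
  exact mul_nonneg (by positivity) (Finset.sum_nonneg fun w _ => Finset.sum_nonneg fun i _ =>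
    Finset.sum_nonneg fun u _ => mul_nonneg (ch.outLawExcept_nonneg _ _ _)
      (ch.costLaw_nonneg hd _ _ _ _ _))

theorem codeDistortion_le (t₀ : Y × Y₁) {d : Sd → Shat → ℝ} {D₀ : ℝ} (hD₀0 : 0 ≤ D₀)
    (hD₀ : ∀ sd s', d sd s' ≤ D₀) (c : RelayCode X X₁ Y Y₁ Shat M n) :
    ch.codeDistortion d c ≤ D₀ := by
  have : Nonempty (Y × Y₁) := ⟨t₀⟩
  set rel : Fin n → (Fin n → Y₁) → X₁ := fun i y₁ =>
    c.relay i fun j => y₁ (Fin.castLE i.isLt.le j) with hrel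
  have hcausal : IsCausal rel := c.isCausal
  rw [codeDistortion_eq]
  have h1 : ∀ w i, ∑ u : Fin n → Y × Y₁, ch.outLawExcept c.enc rel w i u *
      ch.costLaw d (c.enc w i) (rel i fun j => (u j).2) (u i).1 (u i).2
        (c.est (fun j => (u j).1) i) ≤ D₀ := by
    intro w i
    calc _ ≤ ∑ u : Fin n → Y × Y₁, (∏ j, ch.outKernel c.enc rel w j u (u j)) * D₀ := by
          refine Finset.sum_le_sum fun u _ => ?_
          rw [← ch.outKernel_mul_outLawExcept w i u, mul_assoc]
          exact mul_le_mul_of_nonneg_left (ch.costLaw_le _ _ _ _ hD₀ _)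
            (ch.outLawExcept_nonneg _ _ _)
      _ = D₀ := by
          rw [← Finset.sum_mul, sum_causal_prod_eq_one _ (ch.outKernel_causal hcausal w)
            (ch.sum_outKernel w), one_mul]
  calc _ ≤ 1 / ((M : ℝ) * n) * ∑ _w : Fin M, ∑ _i : Fin n, D₀ :=
        mul_le_mul_of_nonneg_left (Finset.sum_le_sum fun w _ => Finset.sum_le_sum fun i _ => h1 w i)
          (by positivity)
    _ = ((M : ℝ) * n) / (M * n) * D₀ := by
        simp only [Finset.sum_const, Finset.card_univ, Fintype.card_fin, nsmul_eq_mul]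
        ring
    _ ≤ D₀ := mul_le_of_le_one_left hD₀0 (div_self_le_one _)

theorem errorProb_eq_zero (hM : M = 1) (c : RelayCode X X₁ Y Y₁ Shat M n) :
    ch.errorProb c = 0 := by
  subst hM
  refine Finset.sum_eq_zero fun ω _ => if_neg fun h => ?_
  exact h (Subsingleton.elim _ _)

end Operational

variable [Fintype X] [Nonempty X] [Fintype X₁] [Nonempty X₁] [Fintype Shat] [Nonempty Shat]
  (ch : RelayChannel X X₁ S Sd Y Y₁)

/-- The code of each length is bounded on its own; the message error plays no role. -/
theorem le_of_achievable {d : Sd → Shat → ℝ} {D₁ : ℝ}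
    (hD₁ : D₁ ∈ lowerBounds (ch.letterDistortions d)) {R D : ℝ} (h : ch.Achievable d R D) :
    D₁ ≤ D := by
  obtain ⟨z⟩ := ch.nonempty_outputs
  obtain ⟨D₀, hD₀0, hD₀⟩ := exists_dist_le d
  obtain ⟨-, c, -, hlim⟩ := h
  refine le_trans (le_limsup_of_frequently_le (Eventually.frequently ?_) ?_) hlim
  · filter_upwards [eventually_gt_atTop 0] with n hn
    obtain ⟨D, hD, hle⟩ := ch.exists_mem_letterDistortions_le d (by positivity) hn z.2.2 (c n)
    exact (hD₁ hD).trans hle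
  · exact isBoundedUnder_of ⟨D₀, fun n => ch.codeDistortion_le z.2.2 hD₀0.le hD₀ (c n)⟩

omit [Fintype X] [Fintype X₁] [Fintype Shat] in
/-- For every length, a code of almost minimal distortion is chosen, so that one sequence of codes
serves all `η`. At rate zero there is a single message, and no decoding error. -/
theorem achievable_of_forall_isCodable {d : Sd → Shat → ℝ} (hd : ∀ sd s', 0 ≤ d sd s') {D : ℝ}
    (h : ∀ η > 0, ch.IsCodable d (D + η)) : ch.Achievable d 0 D := by
  have hne : ∀ n : ℕ, Nonempty (RelayCode X X₁ Y Y₁ Shat (2 ^ ⌈(n : ℝ) * 0⌉₊) n) := fun n =>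
    ⟨⟨fun _ _ => Classical.arbitrary X, fun _ _ => Classical.arbitrary X₁,
      fun _ => ⟨0, by positivity⟩, fun _ _ => Classical.arbitrary Shat⟩⟩
  have hc : ∀ n : ℕ, ∃ c : RelayCode X X₁ Y Y₁ Shat (2 ^ ⌈(n : ℝ) * 0⌉₊) n,
      ∀ c' : RelayCode X X₁ Y Y₁ Shat (2 ^ ⌈(n : ℝ) * 0⌉₊) n,
        ch.codeDistortion d c ≤ ch.codeDistortion d c' + 1 / (n + 1 : ℝ) := by
    intro n
    obtain ⟨c, hc⟩ := exists_lt_of_ciInf_lt (lt_add_of_pos_right (⨅ c : RelayCode X X₁ Y Y₁ Shat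
      (2 ^ ⌈(n : ℝ) * 0⌉₊) n, ch.codeDistortion d c) (Nat.one_div_pos_of_nat (α := ℝ) (n := n)))
    refine ⟨c, fun c' => hc.le.trans (add_le_add_left (ciInf_le ⟨0, ?_⟩ c') _)⟩
    rintro _ ⟨c, rfl⟩
    exact ch.codeDistortion_nonneg hd c
  choose c hc using hc
  refine ⟨le_rfl, c, ?_, le_of_forall_pos_le_add fun η hη => ?_⟩
  · simp only [fun n => ch.errorProb_eq_zero (by simp) (c n)]
    exact tendsto_const_nhds
  · obtain ⟨B, hB⟩ := h (η / 2) (half_pos hη)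
    have hlim : Tendsto (fun n : ℕ => B / (n : ℝ) + 1 / (n + 1 : ℝ)) atTop (𝓝 (0 + 0)) :=
      (tendsto_const_div_atTop_nhds_zero_nat B).add tendsto_one_div_add_atTop_nhds_zero_nat
    rw [add_zero] at hlim
    refine limsup_le_of_le (isBoundedUnder_of ⟨0, fun n =>
      ch.codeDistortion_nonneg hd (c n)⟩ : IsBoundedUnder (· ≥ ·) atTop _).isCoboundedUnder_le ?_
    filter_upwards [eventually_gt_atTop 0, hlim.eventually_lt_const (half_pos hη)] with n hn hlt
    obtain ⟨c', hc'⟩ := hB (2 ^ ⌈(n : ℝ) * 0⌉₊) n (by positivity) hn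
    linarith [hc n c']

end RelayChannel

end RelayISAC

theorem theorem3 {X X₁ S Sd Shat Y Y₁ : Type*}
    [Fintype X] [Nonempty X] [Fintype X₁] [Nonempty X₁] [Fintype S] [Fintype Sd]
    [Fintype Shat] [Nonempty Shat] [Fintype Y] [Fintype Y₁]
    (ch : RelayISAC.RelayChannel X X₁ S Sd Y Y₁)
    (d : Sd → Shat → ℝ) (hd : ∀ sd s', 0 ≤ d sd s') :
    IsLeast (ch.achievableDistortions d) (ch.minDistortion d) ∧
      IsLeast (ch.letterDistortions d) (ch.minDistortion d) := by
  obtain ⟨D, hD⟩ := ch.exists_isLeast_letterDistortions d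
  have h : IsLeast (ch.achievableDistortions d) D :=
    ⟨⟨0, ch.achievable_of_forall_isCodable hd fun η hη =>
      ch.isCodable_of_mem_letterDistortions hd hD.1 hη⟩,
    fun D' ⟨R, hR⟩ => ch.le_of_achievable hD.2 hR⟩
  have hmin : ch.minDistortion d = D := h.csInf_eq
  rw [hmin]
  exact ⟨h, hD⟩
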